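/- Let $G$ be a noncompact connected (real, finite-dimensional, smooth) Lie group with identity $e$, let $\rho$ be a right Haar measure on $G$, let $\chi\colon G\to(0,\infty)$ be a continuous positive character, and let $\mu_\chi$ be the measure with density $\chi$ with respect to $\rho$. Let $\mathbf X=\{X_1,\dots,X_\ell\}$ be a family of linearly independent left-invariant vector fields on $G$ satisfying Hörmander's condition, and let $B_r$ be the ball with centre $e$ and radius $r$ for the associated Carnot–Carathéodory distance. Write $\nabla u\cdot\nabla w=\sum_{j}(X_ju)(X_jw)$, $|\nabla u|^2=\sum_{j}(X_ju)^2$ and $$\Delta_\chi=-\sum_{j=1}^{\ell}\bigl(X_j^2+(X_j\chi)(e)X_j\bigr).$$ Let $M\in L^1(\mu_\chi)$ be a positive $C^2$ function, let $\mu_{\chi,M}$ be the finite measure with density $M$ with respect to $\mu_\chi$, and let $\Delta_{\chi,M}=\Delta_\chi-\nabla(\log M)\cdot\nabla$. A Lyapunov function for $(\Delta_\chi,M)$ is a $C^2$ function $W\colon G\to[1,\infty)$ for which there are constants $\theta>0$, $b\ge 0$, $R'>0$ such that $$-\Delta_{\chi,M}W(x)\le-\theta W(x)+b\,\mathbf 1_{B_{R'}}(x)\qquad\text{for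 all }x\in G.$$ Let $v=-\log M$, and suppose that there exist $a\in(0,1)$, $c>0$ and $R>0$ such that $$a|\nabla v|^2(x)+\Delta_\chi v(x)\ge c\qquad\text{for all }x\in G\setminus B_R.$$ Then $v$ is bounded below and $W=e^{(1-a)(v-\inf_G v)}$ is a Lyapunov function for $(\Delta_\chi,M)$; in particular $(\Delta_\chi,M)$ admits a Lyapunov function. Moreover, there is a constant $C=C(G,\mathbf X,\chi,M)$ such that $$\Bigl\|f-\frac1{\mu_{\chi,M}(G)}\int_G f\,d\mu_{\chi,M}\Bigr\|_{L^2(\mu_{\chi,M})}\le C\,\bigl\||\nabla f|\bigr\|_{L^2(\mu_{\chi,M})}$$ for all real-valued $f\in L^2(\mu_{\chi,M})$ whose distributional derivatives $X_1f,\dots,X_\ell f$ are locally integrable functions with $|\nabla f|\in L^2(\mu_{\chi,M})$. -/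

import Mathlib

open MeasureTheory Set
open scoped Manifold ContDiff ENNReal NNReal

noncomputable section

namespace SubRiemannianLie

variable {E : Type*} [NormedAddCommGroup E] [NormedSpace ℝ E]
  {G : Type*} [TopologicalSpace G] [ChartedSpace E G] [Group G] {ℓ : ℕ}

/-- The derivative `Y u` of a function `u` along the left-invariant vector field on `G` whose value
at the identity is `Y`. -/
def lieDeriv (Y : GroupLieAlgebra 𝓘(ℝ, E) G) (u : G → ℝ) (x : G) : ℝ :=
  mfderiv 𝓘(ℝ, E) 𝓘(ℝ, ℝ) u x (mulInvariantVectorField Y x)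

/-- Hörmander's condition for the left-invariant vector fields `X₁, …, X_ℓ`: the Lie algebra they
generate is the whole Lie algebra of `G`, i.e. the only linear subspace of the Lie algebra that
contains every `X j` and is closed under the Lie bracket is the whole Lie algebra. -/
def HormanderCondition (X : Fin ℓ → GroupLieAlgebra 𝓘(ℝ, E) G) : Prop :=
  ∀ S : Submodule ℝ (GroupLieAlgebra 𝓘(ℝ, E) G),
    (∀ j, X j ∈ S) → (∀ u ∈ S, ∀ v ∈ S, ⁅u, v⁆ ∈ S) → S = ⊤

/-- `γ : [0, T] → G` is a subunit curve for `X`: it is absolutely continuous and, for almost every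
`t`, `γ'(t) = ∑ j, α j (t) X j (γ t)` with measurable coefficients such that
`∑ j, α j (t) ^ 2 ≤ 1`. A curve in a manifold is absolutely continuous when it is continuous and
its composition with every smooth function is absolutely continuous. -/
structure IsSubunitCurve (X : Fin ℓ → GroupLieAlgebra 𝓘(ℝ, E) G) (T : ℝ) (γ : ℝ → G) : Prop where
  continuousOn : ContinuousOn γ (Icc 0 T)
  absolutelyContinuous : ∀ f : G → ℝ, ContMDiff 𝓘(ℝ, E) 𝓘(ℝ, ℝ) ∞ f →
    AbsolutelyContinuousOnInterval (fun t => f (γ t)) 0 T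
  velocity : ∃ α : ℝ → Fin ℓ → ℝ, Measurable α ∧
    ∀ᵐ t ∂(volume.restrict (Ioo 0 T)), ∑ j, α t j ^ 2 ≤ 1 ∧
      HasMFDerivAt 𝓘(ℝ, ℝ) 𝓘(ℝ, E) γ t
        ((1 : ℝ →L[ℝ] ℝ).smulRight (∑ j, α t j • mulInvariantVectorField (X j) (γ t)))

/-- The Carnot–Carathéodory distance of `X`: the infimum of the `T ≥ 0` for which a subunit curve
on `[0, T]` joins `x` to `y`. It is written with values in `[0, ∞]`; the value `∞` would mean that
no subunit curve joins the two points. -/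
def ccDist (X : Fin ℓ → GroupLieAlgebra 𝓘(ℝ, E) G) (x y : G) : ℝ≥0∞ :=
  ⨅ (T : ℝ≥0) (_ : ∃ γ : ℝ → G, IsSubunitCurve X T γ ∧ γ 0 = x ∧ γ T = y), (T : ℝ≥0∞)

/-- The Carnot–Carathéodory ball `B_R` centred at the identity. -/
def ccBall (X : Fin ℓ → GroupLieAlgebra 𝓘(ℝ, E) G) (R : ℝ) : Set G :=
  {x | ccDist X x 1 < ENNReal.ofReal R}

/-- `∇u · ∇w = ∑ j, (X j u) (X j w)`. -/
def gradInner (X : Fin ℓ → GroupLieAlgebra 𝓘(ℝ, E) G) (u w : G → ℝ) (x : G) : ℝ :=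
  ∑ j, lieDeriv (X j) u x * lieDeriv (X j) w x

/-- `|∇u|² = ∑ j, (X j u)²`. -/
def gradSq (X : Fin ℓ → GroupLieAlgebra 𝓘(ℝ, E) G) (u : G → ℝ) (x : G) : ℝ :=
  ∑ j, lieDeriv (X j) u x ^ 2

/-- The sub-Laplacian with drift `Δ_χ = -∑ j, (X j ² + (X j χ)(e) X j)`. -/
def subLaplacian (X : Fin ℓ → GroupLieAlgebra 𝓘(ℝ, E) G) (χ : G → ℝ) (u : G → ℝ) (x : G) : ℝ :=
  -∑ j, (lieDeriv (X j) (lieDeriv (X j) u) x + lieDeriv (X j) χ 1 * lieDeriv (X j) u x)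

/-- The weighted operator `Δ_{χ,M} = Δ_χ - ∇(log M) · ∇`. -/
def weightedLaplacian (X : Fin ℓ → GroupLieAlgebra 𝓘(ℝ, E) G) (χ M : G → ℝ) (u : G → ℝ)
    (x : G) : ℝ :=
  subLaplacian X χ u x - gradInner X (fun y => Real.log (M y)) u x

/-- `W` is a Lyapunov function for `(Δ_χ, M)`: it is `C²`, takes values in `[1, ∞)`, and satisfies
`-Δ_{χ,M} W ≤ -θ W + b 1_{B_R}` on `G` for some `θ > 0`, `b ≥ 0` and `R > 0`. -/
def IsLyapunovFunction (X : Fin ℓ → GroupLieAlgebra 𝓘(ℝ, E) G) (χ M W : G → ℝ) : Prop :=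
  ContMDiff 𝓘(ℝ, E) 𝓘(ℝ, ℝ) 2 W ∧ (∀ x, 1 ≤ W x) ∧
    ∃ θ b R : ℝ, 0 < θ ∧ 0 ≤ b ∧ 0 < R ∧
      ∀ x, -weightedLaplacian X χ M W x ≤ -θ * W x + b * (ccBall X R).indicator 1 x

/-- The couple `(Δ_χ, M)` admits a Lyapunov function. -/
def AdmitsLyapunovFunction (X : Fin ℓ → GroupLieAlgebra 𝓘(ℝ, E) G) (χ M : G → ℝ) : Prop :=
  ∃ W : G → ℝ, IsLyapunovFunction X χ M W

variable [MeasurableSpace G]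

/-- The measure `μ_χ` with density `χ` with respect to `ρ`. -/
def charMeasure (ρ : Measure G) (χ : G → ℝ) : Measure G :=
  ρ.withDensity fun x => ENNReal.ofReal (χ x)

/-- The measure `μ_{χ,M}` with density `M` with respect to `μ_χ`. -/
def weightedMeasure (ρ : Measure G) (χ M : G → ℝ) : Measure G :=
  (charMeasure ρ χ).withDensity fun x => ENNReal.ofReal (M x)

/-- `g = (g₁, …, g_ℓ)` is the distributional gradient `(X₁ f, …, X_ℓ f)` of `f`. The measure `ρ`
is meant to be a right Haar measure, for which the formal adjoint of a left-invariant vector field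
is its opposite. -/
def IsWeakGradient (ρ : Measure G) (X : Fin ℓ → GroupLieAlgebra 𝓘(ℝ, E) G) (f : G → ℝ)
    (g : Fin ℓ → G → ℝ) : Prop :=
  LocallyIntegrable f ρ ∧ ∀ j, LocallyIntegrable (g j) ρ ∧
    ∀ φ : G → ℝ, ContMDiff 𝓘(ℝ, E) 𝓘(ℝ, ℝ) ∞ φ → HasCompactSupport φ →
      ∫ x, f x * lieDeriv (X j) φ x ∂ρ = -∫ x, g j x * φ x ∂ρ

/-- The length `|g| = (∑ j, g_j ²)^{1/2}` of a (weak) gradient. -/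
def gradNorm (g : Fin ℓ → G → ℝ) (x : G) : ℝ :=
  Real.sqrt (∑ j, g j x ^ 2)

/-- The global `L²`-Poincaré inequality for `μ_{χ,M}`: there is a constant `C` such that
`‖f - f_{χ,M}‖ ≤ C ‖|∇f|‖` in `L²(μ_{χ,M})` for all `f ∈ L²_1(μ_{χ,M})`, i.e. for all
`f ∈ L²(μ_{χ,M})` whose distributional gradient `g` has `|g| ∈ L²(μ_{χ,M})`; here `f_{χ,M}` is the
average of `f` with respect to `μ_{χ,M}`. -/
def GlobalPoincare (ρ : Measure G) (X : Fin ℓ → GroupLieAlgebra 𝓘(ℝ, E) G) (χ M : G → ℝ) : Prop :=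
  ∃ C : ℝ≥0, ∀ (f : G → ℝ) (g : Fin ℓ → G → ℝ),
    MemLp f 2 (weightedMeasure ρ χ M) → IsWeakGradient ρ X f g →
    MemLp (gradNorm g) 2 (weightedMeasure ρ χ M) →
      eLpNorm (fun x => f x - ⨍ y, f y ∂(weightedMeasure ρ χ M)) 2 (weightedMeasure ρ χ M) ≤
        C * eLpNorm (gradNorm g) 2 (weightedMeasure ρ χ M)

end SubRiemannianLie

end

/-! Put `w = χ M = χ e^{-v}` and `L = -Δ_χ = ∑ (X_j² + c_j X_j)` with `c_j = (X_j χ)(e)`. A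
continuous positive character satisfies `X_j χ = c_j χ`, so the horizontal field `w ∇v` has
divergence `w (L v - |∇v|²)`. Right Haar measure is invariant under the flows `x ↦ x exp(t X_j)`,
hence horizontal integration by parts produces no boundary or modular terms.

Poincaré inequality (`IsFlowPotential.poincare`). For `F = f - m`, a cutoff `η` and `u = η F`,
integrating `∇(u²) · ∇v` against `w` and using Young's inequality `2 u ∇u · ∇v ≤ (1-a) u² |∇v|² +
|∇u|²/(1-a)` gives `∫ u² (a |∇v|² + Δ_χ v) w ≤ (1-a)⁻¹ ∫ |∇u|² w`. The bracket on the left is at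
least `c` off a compact set `K` and bounded on `K`. The remaining term `∫_K F²` is controlled by a
local Poincaré inequality with a suitable `m` (`exists_localPoincare`); letting `η → 1` finishes,
because the mean is the best constant. The function `W` itself is not needed for this.

Lower bound for `v` (`IsFlowPotential.bddBelow`). The same computation with the field `χ φ(v) ∇v`,
where `φ(s) = ((e^{-s} - k)₊)² e^s`, uses `φ' ≤ -φ` and `φ(s) ≤ e^{-s}`. If `e^{-v} ≤ k` on `K`,
then `c ∫ η² φ(v) χ` is at most a multiple of `sup |∇η|² ∫ χ e^{-v}`, which tends to `0`. Hence
`φ(v) = 0`, that is `e^{-v} ≤ k` everywhere. The Lyapunov property of the exponential is then the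
chain rule (`isLyapunovFunction_exp`).

The geometric input is Chow's theorem in quantitative form (`generates_of_hormanderCondition`): each
compact set consists of words of bounded length in the one-parameter subgroups. It yields the local
Poincaré inequality by telescoping along words, and cutoffs with uniformly small horizontal gradient
by smoothing the word length (`exists_isCutoffSequence`). The coordinates behind it also give the
differentiability of `χ`. Distributional gradients enter only through their integrated form along
the flows (`IsWeakGradient.hasWeakFlowDeriv`), for which the product rule for `f²` is
`integral_sq_mul_flowDeriv`. -/

set_option linter.unusedSectionVars false

namespace SubRiemannianLie

open Filter Topology
open scoped Pointwise

/-! ### Derivatives along one-parameter subgroups -/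

section Flow

variable {G : Type*} [TopologicalSpace G] [Group G]

/-- `γ` is a continuous one-parameter subgroup of `G`. -/
structure IsOneParam (γ : ℝ → G) : Prop where
  continuous : Continuous γ
  map_add : ∀ s t, γ (s + t) = γ s * γ t

namespace IsOneParam

variable {γ : ℝ → G}

lemma map_zero (hγ : IsOneParam γ) : γ 0 = 1 := by
  have := hγ.map_add 0 0
  simpa using this

lemma map_neg (hγ : IsOneParam γ) (t : ℝ) : γ (-t) = (γ t)⁻¹ := by
  have := hγ.map_add (-t) t
  rw [neg_add_cancel, hγ.map_zero] at this
  exact eq_inv_of_mul_eq_one_left this.symm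

lemma mul_neg_cancel (hγ : IsOneParam γ) (x : G) (t : ℝ) : x * γ t * γ (-t) = x := by
  rw [hγ.map_neg, mul_inv_cancel_right]

lemma neg_mul_cancel (hγ : IsOneParam γ) (x : G) (t : ℝ) : x * γ (-t) * γ t = x := by
  rw [hγ.map_neg, inv_mul_cancel_right]

end IsOneParam

/-- `ψ'` is the derivative of `ψ` along the flow `x ↦ x * γ t`. -/
def HasFlowDeriv (γ : ℝ → G) (ψ ψ' : G → ℝ) : Prop :=
  ∀ x, HasDerivAt (fun t => ψ (x * γ t)) (ψ' x) 0

namespace HasFlowDeriv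

variable {γ : ℝ → G} {ψ ψ' φ φ' : G → ℝ}

/-- The group law `x * γ s = (x * γ t) * γ (s - t)` carries differentiability at time `0` to every
time. -/
lemma hasDerivAt (h : HasFlowDeriv γ ψ ψ') (hγ : IsOneParam γ) (x : G) (t : ℝ) :
    HasDerivAt (fun s => ψ (x * γ s)) (ψ' (x * γ t)) t := by
  have h1 := h (x * γ t)
  rw [show (0 : ℝ) = t - t by ring] at h1
  have e : (fun s => ψ (x * γ s)) = fun s => ψ (x * γ t * γ (s - t)) := by
    ext s
    rw [mul_assoc, ← hγ.map_add, add_sub_cancel]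
  rw [e]
  exact h1.comp_sub_const t t

lemma mul (hγ : IsOneParam γ) (h : HasFlowDeriv γ ψ ψ') (h' : HasFlowDeriv γ φ φ') :
    HasFlowDeriv γ (fun x => ψ x * φ x) (fun x => ψ' x * φ x + ψ x * φ' x) := by
  intro x
  have := (h x).mul (h' x)
  simp only [hγ.map_zero, mul_one] at this
  exact this

lemma comp (hγ : IsOneParam γ) {F F' : ℝ → ℝ} (hF : ∀ x, HasDerivAt F (F' (ψ x)) (ψ x))
    (h : HasFlowDeriv γ ψ ψ') :
    HasFlowDeriv γ (fun x => F (ψ x)) (fun x => F' (ψ x) * ψ' x) := by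
  intro x
  have h1 : HasDerivAt F (F' (ψ x)) (ψ (x * γ 0)) := by simpa [hγ.map_zero] using hF x
  exact h1.comp (0 : ℝ) (h x)

lemma const (c : ℝ) : HasFlowDeriv γ (fun _ => c) (fun _ => 0) :=
  fun _ => hasDerivAt_const _ _

lemma const_mul (c : ℝ) (h : HasFlowDeriv γ ψ ψ') :
    HasFlowDeriv γ (fun x => c * ψ x) (fun x => c * ψ' x) :=
  fun x => (h x).const_mul c

lemma congr_deriv (h : HasFlowDeriv γ ψ ψ') (e : ∀ x, ψ' x = φ' x) : HasFlowDeriv γ ψ φ' :=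
  fun x => e x ▸ h x

lemma unique (h : HasFlowDeriv γ ψ ψ') (h' : HasFlowDeriv γ ψ φ') : ψ' = φ' :=
  funext fun x => (h x).unique (h' x)

/-- A flow derivative bounded by `B` gives the Lipschitz constant `B` along the flow. -/
lemma abs_sub_le (hγ : IsOneParam γ) (h : HasFlowDeriv γ ψ ψ') {B : ℝ} (hB : ∀ x, |ψ' x| ≤ B)
    (x : G) (t : ℝ) : |ψ (x * γ t) - ψ x| ≤ B * |t| := by
  have := Convex.norm_image_sub_le_of_norm_hasDerivWithin_le (f := fun s => ψ (x * γ s))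
    (f' := fun s => ψ' (x * γ s)) (s := univ) (x := 0) (y := t) (C := B)
    (fun s _ => (h.hasDerivAt hγ x s).hasDerivWithinAt) (fun s _ => hB _) convex_univ
    (mem_univ _) (mem_univ _)
  simpa [hγ.map_zero] using this

/-- The flow derivative of a measurable function is measurable. -/
lemma measurable [MeasurableSpace G] [BorelSpace G] [ContinuousMul G] [SecondCountableTopology G]
    (hγ : IsOneParam γ) (h : HasFlowDeriv γ ψ ψ') (hψ : Measurable ψ) : Measurable ψ' := by
  refine measurable_of_tendsto_metrizable (f := fun (n : ℕ) x =>
    ((n : ℝ) + 1) * (ψ (x * γ (((n : ℝ) + 1)⁻¹)) - ψ x)) (fun n => ?_) ?_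
  · exact ((hψ.comp (continuous_mul_const _).measurable).sub hψ).const_mul _
  · rw [tendsto_pi_nhds]
    intro x
    have h1 := (h x).tendsto_slope_zero
    have h2 : Tendsto (fun n : ℕ => ((n : ℝ) + 1)⁻¹) atTop (𝓝[≠] 0) := by
      refine tendsto_nhdsWithin_iff.2 ⟨?_, ?_⟩
      · simpa using tendsto_one_div_add_atTop_nhds_zero_nat (𝕜 := ℝ)
      · filter_upwards with n
        simp only [mem_compl_iff, mem_singleton_iff]
        positivity
    have h3 := h1.comp h2
    simpa [Function.comp_def, hγ.map_zero] using h3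

/-- The flow derivative vanishes off the closed set that carries the function. -/
lemma eq_zero_of_notMem [ContinuousMul G] (hγ : IsOneParam γ) (h : HasFlowDeriv γ ψ ψ')
    {K : Set G} (hK : IsClosed K) (hψ : ∀ x, x ∉ K → ψ x = 0) {x : G} (hx : x ∉ K) : ψ' x = 0 := by
  have h1 : Continuous fun t => x * γ t := continuous_const.mul hγ.continuous
  have h2 : ∀ᶠ t in 𝓝 (0 : ℝ), x * γ t ∈ Kᶜ :=
    h1.continuousAt.eventually_mem (hK.isOpen_compl.mem_nhds (by simpa [hγ.map_zero] using hx))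
  have h3 : (fun t => ψ (x * γ t)) =ᶠ[𝓝 0] fun _ => 0 := by
    filter_upwards [h2] with t ht using hψ _ ht
  exact (h x).unique ((hasDerivAt_const (0 : ℝ) (0 : ℝ)).congr_of_eventuallyEq h3)

end HasFlowDeriv

/-- `g` is the derivative of `f` along the flow `x ↦ x * γ t`, in the integrated sense, at almost
every point. -/
def HasWeakFlowDeriv [MeasurableSpace G] (ρ : Measure G) (γ : ℝ → G) (f g : G → ℝ) : Prop :=
  ∀ t, ∀ᵐ x ∂ρ, f (x * γ t) - f x = ∫ s in (0 : ℝ)..t, g (x * γ s)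

end Flow

/-! ### Right-invariant measures and increments along a flow -/

section Translation

variable {G : Type*} [TopologicalSpace G] [Group G] [IsTopologicalGroup G] [T2Space G]
  [SecondCountableTopology G] [MeasurableSpace G] [BorelSpace G]
  {ρ : Measure G} [ρ.IsMulRightInvariant]

lemma setLIntegral_mul_right_le {F : G → ℝ≥0∞} {K K' : Set G} (hK : IsCompact K)
    (hK' : IsCompact K') (y : G) (hy : ∀ x ∈ K, x * y ∈ K') :
    ∫⁻ x in K, F (x * y) ∂ρ ≤ ∫⁻ x in K', F x ∂ρ := by
  rw [← lintegral_indicator hK'.measurableSet, ← lintegral_indicator hK.measurableSet,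
    ← lintegral_mul_right_eq_self (K'.indicator F) y]
  refine lintegral_mono fun x => ?_
  by_cases hx : x ∈ K
  · simp [hx, hy x hx]
  · simp [hx]

lemma sq_lintegral_le {α : Type*} [MeasurableSpace α] (μ : Measure α) {F : α → ℝ≥0∞}
    (hF : AEMeasurable F μ) : (∫⁻ x, F x ∂μ) ^ 2 ≤ μ univ * ∫⁻ x, F x ^ 2 ∂μ := by
  have h := ENNReal.lintegral_mul_le_Lp_mul_Lq μ (p := 2) (q := 2)
    (Real.HolderConjugate.two_two) (aemeasurable_const (b := (1 : ℝ≥0∞))) hF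
  simp only [Pi.mul_apply, one_mul, ENNReal.one_rpow, lintegral_one] at h
  calc (∫⁻ x, F x ∂μ) ^ 2 ≤ _ := pow_le_pow_left₀ zero_le h 2
    _ = _ := by
      rw [mul_pow, ← ENNReal.rpow_natCast, ← ENNReal.rpow_natCast, ← ENNReal.rpow_mul,
        ← ENNReal.rpow_mul]
      norm_num

/-- The compact set swept out of `K` by the flow for times in `[-1, 1]`. -/
def sweep (γ : ℝ → G) (K : Set G) : Set G := K * γ '' Icc (-1) 1

lemma isCompact_sweep {γ : ℝ → G} (hγ : IsOneParam γ) {K : Set G} (hK : IsCompact K) :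
    IsCompact (sweep γ K) := hK.mul (isCompact_Icc.image hγ.continuous)

lemma mul_mem_sweep {G : Type*} [Group G] {γ : ℝ → G} {K : Set G} {x : G} (hx : x ∈ K) {t : ℝ}
    (ht : |t| ≤ 1) : x * γ t ∈ K * γ '' Icc (-1) 1 :=
  mul_mem_mul hx ⟨t, abs_le.1 ht, rfl⟩

/-- The increment along the flow is bounded in `L²` by the weak derivative. -/
lemma setLIntegral_flow_sub_le [SFinite ρ] {γ : ℝ → G} (hγ : IsOneParam γ) {f g : G → ℝ}
    (hg : Measurable g) (hfg : HasWeakFlowDeriv ρ γ f g) {K : Set G} (hK : IsCompact K)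
    {t : ℝ} (ht : |t| ≤ 1) :
    ∫⁻ x in K, ‖f (x * γ t) - f x‖ₑ ^ 2 ∂ρ ≤
      ENNReal.ofReal (t ^ 2) * ∫⁻ x in sweep γ K, ‖g x‖ₑ ^ 2 ∂ρ := by
  have hm : Measurable fun p : G × ℝ => ‖g (p.1 * γ p.2)‖ₑ ^ 2 :=
    ((hg.comp ((continuous_fst.mul (hγ.continuous.comp continuous_snd)).measurable)).enorm).pow_const
      2
  have hvol : volume (uIoc 0 t) = ENNReal.ofReal |t| := by
    simp [uIoc, Real.volume_Ioc, max_sub_min_eq_abs]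
  -- Cauchy–Schwarz in time gives one factor `|t|`; integrating the translation-invariant bound over
  -- the times gives the second.
  have h1 : ∀ᵐ x ∂ρ.restrict K, ‖f (x * γ t) - f x‖ₑ ^ 2 ≤
      ENNReal.ofReal |t| * ∫⁻ s in uIoc 0 t, ‖g (x * γ s)‖ₑ ^ 2 := by
    filter_upwards [ae_restrict_of_ae (hfg t)] with x hx
    rw [hx]
    have hgx : Measurable fun s => g (x * γ s) :=
      hg.comp (continuous_const.mul hγ.continuous).measurable
    have h2 : ‖∫ s in (0 : ℝ)..t, g (x * γ s)‖ₑ ≤ ∫⁻ s in uIoc 0 t, ‖g (x * γ s)‖ₑ := by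
      rw [← ofReal_norm, intervalIntegral.norm_intervalIntegral_eq, ofReal_norm]
      exact enorm_integral_le_lintegral_enorm _
    calc _ ≤ (∫⁻ s in uIoc 0 t, ‖g (x * γ s)‖ₑ) ^ 2 := pow_le_pow_left₀ zero_le h2 2
      _ ≤ _ := by
        have := sq_lintegral_le (volume.restrict (uIoc 0 t)) hgx.enorm.aemeasurable
        rwa [Measure.restrict_apply_univ, hvol] at this
  calc _ ≤ ∫⁻ x in K, (ENNReal.ofReal |t| * ∫⁻ s in uIoc 0 t, ‖g (x * γ s)‖ₑ ^ 2) ∂ρ :=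
        lintegral_mono_ae h1
    _ = ENNReal.ofReal |t| * ∫⁻ x in K, (∫⁻ s in uIoc 0 t, ‖g (x * γ s)‖ₑ ^ 2) ∂ρ :=
        lintegral_const_mul' _ _ (by simp)
    _ = ENNReal.ofReal |t| * ∫⁻ s in uIoc 0 t, ∫⁻ x in K, ‖g (x * γ s)‖ₑ ^ 2 ∂ρ := by
        rw [lintegral_lintegral_swap hm.aemeasurable]
    _ ≤ ENNReal.ofReal |t| * ∫⁻ s in uIoc 0 t, ∫⁻ x in sweep γ K, ‖g x‖ₑ ^ 2 ∂ρ := by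
        refine mul_le_mul_right (setLIntegral_mono' measurableSet_uIoc fun s hs => ?_) _
        refine setLIntegral_mul_right_le (F := fun x => ‖g x‖ₑ ^ 2) hK (isCompact_sweep hγ hK)
          (γ s) fun x hx => mul_mem_sweep hx ?_
        have : |s - 0| ≤ |t - 0| := abs_sub_left_of_mem_uIcc (uIoc_subset_uIcc hs)
        simp only [sub_zero] at this
        exact this.trans ht
    _ = _ := by
        rw [setLIntegral_const, hvol, mul_comm _ (ENNReal.ofReal |t|), ← mul_assoc,
          ← ENNReal.ofReal_mul (abs_nonneg t), abs_mul_abs_self, ← sq]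

end Translation

/-! ### Trilinear integrals with a bounded, compactly carried weight -/

section SquareIntegrable

variable {α : Type*} [MeasurableSpace α] {ρ : Measure α} {K : Set α} {u w ψ : α → ℝ} {B : ℝ}

lemma integrable_mul_mul_of_memLp (hu : MemLp u 2 (ρ.restrict K)) (hw : MemLp w 2 (ρ.restrict K))
    (hK : MeasurableSet K) (hψ : Measurable ψ) (hB : ∀ x, |ψ x| ≤ B) (h0 : ∀ x, x ∉ K → ψ x = 0) :
    Integrable (fun x => u x * w x * ψ x) ρ := by
  have h1 : Integrable (fun x => u x * w x * ψ x) (ρ.restrict K) :=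
    (MemLp.integrable_mul hu hw).mul_bdd (c := B) hψ.aestronglyMeasurable
      (Eventually.of_forall fun x => hB x)
  have h2 : IntegrableOn (fun x => u x * w x * ψ x) K ρ := h1
  rw [← integrable_indicator_iff hK] at h2
  refine h2.congr (Eventually.of_forall fun x => ?_)
  by_cases hx : x ∈ K
  · simp [hx]
  · simp [hx, h0 x hx]

/-- This is Young's inequality with a free parameter instead of Cauchy–Schwarz. When `w` is an
increment with `L²` norm of order `|s|`, the choice `ε = |s|` makes the bound linear in `|s|`. -/
lemma integral_abs_mul_mul_le (hu : MemLp u 2 (ρ.restrict K)) (hw : MemLp w 2 (ρ.restrict K))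
    (hB : ∀ x, |ψ x| ≤ B)
    (h0 : ∀ x, x ∉ K → ψ x = 0) {ε : ℝ} (hε : 0 < ε) :
    ∫ x, |u x * w x * ψ x| ∂ρ ≤
      B / 2 * (ε * ∫ x in K, u x ^ 2 ∂ρ + ε⁻¹ * ∫ x in K, w x ^ 2 ∂ρ) := by
  have hB0 : ∀ x : α, 0 ≤ B := fun x => (abs_nonneg _).trans (hB x)
  have e : ∫ x, |u x * w x * ψ x| ∂ρ = ∫ x in K, |u x * w x * ψ x| ∂ρ :=
    (setIntegral_eq_integral_of_forall_compl_eq_zero fun x hx => by simp [h0 x hx]).symm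
  have hu2 := hu.integrable_sq
  have hw2 := hw.integrable_sq
  rw [e, ← integral_const_mul, ← integral_const_mul,
    ← integral_add (hu2.const_mul ε) (hw2.const_mul ε⁻¹), ← integral_const_mul]
  refine integral_mono_of_nonneg (Eventually.of_forall fun x => abs_nonneg _)
    (((hu2.const_mul ε).add (hw2.const_mul ε⁻¹)).const_mul _) (Eventually.of_forall fun x => ?_)
  have h1 : |u x * w x| ≤ (ε * u x ^ 2 + ε⁻¹ * w x ^ 2) / 2 := by
    have h3 : 2 * (|u x| * |w x|) ≤ ε * |u x| ^ 2 + ε⁻¹ * |w x| ^ 2 := by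
      have := mul_nonneg (inv_nonneg.2 hε.le) (sq_nonneg (ε * |u x| - |w x|))
      have e2 : ε⁻¹ * (ε * |u x| - |w x|) ^ 2 =
          ε * |u x| ^ 2 + ε⁻¹ * |w x| ^ 2 - 2 * (|u x| * |w x|) := by
        field_simp
        ring
      linarith
    rw [abs_mul]
    simp only [sq_abs] at h3
    linarith
  calc |u x * w x * ψ x| = |ψ x| * |u x * w x| := by rw [abs_mul, mul_comm]
    _ ≤ B * ((ε * u x ^ 2 + ε⁻¹ * w x ^ 2) / 2) :=
      mul_le_mul (hB x) h1 (abs_nonneg _) (hB0 x)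
    _ = _ := by ring

lemma abs_integral_mul_mul_le (hu : MemLp u 2 (ρ.restrict K)) (hw : MemLp w 2 (ρ.restrict K))
    (hB : ∀ x, |ψ x| ≤ B)
    (h0 : ∀ x, x ∉ K → ψ x = 0) {ε : ℝ} (hε : 0 < ε) :
    |∫ x, u x * w x * ψ x ∂ρ| ≤
      B / 2 * (ε * ∫ x in K, u x ^ 2 ∂ρ + ε⁻¹ * ∫ x in K, w x ^ 2 ∂ρ) :=
  (abs_integral_le_integral_abs).trans (integral_abs_mul_mul_le hu hw hB h0 hε)

lemma ofReal_setIntegral_sq (hu : MemLp u 2 (ρ.restrict K)) :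
    ENNReal.ofReal (∫ x in K, u x ^ 2 ∂ρ) = ∫⁻ x in K, ‖u x‖ₑ ^ 2 ∂ρ := by
  rw [ofReal_integral_eq_lintegral_ofReal hu.integrable_sq
    (Eventually.of_forall fun x => sq_nonneg _)]
  refine lintegral_congr fun x => ?_
  rw [← sq_abs, ← Real.norm_eq_abs, ENNReal.ofReal_pow (norm_nonneg _), ofReal_norm]

lemma memLp_two_iff_lintegral {μ : Measure α} (hu : AEStronglyMeasurable u μ) :
    MemLp u 2 μ ↔ ∫⁻ x, ‖u x‖ₑ ^ 2 ∂μ < ⊤ := by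
  rw [MemLp, and_iff_right hu, eLpNorm_lt_top_iff_lintegral_rpow_enorm_lt_top (by simp) (by simp)]
  simp

end SquareIntegrable

/-! ### Integration by parts along a flow -/

section Translation

variable {G : Type*} [TopologicalSpace G] [Group G] [IsTopologicalGroup G] [T2Space G]
  [SecondCountableTopology G] [MeasurableSpace G] [BorelSpace G]
  {ρ : Measure G} [ρ.IsMulRightInvariant]

/-- Local square integrability: square integrability on every compact set. -/
def LocallyL2 (ρ : Measure G) (f : G → ℝ) : Prop :=
  Measurable f ∧ ∀ K, IsCompact K → MemLp f 2 (ρ.restrict K)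

lemma LocallyL2.translate {f : G → ℝ} (hf : LocallyL2 ρ f) (y : G) :
    LocallyL2 ρ fun x => f (x * y) := by
  have hm : Measurable fun x : G => f (x * y) := hf.1.comp (continuous_mul_const y).measurable
  refine ⟨hm, fun K hK => ?_⟩
  have hK' : IsCompact (K * {y}) := hK.mul isCompact_singleton
  rw [memLp_two_iff_lintegral hm.aestronglyMeasurable]
  refine lt_of_le_of_lt (setLIntegral_mul_right_le (F := fun x => ‖f x‖ₑ ^ 2) hK hK' y
    fun x hx => mul_mem_mul hx rfl) ?_
  rw [← memLp_two_iff_lintegral hf.1.aestronglyMeasurable]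
  exact hf.2 _ hK'

lemma LocallyL2.sub {f g : G → ℝ} (hf : LocallyL2 ρ f) (hg : LocallyL2 ρ g) :
    LocallyL2 ρ fun x => f x - g x :=
  ⟨hf.1.sub hg.1, fun K hK => (hf.2 K hK).sub (hg.2 K hK)⟩

lemma LocallyL2.setIntegral_translate_sq_le {f : G → ℝ} (hf : LocallyL2 ρ f) {K K' : Set G}
    (hK : IsCompact K) (hK' : IsCompact K') (y : G) (hy : ∀ x ∈ K, x * y ∈ K') :
    ∫ x in K, f (x * y) ^ 2 ∂ρ ≤ ∫ x in K', f x ^ 2 ∂ρ := by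
  rw [← ENNReal.ofReal_le_ofReal_iff (integral_nonneg fun x => sq_nonneg _),
    ofReal_setIntegral_sq (hf.2 _ hK'), ofReal_setIntegral_sq ((hf.translate y).2 K hK)]
  exact setLIntegral_mul_right_le (F := fun x => ‖f x‖ₑ ^ 2) hK hK' y hy

variable [SFinite ρ] {γ : ℝ → G}

lemma setIntegral_flow_sub_sq_le (hγ : IsOneParam γ) {f g : G → ℝ} (hf : LocallyL2 ρ f)
    (hg : LocallyL2 ρ g) (hfg : HasWeakFlowDeriv ρ γ f g) {K : Set G} (hK : IsCompact K)
    {t : ℝ} (ht : |t| ≤ 1) :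
    ∫ x in K, (f (x * γ t) - f x) ^ 2 ∂ρ ≤ t ^ 2 * ∫ x in sweep γ K, g x ^ 2 ∂ρ := by
  have h0 : 0 ≤ ∫ x in sweep γ K, g x ^ 2 ∂ρ := integral_nonneg fun x => sq_nonneg _
  rw [← ENNReal.ofReal_le_ofReal_iff (mul_nonneg (sq_nonneg t) h0),
    ENNReal.ofReal_mul (sq_nonneg t), ofReal_setIntegral_sq (hg.2 _ (isCompact_sweep hγ hK)),
    ofReal_setIntegral_sq (((hf.translate (γ t)).sub hf).2 K hK)]
  exact setLIntegral_flow_sub_le hγ hg.1 hfg hK ht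

lemma subset_sweep (hγ : IsOneParam γ) (K : Set G) : K ⊆ sweep γ K := fun x hx =>
  ⟨x, hx, 1, ⟨0, by simp, hγ.map_zero⟩, mul_one x⟩

lemma eq_zero_of_notMem_sweep (hγ : IsOneParam γ) {K : Set G} {ψ : G → ℝ}
    (hψ : ∀ x, x ∉ K → ψ x = 0) {x : G} (hx : x ∉ sweep γ K) {t : ℝ} (ht : |t| ≤ 1) :
    ψ (x * γ (-t)) = 0 := by
  refine hψ _ fun h => hx ?_
  have := mul_mem_sweep (γ := γ) h ht
  rwa [hγ.neg_mul_cancel] at this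

/-- Moving a compactly supported function along the flow is differentiable in time, tested against
a locally integrable function. -/
lemma hasDerivAt_integral_mul_flow (hγ : IsOneParam γ) {F ψ ψ' : G → ℝ} {K : Set G}
    (hF : ∀ K, IsCompact K → IntegrableOn F K ρ)
    (hK : IsCompact K) (hψ : Measurable ψ)
    (h0 : ∀ x, x ∉ K → ψ x = 0) (hd : HasFlowDeriv γ ψ ψ') {B B' : ℝ} (hB : ∀ x, |ψ x| ≤ B)
    (hB' : ∀ x, |ψ' x| ≤ B') :
    HasDerivAt (fun t => ∫ x, F x * ψ (x * γ (-t)) ∂ρ) (-∫ x, F x * ψ' x ∂ρ) 0 := by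
  have hψ' := hd.measurable hγ hψ
  have h0' : ∀ x, x ∉ K → ψ' x = 0 := fun x hx => hd.eq_zero_of_notMem hγ hK.isClosed h0 hx
  have hc : ∀ t, Measurable fun x : G => x * γ t := fun t => (continuous_mul_const _).measurable
  have hKs := isCompact_sweep hγ hK
  have key : ∀ (φ : G → ℝ) (C t : ℝ), Measurable φ → (∀ x, |φ x| ≤ C) → (∀ x, x ∉ K → φ x = 0) →
      |t| ≤ 1 → Integrable (fun x => F x * φ (x * γ (-t))) ρ := by
    intro φ C t hφ hC hφ0 ht
    have h1 : IntegrableOn (fun x => F x * φ (x * γ (-t))) (sweep γ K) ρ :=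
      (hF _ hKs).mul_bdd (c := C) (hφ.comp (hc _)).aestronglyMeasurable
        (Eventually.of_forall fun x => hC _)
    rw [← integrable_indicator_iff hKs.measurableSet] at h1
    refine h1.congr (Eventually.of_forall fun x => ?_)
    by_cases hx : x ∈ sweep γ K
    · simp [hx]
    · simp [hx, eq_zero_of_notMem_sweep hγ hφ0 hx ht]
  have hb : ∀ t ∈ Metric.ball (0 : ℝ) 1, |t| ≤ 1 := fun t ht => by
    rw [mem_ball_zero_iff, Real.norm_eq_abs] at ht
    exact ht.le
  have main := hasDerivAt_integral_of_dominated_loc_of_deriv_le (μ := ρ)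
    (F := fun t x => F x * ψ (x * γ (-t))) (F' := fun t x => F x * -ψ' (x * γ (-t)))
    (x₀ := (0 : ℝ)) (s := Metric.ball 0 1)
    (bound := fun x => (sweep γ K).indicator (fun x => |F x| * B') x)
    (Metric.ball_mem_nhds _ one_pos) ?_ ?_ ?_ ?_ ?_ ?_
  · simpa [hγ.map_zero, integral_neg] using main.2
  · filter_upwards [Metric.ball_mem_nhds (0 : ℝ) one_pos] with t ht
    exact (key ψ B t hψ hB h0 (hb t ht)).aestronglyMeasurable
  · exact key ψ B 0 hψ hB h0 (by simp)
  · have := (key ψ' B' 0 hψ' hB' h0' (by simp)).aestronglyMeasurable.neg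
    refine this.congr (Eventually.of_forall fun x => ?_)
    simp
  · refine Eventually.of_forall fun x t ht => ?_
    by_cases hx : x ∈ sweep γ K
    · simp only [hx, indicator_of_mem, norm_mul, norm_neg, Real.norm_eq_abs]
      exact mul_le_mul_of_nonneg_left (hB' _) (abs_nonneg _)
    · simp [hx, eq_zero_of_notMem_sweep hγ h0' hx (hb t ht)]
  · rw [integrable_indicator_iff hKs.measurableSet]
    exact (hF _ hKs).abs.mul_const _
  · refine Eventually.of_forall fun x t _ => ?_
    have h1 := hd.hasDerivAt hγ x (-t)
    have h2 := (HasDerivAt.scomp t h1 (hasDerivAt_neg t)).const_mul (F x)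
    simpa using h2

/-- Integration by parts along the flow, for the square of a weakly differentiable function. -/
theorem integral_sq_mul_flowDeriv (hγ : IsOneParam γ) {f g ψ ψ' : G → ℝ}
    (hf : LocallyL2 ρ f) (hg : LocallyL2 ρ g) (hfg : HasWeakFlowDeriv ρ γ f g) {K : Set G}
    (hK : IsCompact K) (hψ : Measurable ψ) (h0 : ∀ x, x ∉ K → ψ x = 0)
    (hd : HasFlowDeriv γ ψ ψ') {B B' : ℝ} (hB : ∀ x, |ψ x| ≤ B) (hB' : ∀ x, |ψ' x| ≤ B') :
    ∫ x, f x ^ 2 * ψ' x ∂ρ = -(2 * ∫ x, f x * g x * ψ x ∂ρ) := by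
  have hKs := isCompact_sweep hγ hK
  have hKss := isCompact_sweep hγ hKs
  have hKm := hK.measurableSet
  set Gs := ∫ x in sweep γ K, g x ^ 2 ∂ρ with hGs
  -- Increments of `f` are measured on the sweep of `K`, and bounding them by `g` costs a second
  -- sweep.
  set Gss := ∫ x in sweep γ (sweep γ K), g x ^ 2 ∂ρ with hGss
  set Fs := ∫ x in sweep γ K, f x ^ 2 ∂ρ with hFs
  set E : ℝ → ℝ := fun s => ∫ x, g (x * γ s) * f x * ψ x ∂ρ with hE
  -- E is Lipschitz at `0`
  have hElip : ∀ s, |s| ≤ 1 → |E s - E 0| ≤ (B / 2 * (Gs + Gss) + B' / 2 * (Gs + Fs)) * |s| := by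
    intro s hs
    rcases eq_or_ne s 0 with rfl | hs0
    · simp
    have hs1 : 0 < |s| := abs_pos.2 hs0
    -- Right invariance moves the translation off `g`, which has no regularity, onto `f` and `ψ`,
    -- whose increments are of order `|s|`.
    have e1 : E s = ∫ x, g x * f (x * γ (-s)) * ψ (x * γ (-s)) ∂ρ := by
      rw [← integral_mul_right_eq_self _ (γ s)]
      simp only [hγ.mul_neg_cancel, hE]
    have hψs : Measurable fun x => ψ (x * γ (-s)) := hψ.comp (continuous_mul_const _).measurable
    have i1 : Integrable (fun x => g x * (f (x * γ (-s)) - f x) * ψ (x * γ (-s))) ρ :=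
      integrable_mul_mul_of_memLp (hg.2 _ hKs) (((hf.translate _).sub hf).2 _ hKs)
        hKs.measurableSet hψs (fun x => hB _) (fun x hx => eq_zero_of_notMem_sweep hγ h0 hx hs)
    have hz : ∀ x, x ∉ sweep γ K → ψ (x * γ (-s)) - ψ x = 0 := fun x hx => by
      rw [eq_zero_of_notMem_sweep hγ h0 hx hs, h0 x fun h => hx (subset_sweep hγ K h), sub_zero]
    have hlip : ∀ x, |ψ (x * γ (-s)) - ψ x| ≤ B' * |s| := fun x => by
      simpa using hd.abs_sub_le hγ hB' x (-s)
    have i2 : Integrable (fun x => g x * f x * (ψ (x * γ (-s)) - ψ x)) ρ :=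
      integrable_mul_mul_of_memLp (hg.2 _ hKs) (hf.2 _ hKs)
        hKs.measurableSet (hψs.sub hψ) hlip hz
    have e2 : E s - E 0 = ∫ x, g x * (f (x * γ (-s)) - f x) * ψ (x * γ (-s)) ∂ρ +
        ∫ x, g x * f x * (ψ (x * γ (-s)) - ψ x) ∂ρ := by
      have e0 : E 0 = ∫ x, g x * f x * ψ x ∂ρ := by simp [hE, hγ.map_zero]
      have i0 : Integrable (fun x => g x * f x * ψ x) ρ :=
        integrable_mul_mul_of_memLp (hg.2 _ hK) (hf.2 _ hK) hKm hψ hB h0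
      rw [← integral_add i1 i2, e1, e0, sub_eq_iff_eq_add, ← integral_add (f := fun x => g x * (f (x * γ (-s)) - f x) * ψ (x * γ (-s)) +
          g x * f x * (ψ (x * γ (-s)) - ψ x)) (i1.add i2) i0]
      congr 1
      ext x
      ring
    -- Young's parameter is `|s|`, matching the size `s²` of the squared increment.
    have b1 := abs_integral_mul_mul_le (hg.2 _ hKs) (((hf.translate (γ (-s))).sub hf).2 _ hKs)
        (fun x => hB (x * γ (-s)))
        (fun x hx => eq_zero_of_notMem_sweep hγ h0 hx hs) hs1
    have b2 := abs_integral_mul_mul_le (hg.2 _ hKs) (hf.2 _ hKs) hlip hz one_pos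
    have b3 := setIntegral_flow_sub_sq_le hγ hf hg hfg hKs (t := -s) (by simpa using hs)
    have hB0 : 0 ≤ B := (abs_nonneg _).trans (hB 1)
    rw [e2]
    refine (abs_add_le _ _).trans ?_
    have b4 : |s|⁻¹ * ∫ x in sweep γ K, (f (x * γ (-s)) - f x) ^ 2 ∂ρ ≤ |s| * Gss := by
      rw [inv_mul_le_iff₀ hs1]
      calc _ ≤ _ := b3
        _ = _ := by rw [← mul_assoc, abs_mul_abs_self, neg_sq, sq]
    have b5 : B / 2 * (|s| * Gs + |s|⁻¹ * ∫ x in sweep γ K, (f (x * γ (-s)) - f x) ^ 2 ∂ρ) ≤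
        B / 2 * (|s| * Gs + |s| * Gss) :=
      mul_le_mul_of_nonneg_left (by linarith) (by linarith)
    simp only [inv_one, one_mul] at b2
    have := add_le_add (b1.trans b5) b2
    refine this.trans (le_of_eq ?_)
    ring
  -- Fubini
  have hEint : ∀ t, |t| ≤ 1 → IntervalIntegrable E volume 0 t ∧
      ∫ x, (f (x * γ t) - f x) * f x * ψ x ∂ρ = ∫ s in (0 : ℝ)..t, E s := by
    intro t ht
    have hm : Measurable fun p : ℝ × G => g (p.2 * γ p.1) * f p.2 * ψ p.2 :=
      ((hg.1.comp ((continuous_snd.mul (hγ.continuous.comp continuous_fst)).measurable)).mul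
        (hf.1.comp measurable_snd)).mul (hψ.comp measurable_snd)
    have hI : Integrable (fun p : ℝ × G => g (p.2 * γ p.1) * f p.2 * ψ p.2)
        ((volume.restrict (uIoc 0 t)).prod ρ) := by
      rw [integrable_prod_iff hm.aestronglyMeasurable]
      constructor
      · exact Eventually.of_forall fun s => integrable_mul_mul_of_memLp
          ((hg.translate (γ s)).2 _ hK) (hf.2 _ hK) hKm hψ hB h0
      · have : IsFiniteMeasure (volume.restrict (uIoc 0 t)) := by
          refine ⟨?_⟩
          simp [uIoc, Real.volume_Ioc]
        refine Integrable.mono' (g := fun _ => B / 2 * (Gs + ∫ x in K, f x ^ 2 ∂ρ))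
          (integrable_const _) ?_ ?_
        · exact hm.norm.stronglyMeasurable.integral_prod_right.aestronglyMeasurable
        · filter_upwards [ae_restrict_mem measurableSet_uIoc] with s hs
          have hs1 : |s| ≤ 1 := by
            have : |s - 0| ≤ |t - 0| := abs_sub_left_of_mem_uIcc (uIoc_subset_uIcc hs)
            simp only [sub_zero] at this
            exact this.trans ht
          have b1 := integral_abs_mul_mul_le ((hg.translate (γ s)).2 _ hK) (hf.2 _ hK) hB h0
            one_pos
          have b2 := hg.setIntegral_translate_sq_le hK hKs (γ s) fun x hx => mul_mem_sweep hx hs1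
          simp only [inv_one, one_mul] at b1
          have hB0 : 0 ≤ B := (abs_nonneg _).trans (hB 1)
          rw [Real.norm_of_nonneg (integral_nonneg fun x => norm_nonneg _)]
          refine b1.trans (mul_le_mul_of_nonneg_left (by linarith) (by linarith))
    refine ⟨?_, ?_⟩
    · rw [intervalIntegrable_iff]
      exact hI.integral_prod_left
    · have e1 : ∫ x, (f (x * γ t) - f x) * f x * ψ x ∂ρ =
          ∫ x, (∫ s in (0 : ℝ)..t, g (x * γ s) * f x * ψ x) ∂ρ := by
        refine integral_congr_ae ?_
        filter_upwards [hfg t] with x hx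
        rw [hx, intervalIntegral.integral_mul_const, intervalIntegral.integral_mul_const]
      rw [e1]
      simp only [intervalIntegral.intervalIntegral_eq_integral_uIoc]
      rw [integral_smul]
      congr 1
      exact (integral_integral_swap hI).symm
  set C := B / 2 * (Gs + Gss) + B' / 2 * (Gs + Fs) with hC
  have hElip' : ∀ t, |t| ≤ 1 → |∫ x, (f (x * γ t) - f x) * f x * ψ x ∂ρ - t * E 0| ≤
      C * |t| * |t| := by
    intro t ht
    obtain ⟨h1, h2⟩ := hEint t ht
    have e1 : ∫ x, (f (x * γ t) - f x) * f x * ψ x ∂ρ - t * E 0 = ∫ s in (0 : ℝ)..t, (E s - E 0) := by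
      rw [h2, intervalIntegral.integral_sub h1 (by simp), intervalIntegral.integral_const]
      simp
    rw [e1]
    have := intervalIntegral.norm_integral_le_of_norm_le_const (a := 0) (b := t)
      (f := fun s => E s - E 0) (C := C * |t|) fun s hs => ?_
    · simpa using this
    · have hs1 : |s| ≤ |t| := by
        simpa using (abs_sub_left_of_mem_uIcc (uIoc_subset_uIcc hs) : |s - 0| ≤ |t - 0|)
      have hC0 : 0 ≤ C := by
        have := (abs_nonneg _).trans (hElip 1 (by simp))
        simpa using this
      exact (hElip s (hs1.trans ht)).trans (mul_le_mul_of_nonneg_left hs1 hC0)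
  -- the first derivative
  have d1 := hasDerivAt_integral_mul_flow (ρ := ρ) hγ (F := fun x => f x ^ 2)
    (fun K hK => (hf.2 K hK).integrable_sq) hK hψ h0 hd hB hB'
  have e1 : ∀ t, ∫ x, f x ^ 2 * ψ (x * γ (-t)) ∂ρ = ∫ x, f (x * γ t) ^ 2 * ψ x ∂ρ := by
    intro t
    rw [← integral_mul_right_eq_self _ (γ t)]
    simp only [hγ.mul_neg_cancel]
  -- the second derivative
  have d2 : HasDerivAt (fun t => ∫ x, f x ^ 2 * ψ (x * γ (-t)) ∂ρ) (2 * E 0) 0 := by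
    rw [hasDerivAt_iff_isLittleO_nhds_zero]
    have hbig : (fun h => ∫ x, f x ^ 2 * ψ (x * γ (-(0 + h))) ∂ρ -
        ∫ x, f x ^ 2 * ψ (x * γ (-0)) ∂ρ - h • (2 * E 0)) =O[𝓝 0] fun h : ℝ => h ^ 2 := by
      refine Asymptotics.IsBigO.of_bound (B * Gs + 2 * C) ?_
      filter_upwards [Metric.ball_mem_nhds (0 : ℝ) one_pos] with t ht
      have ht : |t| ≤ 1 := by
        rw [mem_ball_zero_iff, Real.norm_eq_abs] at ht
        exact ht.le
      rw [e1, e1]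
      simp only [zero_add, hγ.map_zero, mul_one, smul_eq_mul]
      have j0 : Integrable (fun x => f x * f x * ψ x) ρ :=
        integrable_mul_mul_of_memLp (hf.2 _ hK) (hf.2 _ hK) hKm hψ hB h0
      have j1 : Integrable (fun x => (f (x * γ t) - f x) * (f (x * γ t) - f x) * ψ x) ρ :=
        integrable_mul_mul_of_memLp (((hf.translate _).sub hf).2 _ hK)
          (((hf.translate _).sub hf).2 _ hK) hKm hψ hB h0
      have j2 : Integrable (fun x => (f (x * γ t) - f x) * f x * ψ x) ρ :=
        integrable_mul_mul_of_memLp (((hf.translate _).sub hf).2 _ hK) (hf.2 _ hK) hKm hψ hB h0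
      -- With `d` the increment of `f`, the increment of `f²` is `d² + 2 d f`. The first part is
      -- `O(t²)` after integration, and the second is `2 t E 0 + O(t²)` because `E` is Lipschitz at
      -- `0`.
      have e2 : ∫ x, f (x * γ t) ^ 2 * ψ x ∂ρ - ∫ x, f x ^ 2 * ψ x ∂ρ - t * (2 * E 0) =
          ∫ x, (f (x * γ t) - f x) * (f (x * γ t) - f x) * ψ x ∂ρ +
          2 * (∫ x, (f (x * γ t) - f x) * f x * ψ x ∂ρ - t * E 0) := by
        have e3 : ∫ x, f (x * γ t) ^ 2 * ψ x ∂ρ =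
            ∫ x, (f (x * γ t) - f x) * (f (x * γ t) - f x) * ψ x ∂ρ +
            2 * ∫ x, (f (x * γ t) - f x) * f x * ψ x ∂ρ + ∫ x, f x * f x * ψ x ∂ρ := by
          rw [← integral_const_mul, ← integral_add j1 (j2.const_mul 2),
            ← integral_add (f := fun x => (f (x * γ t) - f x) * (f (x * γ t) - f x) * ψ x +
              2 * ((f (x * γ t) - f x) * f x * ψ x)) (j1.add (j2.const_mul 2)) j0]
          congr 1
          ext x
          ring
        have e4 : ∫ x, f x ^ 2 * ψ x ∂ρ = ∫ x, f x * f x * ψ x ∂ρ := by simp only [sq]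
        rw [e3, e4]
        ring
      rw [e2, Real.norm_eq_abs, Real.norm_eq_abs, abs_pow, sq_abs]
      have b1 := abs_integral_mul_mul_le (((hf.translate (γ t)).sub hf).2 _ hK)
        (((hf.translate (γ t)).sub hf).2 _ hK) hB h0 one_pos
      have b2 := setIntegral_flow_sub_sq_le hγ hf hg hfg hK ht
      have b3 := hElip' t ht
      have hB0 : 0 ≤ B := (abs_nonneg _).trans (hB 1)
      have b4 := mul_le_mul_of_nonneg_left b2 hB0
      simp only [inv_one, one_mul] at b1
      rw [mul_assoc, abs_mul_abs_self] at b3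
      refine (abs_add_le _ _).trans ?_
      rw [abs_mul, abs_two]
      simp only [← hGs] at b4
      nlinarith
    exact hbig.trans_isLittleO (by simpa using Asymptotics.isLittleO_pow_pow (𝕜 := ℝ) one_lt_two)
  have h3 := d1.unique d2
  have e0 : E 0 = ∫ x, f x * g x * ψ x ∂ρ := by
    simp only [hE, hγ.map_zero, mul_one]
    congr 1
    ext x
    ring
  rw [e0] at h3
  linarith

end Translation

/-! ### Words in the one-parameter subgroups and word length -/

section Words

variable {G : Type*} [TopologicalSpace G] [Group G] [IsTopologicalGroup G] {ι : Type*}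

/-- The group elements reached from the identity in time at most one along one of the flows. -/
def letters (γ : ι → ℝ → G) : Set G := insert 1 (⋃ j, γ j '' Icc (-1) 1)

variable {γ : ι → ℝ → G}

lemma one_mem_letters : (1 : G) ∈ letters γ := mem_insert _ _

lemma apply_mem_letters (j : ι) {t : ℝ} (ht : |t| ≤ 1) : γ j t ∈ letters γ :=
  mem_insert_of_mem _ (mem_iUnion.2 ⟨j, t, abs_le.1 ht, rfl⟩)

lemma isCompact_letters [Finite ι] (hγ : ∀ j, IsOneParam (γ j)) : IsCompact (letters γ) :=
  (isCompact_iUnion fun j => isCompact_Icc.image (hγ j).continuous).insert 1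

lemma inv_mem_letters (hγ : ∀ j, IsOneParam (γ j)) {x : G} (hx : x ∈ letters γ) :
    x⁻¹ ∈ letters γ := by
  rcases hx with rfl | hx
  · simp [one_mem_letters]
  · obtain ⟨j, t, ht, rfl⟩ := mem_iUnion.1 hx
    rw [← (hγ j).map_neg]
    exact apply_mem_letters j (by simpa using abs_le.2 ht)

lemma inv_letters (hγ : ∀ j, IsOneParam (γ j)) : (letters γ)⁻¹ = letters γ := by
  ext x
  rw [Set.mem_inv]
  exact ⟨fun h => by simpa using inv_mem_letters hγ h, inv_mem_letters hγ⟩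

lemma isCompact_pow {S : Set G} (hS : IsCompact S) (n : ℕ) : IsCompact (S ^ n) := by
  induction n with
  | zero => simp
  | succ n ih => rw [pow_succ]; exact ih.mul hS

lemma inv_mem_letters_pow (hγ : ∀ j, IsOneParam (γ j)) {n : ℕ} {x : G}
    (hx : x ∈ letters γ ^ n) : x⁻¹ ∈ letters γ ^ n := by
  rw [← inv_letters hγ, inv_pow, Set.mem_inv, inv_inv]
  exact hx

lemma letters_pow_mono {m n : ℕ} (h : m ≤ n) : letters γ ^ m ⊆ letters γ ^ n :=
  pow_subset_pow_right one_mem_letters h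

/-- Every compact set consists of words of bounded length in the flows. -/
def Generates (γ : ι → ℝ → G) : Prop := ∀ K : Set G, IsCompact K → ∃ n, K ⊆ letters γ ^ n

/-- The least length of a word representing `x`. -/
noncomputable def wordLength (γ : ι → ℝ → G) (x : G) : ℕ := sInf {n | x ∈ letters γ ^ n}

lemma wordLength_le_iff (h : Generates γ) {x : G} {n : ℕ} :
    wordLength γ x ≤ n ↔ x ∈ letters γ ^ n := by
  constructor
  · intro hn
    obtain ⟨m, hm⟩ := h {x} isCompact_singleton
    have : x ∈ letters γ ^ wordLength γ x :=
      Nat.sInf_mem (s := {n | x ∈ letters γ ^ n}) ⟨m, hm rfl⟩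
    exact letters_pow_mono hn this
  · intro hx
    exact Nat.sInf_le hx

lemma wordLength_mul_le (h : Generates γ) (x y : G) :
    wordLength γ (x * y) ≤ wordLength γ x + wordLength γ y := by
  rw [wordLength_le_iff h, pow_add]
  exact mul_mem_mul ((wordLength_le_iff h).1 le_rfl) ((wordLength_le_iff h).1 le_rfl)

/-- The triangle inequality for the left-invariant word metric; symmetry comes from `letters γ`
being closed under inversion. -/
lemma abs_wordLength_sub_le (hγ : ∀ j, IsOneParam (γ j)) (h : Generates γ) {x z : G} {m : ℕ}
    (hm : z⁻¹ * x ∈ letters γ ^ m) :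
    |(wordLength γ z : ℝ) - wordLength γ x| ≤ m := by
  have h1 := wordLength_mul_le h z (z⁻¹ * x)
  have h2 := wordLength_mul_le h x (z⁻¹ * x)⁻¹
  have h3 := (wordLength_le_iff h).2 hm
  have h4 := (wordLength_le_iff h).2 (inv_mem_letters_pow hγ hm)
  rw [mul_inv_cancel_left] at h1
  rw [mul_inv_rev, inv_inv, mul_inv_cancel_left] at h2
  rw [mul_inv_rev, inv_inv] at h4
  have h5 : (wordLength γ z : ℝ) ≤ wordLength γ x + m := by exact_mod_cast h2.trans (by omega)
  have h6 : (wordLength γ x : ℝ) ≤ wordLength γ z + m := by exact_mod_cast h1.trans (by omega)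
  rw [abs_le]
  constructor <;> linarith

variable [MeasurableSpace G] [BorelSpace G] [T2Space G]

/-- The sublevel sets are powers of a compact set, hence closed. -/
lemma measurable_wordLength [Finite ι] (hγ : ∀ j, IsOneParam (γ j)) (h : Generates γ) :
    Measurable (wordLength γ) := by
  refine measurable_of_Iic fun n => ?_
  have : wordLength γ ⁻¹' Iic n = letters γ ^ n := by
    ext x
    exact wordLength_le_iff h
  rw [this]
  exact (isCompact_pow (isCompact_letters hγ) n).measurableSet

end Words

/-! ### The local Poincaré inequality -/

section LocalPoincare

variable {G : Type*} [TopologicalSpace G] [Group G] [IsTopologicalGroup G] [T2Space G]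
  [SecondCountableTopology G] [MeasurableSpace G] [BorelSpace G]
  {ρ : Measure G} [ρ.IsMulRightInvariant] [SFinite ρ] {ι : Type*} [Fintype ι] {γ : ι → ℝ → G}

lemma enorm_add_sq_le (a b : ℝ) : ‖a + b‖ₑ ^ 2 ≤ 2 * (‖a‖ₑ ^ 2 + ‖b‖ₑ ^ 2) := by
  have h : ∀ c : ℝ, ‖c‖ₑ ^ 2 = ENNReal.ofReal (c ^ 2) := fun c => by
    rw [← sq_abs, ← Real.norm_eq_abs, ENNReal.ofReal_pow (norm_nonneg _), ofReal_norm]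
  rw [h, h, h, ← ENNReal.ofReal_add (sq_nonneg _) (sq_nonneg _),
    show (2 : ℝ≥0∞) = ENNReal.ofReal 2 by simp, ← ENNReal.ofReal_mul (by norm_num)]
  refine ENNReal.ofReal_le_ofReal ?_
  nlinarith [sq_nonneg (a - b)]

/-- The increment of a function under right translation by a word is bounded in `L²` by its
horizontal gradient. -/
lemma setLIntegral_word_sub_le (hγ : ∀ j, IsOneParam (γ j)) {f : G → ℝ} {g : ι → G → ℝ}
    (hf : Measurable f) (hg : ∀ j, Measurable (g j))
    (hfg : ∀ j, HasWeakFlowDeriv ρ (γ j) f (g j)) {K : Set G} (hK : IsCompact K) (n : ℕ)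
    {z : G} (hz : z ∈ letters γ ^ n) :
    ∫⁻ x in K, ‖f (x * z) - f x‖ₑ ^ 2 ∂ρ ≤
      4 ^ n * ∑ j, ∫⁻ x in K * letters γ ^ n, ‖g j x‖ₑ ^ 2 ∂ρ := by
  induction n generalizing z with
  | zero =>
    rw [pow_zero, Set.mem_one] at hz
    simp [hz]
  | succ n ih =>
    rw [pow_succ] at hz
    obtain ⟨w, hw, s, hs, rfl⟩ := mem_mul.1 hz
    set Γ := ∑ j, ∫⁻ x in K * letters γ ^ (n + 1), ‖g j x‖ₑ ^ 2 ∂ρ with hΓ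
    have hKn : IsCompact (K * letters γ ^ n) := hK.mul (isCompact_pow (isCompact_letters hγ) n)
    have h1 : ∫⁻ x in K, ‖f (x * w) - f x‖ₑ ^ 2 ∂ρ ≤ 4 ^ n * Γ := by
      refine (ih hw).trans (mul_le_mul_right (Finset.sum_le_sum fun j _ => ?_) _)
      exact lintegral_mono_set (mul_subset_mul_left (letters_pow_mono n.le_succ))
    -- Translation by `w` carries `K` into `K * letters γ ^ n`; what remains there is a single flow
    -- step of time at most `1`.
    have h2 : ∫⁻ x in K, ‖f (x * w * s) - f (x * w)‖ₑ ^ 2 ∂ρ ≤ Γ := by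
      refine (setLIntegral_mul_right_le (F := fun y => ‖f (y * s) - f y‖ₑ ^ 2) hK hKn w
        fun x hx => mul_mem_mul hx hw).trans ?_
      rcases hs with rfl | hs
      · simp
      · obtain ⟨j, t, ht, rfl⟩ := mem_iUnion.1 hs
        have ht' : |t| ≤ 1 := abs_le.2 ht
        refine (setLIntegral_flow_sub_le (hγ j) (hg j) (hfg j) hKn ht').trans ?_
        calc _ ≤ 1 * ∫⁻ x in sweep (γ j) (K * letters γ ^ n), ‖g j x‖ₑ ^ 2 ∂ρ := by
              gcongr
              rw [ENNReal.ofReal_le_one]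
              exact (sq_le_one_iff_abs_le_one t).2 ht'
          _ ≤ ∫⁻ x in K * letters γ ^ (n + 1), ‖g j x‖ₑ ^ 2 ∂ρ := by
              rw [one_mul]
              refine lintegral_mono_set ?_
              rw [pow_succ, ← mul_assoc]
              refine mul_subset_mul_left ?_
              rintro _ ⟨r, hr, rfl⟩
              exact apply_mem_letters j (abs_le.2 hr)
          _ ≤ Γ := Finset.single_le_sum (f := fun j =>
              ∫⁻ x in K * letters γ ^ (n + 1), ‖g j x‖ₑ ^ 2 ∂ρ) (fun _ _ => zero_le)
              (Finset.mem_univ j)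
    have hmw : Measurable fun x => ‖f (x * w) - f x‖ₑ ^ 2 :=
      ((hf.comp (continuous_mul_const w).measurable).sub hf).enorm.pow_const 2
    simp only [← mul_assoc]
    calc ∫⁻ x in K, ‖f (x * w * s) - f x‖ₑ ^ 2 ∂ρ
        ≤ ∫⁻ x in K, 2 * (‖f (x * w * s) - f (x * w)‖ₑ ^ 2 + ‖f (x * w) - f x‖ₑ ^ 2) ∂ρ := by
          refine lintegral_mono fun x => ?_
          have := enorm_add_sq_le (f (x * w * s) - f (x * w)) (f (x * w) - f x)
          rwa [sub_add_sub_cancel] at this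
      _ = 2 * (∫⁻ x in K, ‖f (x * w * s) - f (x * w)‖ₑ ^ 2 ∂ρ +
          ∫⁻ x in K, ‖f (x * w) - f x‖ₑ ^ 2 ∂ρ) := by
          rw [lintegral_const_mul' _ _ (by simp), lintegral_add_right _ hmw]
      _ ≤ 2 * (Γ + 4 ^ n * Γ) := by gcongr
      _ ≤ 2 * (4 ^ n * Γ + 4 ^ n * Γ) := by
          gcongr
          exact le_mul_of_one_le_left zero_le (one_le_pow₀ (by norm_num))
      _ = 4 ^ (n + 1) * Γ := by ring

/-- The local Poincaré inequality, with a larger compact set on the right-hand side. -/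
theorem exists_localPoincare [LocallyCompactSpace G] (hγ : ∀ j, IsOneParam (γ j))
    (hgen : Generates γ) {K : Set G} (hK : IsCompact K) (hK0 : (interior K).Nonempty) :
    ∃ (D : ℝ≥0) (K' : Set G), IsCompact K' ∧ ∀ (f : G → ℝ) (g : ι → G → ℝ), Measurable f →
      (∀ j, Measurable (g j)) → (∀ j, HasWeakFlowDeriv ρ (γ j) f (g j)) →
      ∃ m : ℝ, ∫⁻ x in K, ‖f x - m‖ₑ ^ 2 ∂ρ ≤ D * ∑ j, ∫⁻ x in K', ‖g j x‖ₑ ^ 2 ∂ρ := by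
  obtain ⟨K₀⟩ : Nonempty (TopologicalSpace.PositiveCompacts G) := inferInstance
  -- The averaging variable needs a left Haar measure: for fixed `x` the substitution `y = x * z` is
  -- a left translation. The variable `x` keeps the right-invariant `ρ`, under which increments by
  -- words are controlled.
  let ν : Measure G := Measure.haarMeasure K₀
  have hKK : IsCompact (K⁻¹ * K) := hK.inv.mul hK
  obtain ⟨n, hn⟩ := hgen _ hKK
  have hν0 : ν K ≠ 0 := (Measure.measure_pos_of_nonempty_interior ν hK0).ne'
  have hν1 : ν K ≠ ⊤ := hK.measure_lt_top.ne
  have hD : (ν K)⁻¹ * (ν (K⁻¹ * K) * 4 ^ n) ≠ ⊤ :=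
    ENNReal.mul_ne_top (ENNReal.inv_ne_top.2 hν0)
      (ENNReal.mul_ne_top hKK.measure_lt_top.ne (by simp))
  refine ⟨((ν K)⁻¹ * (ν (K⁻¹ * K) * 4 ^ n)).toNNReal, K * letters γ ^ n,
    hK.mul (isCompact_pow (isCompact_letters hγ) n), fun f g hf hg hfg => ?_⟩
  rw [ENNReal.coe_toNNReal hD]
  set Γ := ∑ j, ∫⁻ x in K * letters γ ^ n, ‖g j x‖ₑ ^ 2 ∂ρ with hΓ
  have hm1 : Measurable fun p : G × G => ‖f p.1 - f p.2‖ₑ ^ 2 :=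
    ((hf.comp measurable_fst).sub (hf.comp measurable_snd)).enorm.pow_const 2
  have hm2 : Measurable fun p : G × G => ‖f (p.1 * p.2) - f p.1‖ₑ ^ 2 :=
    ((hf.comp measurable_mul).sub (hf.comp measurable_fst)).enorm.pow_const 2
  have hm3 : Measurable fun y => ∫⁻ x in K, ‖f x - f y‖ₑ ^ 2 ∂ρ :=
    Measurable.lintegral_prod_left (f := fun x y : G => ‖f x - f y‖ₑ ^ 2) hm1
  -- The constant is a value `f y` at a point where the mean square deviation does not exceed its
  -- average, so no integrability of `f` is required.
  obtain ⟨y, -, hy⟩ := exists_le_setLAverage hν0 hν1 hm3.aemeasurable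
  refine ⟨f y, hy.trans ?_⟩
  rw [setLAverage_eq, ENNReal.div_eq_inv_mul, mul_assoc, mul_assoc]
  refine mul_le_mul_right ?_ _
  calc ∫⁻ y in K, ∫⁻ x in K, ‖f x - f y‖ₑ ^ 2 ∂ρ ∂ν
      = ∫⁻ x in K, ∫⁻ y in K, ‖f x - f y‖ₑ ^ 2 ∂ν ∂ρ :=
        (lintegral_lintegral_swap (f := fun x y => ‖f x - f y‖ₑ ^ 2) hm1.aemeasurable).symm
    _ ≤ ∫⁻ x in K, ∫⁻ z in K⁻¹ * K, ‖f (x * z) - f x‖ₑ ^ 2 ∂ν ∂ρ := by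
        refine setLIntegral_mono' hK.measurableSet fun x hx => ?_
        rw [← lintegral_indicator hK.measurableSet, ← lintegral_indicator hKK.measurableSet,
          ← lintegral_mul_left_eq_self (μ := ν) _ x]
        refine lintegral_mono fun z => ?_
        by_cases hz : x * z ∈ K
        · have : z ∈ K⁻¹ * K := by
            have := mul_mem_mul (inv_mem_inv.2 hx) hz
            rwa [inv_mul_cancel_left] at this
          rw [indicator_of_mem hz, indicator_of_mem this, ← enorm_neg, neg_sub]
        · simp [hz]
    _ = ∫⁻ z in K⁻¹ * K, ∫⁻ x in K, ‖f (x * z) - f x‖ₑ ^ 2 ∂ρ ∂ν :=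
        lintegral_lintegral_swap (f := fun x z => ‖f (x * z) - f x‖ₑ ^ 2) hm2.aemeasurable
    _ ≤ ∫⁻ z in K⁻¹ * K, 4 ^ n * Γ ∂ν :=
        setLIntegral_mono' hKK.measurableSet fun z hz =>
          setLIntegral_word_sub_le hγ hf hg hfg hK n (hn hz)
    _ = ν (K⁻¹ * K) * (4 ^ n * Γ) := by rw [setLIntegral_const, mul_comm]

end LocalPoincare

/-! ### Cutoff functions with small horizontal gradient -/

section Cutoff

variable {G : Type*} [TopologicalSpace G] [Group G] [IsTopologicalGroup G] [T2Space G]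
  [SecondCountableTopology G] [MeasurableSpace G] [BorelSpace G]

/-- Differentiation of a convolution along the flow. -/
lemma hasFlowDeriv_convolution {ν : Measure G} [IsFiniteMeasureOnCompacts ν]
    {γ : ℝ → G} (hγ : IsOneParam γ) {q ψ ψ' : G → ℝ} (hq : Measurable q) {C : ℝ}
    (hC : ∀ x, |q x| ≤ C) (hψ : Continuous ψ) (hψ' : Continuous ψ') (hψc : HasCompactSupport ψ)
    (hd : HasFlowDeriv γ ψ ψ') :
    HasFlowDeriv γ (fun x => ∫ z, q z * ψ (z⁻¹ * x) ∂ν) (fun x => ∫ z, q z * ψ' (z⁻¹ * x) ∂ν) := by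
  intro x
  have hK : IsCompact (tsupport ψ) := hψc
  have h0 : ∀ y, y ∉ tsupport ψ → ψ y = 0 := fun y hy => image_eq_zero_of_notMem_tsupport hy
  have h0' : ∀ y, y ∉ tsupport ψ → ψ' y = 0 := fun y hy =>
    hd.eq_zero_of_notMem hγ (isClosed_tsupport ψ) h0 hy
  -- For `|t| ≤ 1` the integrand can be nonzero only when `z` lies in this compact set, so
  -- domination is by a constant on it.
  set L : Set G := ({x} * γ '' Icc (-1) 1) * (tsupport ψ)⁻¹ with hL
  have hLc : IsCompact L :=
    (isCompact_singleton.mul (isCompact_Icc.image hγ.continuous)).mul hK.inv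
  have hz0 : ∀ φ : G → ℝ, (∀ y, y ∉ tsupport ψ → φ y = 0) → ∀ z, z ∉ L → ∀ t, |t| ≤ 1 →
      φ (z⁻¹ * (x * γ t)) = 0 := by
    intro φ hφ z hz t ht
    refine hφ _ fun h => hz ?_
    have := mul_mem_mul (mul_mem_sweep (γ := γ) (mem_singleton x) ht) (inv_mem_inv.2 h)
    rwa [mul_inv_rev, inv_inv, mul_inv_cancel_left] at this
  obtain ⟨B', hB'⟩ := hψ'.bounded_above_of_compact_support
    (HasCompactSupport.of_support_subset_isCompact hK fun y hy => by
      by_contra h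
      exact hy (h0' y h))
  obtain ⟨B, hB⟩ := hψ.bounded_above_of_compact_support hψc
  have hcont : ∀ φ : G → ℝ, Continuous φ → ∀ t, Measurable fun z => q z * φ (z⁻¹ * (x * γ t)) :=
    fun φ hφ t => hq.mul (hφ.comp (continuous_inv.mul continuous_const)).measurable
  have hb : ∀ t ∈ Metric.ball (0 : ℝ) 1, |t| ≤ 1 := fun t ht => by
    rw [mem_ball_zero_iff, Real.norm_eq_abs] at ht
    exact ht.le
  have hC0 : 0 ≤ C := (abs_nonneg _).trans (hC 1)
  have main := hasDerivAt_integral_of_dominated_loc_of_deriv_le (μ := ν)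
    (F := fun t z => q z * ψ (z⁻¹ * (x * γ t))) (F' := fun t z => q z * ψ' (z⁻¹ * (x * γ t)))
    (x₀ := (0 : ℝ)) (s := Metric.ball 0 1)
    (bound := fun z => L.indicator (fun _ => C * B') z)
    (Metric.ball_mem_nhds _ one_pos) ?_ ?_ ?_ ?_ ?_ ?_
  · simpa [hγ.map_zero] using main.2
  · exact Eventually.of_forall fun t => (hcont ψ hψ t).aestronglyMeasurable
  · refine Integrable.mono' (g := L.indicator fun _ => C * B) ?_
      (hcont ψ hψ 0).aestronglyMeasurable (Eventually.of_forall fun z => ?_)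
    · rw [integrable_indicator_iff hLc.measurableSet]
      exact integrableOn_const hLc.measure_lt_top.ne
    · by_cases hz : z ∈ L
      · rw [indicator_of_mem hz, norm_mul]
        exact mul_le_mul (hC z) (hB _) (norm_nonneg _) hC0
      · rw [indicator_of_notMem hz, hz0 ψ h0 z hz 0 (by simp)]
        simp
  · exact (hcont ψ' hψ' 0).aestronglyMeasurable
  · refine Eventually.of_forall fun z t ht => ?_
    by_cases hz : z ∈ L
    · rw [indicator_of_mem hz, norm_mul]
      exact mul_le_mul (hC z) (hB' _) (norm_nonneg _) hC0
    · rw [indicator_of_notMem hz, hz0 ψ' h0' z hz t (hb t ht)]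
      simp
  · rw [integrable_indicator_iff hLc.measurableSet]
    exact integrableOn_const hLc.measure_lt_top.ne
  · refine Eventually.of_forall fun z t _ => ?_
    have h1 := (hd.hasDerivAt hγ (z⁻¹ * x) t).const_mul (q z)
    simpa [mul_assoc] using h1

variable {ι : Type*}

/-- A sequence of cutoff functions, exhausting `G`, whose derivatives along the flows tend to zero
uniformly. -/
structure IsCutoffSequence (γ : ι → ℝ → G) (η : ℕ → G → ℝ) (η' : ℕ → ι → G → ℝ) (δ : ℕ → ℝ) :
    Prop where
  tendsto : Tendsto δ atTop (𝓝 0)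
  measurable : ∀ n, Measurable (η n)
  nonneg : ∀ n x, 0 ≤ η n x
  le_one : ∀ n x, η n x ≤ 1
  compact : ∀ n, ∃ K, IsCompact K ∧ ∀ x, x ∉ K → η n x = 0
  deriv : ∀ n j, HasFlowDeriv (γ j) (η n) (η' n j)
  deriv_le : ∀ n j x, |η' n j x| ≤ δ n
  eventually_eq : ∀ x, ∀ᶠ n in atTop, η n x = 1

theorem exists_isCutoffSequence [LocallyCompactSpace G] [Finite ι] {γ : ι → ℝ → G}
    (hγ : ∀ j, IsOneParam (γ j))
    (hgen : Generates γ) {ψ : G → ℝ} {ψ' : ι → G → ℝ} (hψ : Continuous ψ)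
    (hψc : HasCompactSupport ψ) (hψ0 : ∀ x, 0 ≤ ψ x) (hψ1 : 0 < ψ 1)
    (hψ' : ∀ j, Continuous (ψ' j)) (hd : ∀ j, HasFlowDeriv (γ j) ψ (ψ' j)) :
    ∃ η η' δ, IsCutoffSequence γ η η' δ := by
  obtain ⟨K₀⟩ : Nonempty (TopologicalSpace.PositiveCompacts G) := inferInstance
  let ν : Measure G := Measure.haarMeasure K₀
  -- Left invariance makes the total mass of the convolution kernel independent of `x`; this mass is
  -- the normalising constant `c`.
  have hinv : ∀ (φ : G → ℝ) (x : G), ∫ z, φ (z⁻¹ * x) ∂ν = ∫ w, φ w⁻¹ ∂ν := by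
    intro φ x
    rw [← integral_mul_left_eq_self _ x]
    simp
  have hK : IsCompact (tsupport ψ) := hψc
  obtain ⟨m, hm⟩ := hgen _ hK
  set c := ∫ w, ψ w⁻¹ ∂ν with hc
  have hψi : Continuous fun w => ψ w⁻¹ := hψ.comp continuous_inv
  have hψic : HasCompactSupport fun w => ψ w⁻¹ := hψc.comp_homeomorph (Homeomorph.inv G)
  have hc0 : 0 < c := hψi.integral_pos_of_hasCompactSupport_nonneg_nonzero hψic (fun w => hψ0 _)
    (x := 1) (by simpa using hψ1.ne')
  have hψc' : ∀ j, HasCompactSupport (ψ' j) := fun j =>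
    HasCompactSupport.of_support_subset_isCompact hK fun y hy => by
      by_contra h
      exact hy ((hd j).eq_zero_of_notMem (hγ j) (isClosed_tsupport ψ)
        (fun y hy => image_eq_zero_of_notMem_tsupport hy) h)
  have hint : ∀ (φ : G → ℝ), Continuous φ → HasCompactSupport φ → ∀ x,
      Integrable (fun z => φ (z⁻¹ * x)) ν := by
    intro φ hφ hφc x
    refine (hφ.comp (continuous_inv.mul continuous_const)).integrable_of_hasCompactSupport ?_
    exact hφc.comp_homeomorph ((Homeomorph.inv G).trans (Homeomorph.mulRight x))
  -- The profile equals `1` up to word length `n + 1`, vanishes from `2 (n + 1)` on, and has slope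
  -- `1 / (n + 1)` in the word length. It is only measurable; convolution with `ψ` supplies the
  -- derivatives.
  let q : ℕ → G → ℝ := fun n z => max 0 (min 1 (2 - (wordLength γ z : ℝ) / ((n : ℝ) + 1)))
  have hq0 : ∀ n z, 0 ≤ q n z := fun n z => le_max_left _ _
  have hq1 : ∀ n z, q n z ≤ 1 := fun n z => max_le zero_le_one (min_le_left _ _)
  have hqa : ∀ n z, |q n z| ≤ 1 := fun n z => by rw [abs_of_nonneg (hq0 n z)]; exact hq1 n z
  have hqm : ∀ n, Measurable (q n) := fun n =>
    measurable_const.max (measurable_const.min (measurable_const.sub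
      (((measurable_from_nat (f := fun k : ℕ => (k : ℝ))).comp
        (measurable_wordLength hγ hgen)).div_const _)))
  have hqlip : ∀ n z x, |q n z - q n x| ≤
      |(wordLength γ z : ℝ) - wordLength γ x| / ((n : ℝ) + 1) := by
    intro n z x
    have hn : (0 : ℝ) < (n : ℝ) + 1 := by positivity
    have h1 := abs_max_sub_max_le_max (0 : ℝ) (min 1 (2 - (wordLength γ z : ℝ) / ((n : ℝ) + 1))) 0
      (min 1 (2 - (wordLength γ x : ℝ) / ((n : ℝ) + 1)))
    have h2 := abs_min_sub_min_le_max (1 : ℝ) (2 - (wordLength γ z : ℝ) / ((n : ℝ) + 1)) 1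
      (2 - (wordLength γ x : ℝ) / ((n : ℝ) + 1))
    simp only [sub_self, abs_zero, abs_nonneg, sup_of_le_right] at h1 h2
    refine h1.trans (h2.trans (le_of_eq ?_))
    rw [sub_sub_sub_cancel_left, ← sub_div, abs_div, abs_of_pos hn, abs_sub_comm]
  let D : ι → ℝ := fun j => ∫ w, |ψ' j w⁻¹| ∂ν
  obtain ⟨Dm, hDm⟩ : ∃ Dm, ∀ j, D j ≤ Dm := by
    obtain ⟨b, hb⟩ := (Set.finite_range D).bddAbove
    exact ⟨b, fun j => hb ⟨j, rfl⟩⟩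
  refine ⟨fun n x => c⁻¹ * ∫ z, q n z * ψ (z⁻¹ * x) ∂ν,
    fun n j x => c⁻¹ * ∫ z, q n z * ψ' j (z⁻¹ * x) ∂ν,
    fun n => c⁻¹ * (m / ((n : ℝ) + 1) * Dm), ?_, ?_, ?_, ?_, ?_, ?_, ?_, ?_⟩
  · have h1 : Tendsto (fun n : ℕ => (m : ℝ) / ((n : ℝ) + 1)) atTop (𝓝 0) := by
      have := (tendsto_one_div_add_atTop_nhds_zero_nat (𝕜 := ℝ)).const_mul (m : ℝ)
      simpa [div_eq_mul_inv] using this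
    simpa using (h1.mul_const Dm).const_mul c⁻¹
  · intro n
    refine Measurable.const_mul ?_ _
    have : Measurable fun p : G × G => q n p.2 * ψ (p.2⁻¹ * p.1) :=
      ((hqm n).comp measurable_snd).mul
        (hψ.comp ((continuous_snd.inv).mul continuous_fst)).measurable
    exact this.stronglyMeasurable.integral_prod_right.measurable
  · intro n x
    exact mul_nonneg (inv_nonneg.2 hc0.le)
      (integral_nonneg fun z => mul_nonneg (hq0 n z) (hψ0 _))
  · intro n x
    rw [inv_mul_le_iff₀ hc0, mul_one, hc, ← hinv ψ x]
    refine integral_mono_of_nonneg (Eventually.of_forall fun z => mul_nonneg (hq0 n z) (hψ0 _))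
      (hint ψ hψ hψc x) (Eventually.of_forall fun z => ?_)
    exact mul_le_of_le_one_left (hψ0 _) (hq1 n z)
  · intro n
    refine ⟨letters γ ^ (2 * (n + 1)) * tsupport ψ,
      (isCompact_pow (isCompact_letters hγ) _).mul hK, fun x hx => ?_⟩
    have : ∀ z, q n z * ψ (z⁻¹ * x) = 0 := by
      intro z
      by_contra h
      refine hx ?_
      have h1 : z⁻¹ * x ∈ tsupport ψ := by
        by_contra h'
        exact h (by rw [image_eq_zero_of_notMem_tsupport h', mul_zero])
      have h2 : z ∈ letters γ ^ (2 * (n + 1)) := by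
        rw [← wordLength_le_iff hgen]
        by_contra h'
        refine h ?_
        have h3 : (2 : ℝ) * ((n : ℝ) + 1) ≤ wordLength γ z := by
          exact_mod_cast (not_le.1 h').le
        have hn : (0 : ℝ) < (n : ℝ) + 1 := by positivity
        have h4 : q n z = 0 := by
          refine max_eq_left ((min_le_right _ _).trans ?_)
          rw [sub_nonpos, le_div_iff₀ hn]
          exact h3
        rw [h4, zero_mul]
      have := mul_mem_mul h2 h1
      rwa [mul_inv_cancel_left] at this
    simp [this]
  · intro n j
    exact (hasFlowDeriv_convolution (hγ j) (hqm n) (hqa n) hψ (hψ' j) hψc (hd j)).const_mul _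
  · intro n j x
    -- This is the flow derivative of the constant function `x ↦ ∫ ψ (z⁻¹ * x)`.
    have hz : ∫ z, ψ' j (z⁻¹ * x) ∂ν = 0 := by
      have h1 := hasFlowDeriv_convolution (ν := ν) (hγ j) (q := fun _ => 1) measurable_const
        (C := 1) (by simp) hψ (hψ' j) hψc (hd j)
      simp only [one_mul] at h1
      have h2 : (fun x => ∫ z, ψ (z⁻¹ * x) ∂ν) = fun _ => c := funext fun x => hinv ψ x
      rw [h2] at h1
      exact congrFun (h1.unique (HasFlowDeriv.const c)) x
    have hi := hint (ψ' j) (hψ' j) (hψc' j) x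
    have hqi : Integrable (fun z => q n z * ψ' j (z⁻¹ * x)) ν :=
      hi.bdd_mul (c := 1) (hqm n).aestronglyMeasurable (Eventually.of_forall fun z => hqa n z)
    -- Since the kernel `ψ' j` has mean zero, only the oscillation of `q n` over the support counts.
    -- Points `z` and `x` there differ by a word of length at most `m`, whence the factor `m / (n +
    -- 1)`.
    have e : ∫ z, q n z * ψ' j (z⁻¹ * x) ∂ν = ∫ z, (q n z - q n x) * ψ' j (z⁻¹ * x) ∂ν := by
      simp only [sub_mul]
      rw [integral_sub hqi (hi.const_mul _), integral_const_mul, hz, mul_zero, sub_zero]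
    rw [abs_mul, abs_of_pos (inv_pos.2 hc0), e]
    refine mul_le_mul_of_nonneg_left ?_ (inv_nonneg.2 hc0.le)
    have hmn : (0 : ℝ) ≤ m / ((n : ℝ) + 1) := by positivity
    calc |∫ z, (q n z - q n x) * ψ' j (z⁻¹ * x) ∂ν|
        ≤ ∫ z, m / ((n : ℝ) + 1) * |ψ' j (z⁻¹ * x)| ∂ν := by
          refine abs_integral_le_integral_abs.trans ?_
          refine integral_mono_of_nonneg (Eventually.of_forall fun z => abs_nonneg _)
            (hi.abs.const_mul _) (Eventually.of_forall fun z => ?_)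
          dsimp only
          rw [abs_mul]
          by_cases h : z⁻¹ * x ∈ tsupport ψ
          · refine mul_le_mul_of_nonneg_right ((hqlip n z x).trans ?_) (abs_nonneg _)
            refine div_le_div_of_nonneg_right ?_ (by positivity)
            exact abs_wordLength_sub_le hγ hgen (hm h)
          · have : ψ' j (z⁻¹ * x) = 0 := by
              exact (hd j).eq_zero_of_notMem (hγ j) (isClosed_tsupport ψ)
                (fun y hy => image_eq_zero_of_notMem_tsupport hy) h
            simp [this]
      _ = m / ((n : ℝ) + 1) * D j := by
          rw [integral_const_mul, hinv (fun y => |ψ' j y|)]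
      _ ≤ _ := mul_le_mul_of_nonneg_left (hDm j) hmn
  · intro x
    -- From this index on, every `z` seen by the kernel at `x` has word length at most `n`, where `q
    -- n` is `1`.
    filter_upwards [eventually_ge_atTop (wordLength γ x + m)] with n hn
    have : ∀ z, q n z * ψ (z⁻¹ * x) = ψ (z⁻¹ * x) := by
      intro z
      by_cases h : z⁻¹ * x ∈ tsupport ψ
      · have h1 := (abs_le.1 (abs_wordLength_sub_le hγ hgen (hm h))).2
        have h2 : (wordLength γ x : ℝ) + m ≤ n := by exact_mod_cast hn
        have hn : (0 : ℝ) < (n : ℝ) + 1 := by positivity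
        have h3 : (wordLength γ z : ℝ) / ((n : ℝ) + 1) ≤ 1 := by
          rw [div_le_one hn]
          linarith
        have h4 : q n z = 1 := by
          have : min 1 (2 - (wordLength γ z : ℝ) / ((n : ℝ) + 1)) = 1 := min_eq_left (by linarith)
          simp only [q, this]
          exact max_eq_right zero_le_one
        rw [h4, one_mul]
      · rw [image_eq_zero_of_notMem_tsupport h, mul_zero]
    simp only [this, hinv]
    exact inv_mul_cancel₀ hc0.ne'

end Cutoff

/-! ### Weighted estimates: lower bound for the potential and the Poincaré inequality -/

section Weighted

variable {G : Type*} [TopologicalSpace G] [Group G] [IsTopologicalGroup G] [T2Space G]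
  [SecondCountableTopology G] [MeasurableSpace G] [BorelSpace G]
  {ρ : Measure G} [ρ.IsMulRightInvariant] [SFinite ρ]

/-- Integration by parts against `η ^ 2 * P` with `η` a cutoff function. -/
lemma integral_cutoff_byParts {γ : ℝ → G} (hγ : IsOneParam γ) {f g : G → ℝ}
    (hf : LocallyL2 ρ f) (hg : LocallyL2 ρ g) (hfg : HasWeakFlowDeriv ρ γ f g) {K : Set G}
    (hK : IsCompact K) {η η' P P' : G → ℝ} (hη : Measurable η) (h0 : ∀ x, x ∉ K → η x = 0)
    (hn : ∀ x, 0 ≤ η x) (h1 : ∀ x, η x ≤ 1) (hd : HasFlowDeriv γ η η') {δ : ℝ}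
    (hδ : ∀ x, |η' x| ≤ δ) (hP : Continuous P) (hP' : Continuous P') (hdP : HasFlowDeriv γ P P') :
    Integrable (fun x => f x ^ 2 * (2 * η x * η' x * P x + η x ^ 2 * P' x) +
        2 * (f x * g x * (η x ^ 2 * P x))) ρ ∧
      ∫ x, (f x ^ 2 * (2 * η x * η' x * P x + η x ^ 2 * P' x) +
        2 * (f x * g x * (η x ^ 2 * P x))) ∂ρ = 0 := by
  -- The cutoff is squared so that its derivative retains a factor `η`; the cross term can then be
  -- absorbed into `η² |∇v|²` by Young's inequality.
  have hη2 : HasFlowDeriv γ (fun x => η x ^ 2) (fun x => 2 * η x * η' x) :=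
    HasFlowDeriv.comp hγ (F := fun y => y ^ 2) (F' := fun y => 2 * y)
      (fun x => by simpa using hasDerivAt_pow 2 (η x)) hd
  have hψd := HasFlowDeriv.mul hγ hη2 hdP
  have hψm : Measurable fun x => η x ^ 2 * P x := (hη.pow_const 2).mul hP.measurable
  have hψ0 : ∀ x, x ∉ K → η x ^ 2 * P x = 0 := fun x hx => by simp [h0 x hx]
  have hψ'0 : ∀ x, x ∉ K → 2 * η x * η' x * P x + η x ^ 2 * P' x = 0 := fun x hx => by
    simp [h0 x hx]
  obtain ⟨B, hB⟩ := hK.exists_bound_of_continuousOn hP.continuousOn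
  obtain ⟨B', hB'⟩ := hK.exists_bound_of_continuousOn hP'.continuousOn
  have hδ0 : 0 ≤ δ := (abs_nonneg _).trans (hδ 1)
  have hηa : ∀ x, |η x| ≤ 1 := fun x => by rw [abs_of_nonneg (hn x)]; exact h1 x
  have hη2a : ∀ x, |η x ^ 2| ≤ 1 := fun x => by
    rw [abs_pow]
    exact pow_le_one₀ (abs_nonneg _) (hηa x)
  have b1 : ∀ x, |η x ^ 2 * P x| ≤ |B| := by
    intro x
    by_cases hx : x ∈ K
    · rw [abs_mul]
      calc _ ≤ 1 * |B| := mul_le_mul (hη2a x) ((hB x hx).trans (le_abs_self _)) (abs_nonneg _)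
            zero_le_one
        _ = _ := one_mul _
    · rw [hψ0 x hx, abs_zero]
      exact abs_nonneg _
  have b2 : ∀ x, |2 * η x * η' x * P x + η x ^ 2 * P' x| ≤ 2 * δ * |B| + |B'| := by
    intro x
    by_cases hx : x ∈ K
    · refine (abs_add_le _ _).trans (add_le_add ?_ ?_)
      · rw [abs_mul, abs_mul, abs_mul, abs_two]
        have e1 : |η x| * |η' x| ≤ 1 * δ := mul_le_mul (hηa x) (hδ x) (abs_nonneg _) zero_le_one
        have e2 : |P x| ≤ |B| := (hB x hx).trans (le_abs_self _)
        have := mul_le_mul e1 e2 (abs_nonneg _) (by linarith)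
        linarith
      · rw [abs_mul]
        calc _ ≤ 1 * |B'| := mul_le_mul (hη2a x) ((hB' x hx).trans (le_abs_self _)) (abs_nonneg _)
              zero_le_one
          _ = _ := one_mul _
    · rw [hψ'0 x hx, abs_zero]
      positivity
  have key := integral_sq_mul_flowDeriv hγ hf hg hfg hK hψm hψ0 hψd b1 b2
  have hψ'm := hψd.measurable hγ hψm
  have i1 : Integrable (fun x => f x ^ 2 * (2 * η x * η' x * P x + η x ^ 2 * P' x)) ρ := by
    have := integrable_mul_mul_of_memLp (hf.2 _ hK) (hf.2 _ hK) hK.measurableSet hψ'm b2 hψ'0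
    simpa only [← sq] using this
  have i2 : Integrable (fun x => f x * g x * (η x ^ 2 * P x)) ρ :=
    integrable_mul_mul_of_memLp (hf.2 _ hK) (hg.2 _ hK) hK.measurableSet hψm b1 hψ0
  refine ⟨i1.add (i2.const_mul 2), ?_⟩
  rw [integral_add i1 (i2.const_mul 2), integral_const_mul, key]
  ring

/-- The data of a weighted sub-Laplacian, expressed along the flows: `χ` is a positive density with
logarithmic derivatives `c j`, and `v` has continuous first and second derivatives. -/
structure IsFlowPotential {ι : Type*} (γ : ι → ℝ → G) (χ : G → ℝ) (c : ι → ℝ) (v : G → ℝ)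
    (v' v'' : ι → G → ℝ) : Prop where
  oneParam : ∀ j, IsOneParam (γ j)
  generates : Generates γ
  pos : ∀ x, 0 < χ x
  continuous_χ : Continuous χ
  deriv_χ : ∀ j, HasFlowDeriv (γ j) χ fun x => c j * χ x
  continuous : Continuous v
  continuous_deriv : ∀ j, Continuous (v' j)
  continuous_deriv₂ : ∀ j, Continuous (v'' j)
  deriv : ∀ j, HasFlowDeriv (γ j) v (v' j)
  deriv₂ : ∀ j, HasFlowDeriv (γ j) (v' j) (v'' j)

lemma locallyL2_const [IsFiniteMeasureOnCompacts ρ] (c : ℝ) : LocallyL2 ρ fun _ : G => c :=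
  ⟨measurable_const, fun K hK => by
    have : IsFiniteMeasure (ρ.restrict K) := ⟨by simpa using hK.measure_lt_top⟩
    exact memLp_const c⟩

lemma hasWeakFlowDeriv_const (γ : ℝ → G) (c : ℝ) :
    HasWeakFlowDeriv ρ γ (fun _ => c) fun _ => 0 := fun t => by simp

lemma HasWeakFlowDeriv.sub_const {γ : ℝ → G} {f g : G → ℝ} (h : HasWeakFlowDeriv ρ γ f g) (c : ℝ) :
    HasWeakFlowDeriv ρ γ (fun x => f x - c) g := fun t => by
  filter_upwards [h t] with x hx
  rw [← hx]
  ring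

lemma integral_neg_add_eq {α : Type*} [MeasurableSpace α] {μ : Measure α} {A B : α → ℝ}
    (hA : Integrable A μ) (h0 : ∫ x, A x ∂μ = 0) (hB : Integrable B μ) :
    ∫ x, (-A x + B x) ∂μ = ∫ x, B x ∂μ := by
  have h := integral_add hA.neg hB
  simp only [Pi.neg_apply, integral_neg, h0, neg_zero, zero_add] at h
  exact h

/-- Squaring removes the corner of the positive part, which makes the truncation in
`IsFlowPotential.bddBelow` admissible in the chain rule. -/
lemma hasDerivAt_posPart_sq (y : ℝ) : HasDerivAt (fun z : ℝ => max z 0 ^ 2) (2 * max y 0) y := by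
  rcases lt_trichotomy y 0 with h | h | h
  · rw [max_eq_right h.le, mul_zero]
    refine (hasDerivAt_const y (0 : ℝ)).congr_of_eventuallyEq ?_
    filter_upwards [eventually_lt_nhds h] with z hz
    simp [max_eq_right hz.le]
  · subst h
    rw [max_self, mul_zero]
    refine HasDerivAt.of_isLittleO ?_
    have : (fun z : ℝ => max z 0 ^ 2) =O[𝓝 0] fun z : ℝ => z ^ 2 := by
      refine Asymptotics.IsBigO.of_bound 1 (Eventually.of_forall fun z => ?_)
      rw [one_mul, norm_pow, norm_pow]
      refine pow_le_pow_left₀ (norm_nonneg _) ?_ 2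
      rcases le_total z 0 with h | h <;> simp [h]
    have h2 := this.trans_isLittleO (Asymptotics.isLittleO_pow_id (𝕜 := ℝ) one_lt_two)
    simpa using h2
  · rw [max_eq_left h.le]
    have h1 : HasDerivAt (fun z : ℝ => z ^ 2) (2 * y) y := by simpa using hasDerivAt_pow 2 y
    refine h1.congr_of_eventuallyEq ?_
    filter_upwards [eventually_gt_nhds h] with z hz
    simp [max_eq_left hz.le]

variable {ι : Type*} [Fintype ι] {γ : ι → ℝ → G} {χ v : G → ℝ} {c : ι → ℝ} {v' v'' : ι → G → ℝ}
  {η : ℕ → G → ℝ} {η' : ℕ → ι → G → ℝ} {δ : ℕ → ℝ}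

/-- If `a |∇v|² - L v ≥ κ > 0` off a compact set and `exp (-v)` is integrable, then `v` is bounded
below. -/
theorem IsFlowPotential.bddBelow [IsFiniteMeasureOnCompacts ρ] [ρ.IsOpenPosMeasure]
    (H : IsFlowPotential γ χ c v v' v'') (hη : IsCutoffSequence γ η η' δ)
    (hint : Integrable (fun x => χ x * Real.exp (-v x)) ρ) {a κ : ℝ} (ha : a < 1) (hκ : 0 < κ)
    {K : Set G} (hK : IsCompact K)
    (h : ∀ x, x ∉ K → κ ≤ a * ∑ j, v' j x ^ 2 - ∑ j, (v'' j x + c j * v' j x)) :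
    BddBelow (range v) := by
  obtain ⟨k₀, hk₀⟩ := hK.exists_bound_of_continuousOn
    (Real.continuous_exp.comp H.continuous.neg).continuousOn
  -- The level is at least `e^{-v}` on `K`, so the truncation vanishes there; the maximum with `1`
  -- makes `log k` meaningful.
  set k := max k₀ 1 with hk
  have hk1 : 0 < k := lt_of_lt_of_le one_pos (le_max_right _ _)
  have hkK : ∀ x ∈ K, Real.exp (-v x) ≤ k := fun x hx =>
    ((le_abs_self _).trans (hk₀ x hx)).trans (le_max_left _ _)
  let y : ℝ → ℝ := fun s => max (Real.exp (-s) - k) 0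
  -- A truncated `C¹` substitute for `e^{-s}`: it keeps the inequality `φ' ≤ -φ`, because `y s * exp
  -- s ≤ 1`, but vanishes where `e^{-s} ≤ k`.
  let φ : ℝ → ℝ := fun s => y s ^ 2 * Real.exp s
  let φ' : ℝ → ℝ := fun s => -(2 * y s) + y s ^ 2 * Real.exp s
  have hyc : Continuous y := ((Real.continuous_exp.comp continuous_neg).sub continuous_const).max
    continuous_const
  have hφc : Continuous φ := (hyc.pow 2).mul Real.continuous_exp
  have hφ'c : Continuous φ' :=
    ((continuous_const.mul hyc).neg).add ((hyc.pow 2).mul Real.continuous_exp)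
  have hy0 : ∀ s, 0 ≤ y s := fun s => le_max_right _ _
  have hy1 : ∀ s, y s * Real.exp s ≤ 1 := by
    intro s
    have h1 : y s ≤ Real.exp (-s) := max_le (by linarith) (Real.exp_pos _).le
    calc y s * Real.exp s ≤ Real.exp (-s) * Real.exp s :=
          mul_le_mul_of_nonneg_right h1 (Real.exp_pos _).le
      _ = 1 := by rw [← Real.exp_add]; simp
  have hφ0 : ∀ s, 0 ≤ φ s := fun s => mul_nonneg (sq_nonneg _) (Real.exp_pos _).le
  have hφ1 : ∀ s, φ s ≤ Real.exp (-s) := by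
    intro s
    have h1 : y s ≤ Real.exp (-s) := max_le (by linarith) (Real.exp_pos _).le
    have h2 := mul_le_mul_of_nonneg_left (hy1 s) (hy0 s)
    have h3 : φ s = y s * (y s * Real.exp s) := by simp only [φ]; ring
    linarith
  have hφφ : ∀ s, φ' s ≤ -φ s := by
    intro s
    have h2 := mul_le_mul_of_nonneg_left (hy1 s) (hy0 s)
    simp only [φ, φ']
    nlinarith
  have hφd : ∀ s, HasDerivAt φ (φ' s) s := by
    intro s
    have h1 : HasDerivAt (fun s => Real.exp (-s) - k) (-Real.exp (-s)) s := by
      simpa using ((hasDerivAt_neg s).exp).sub_const k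
    have h2 := ((hasDerivAt_posPart_sq (Real.exp (-s) - k)).comp s h1).mul (Real.hasDerivAt_exp s)
    refine h2.congr_deriv ?_
    have h3 : Real.exp (-s) * Real.exp s = 1 := by rw [← Real.exp_add]; simp
    simp only [Function.comp_apply, φ', y]
    linear_combination (-(2 * max (Real.exp (-s) - k) 0)) * h3
  let P : ι → G → ℝ := fun j x => χ x * (v' j x * φ (v x))
  let P' : ι → G → ℝ := fun j x =>
    c j * χ x * (v' j x * φ (v x)) + χ x * (v'' j x * φ (v x) + v' j x * (φ' (v x) * v' j x))
  have hPc : ∀ j, Continuous (P j) := fun j =>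
    H.continuous_χ.mul ((H.continuous_deriv j).mul (hφc.comp H.continuous))
  have hP'c : ∀ j, Continuous (P' j) := fun j =>
    ((continuous_const.mul H.continuous_χ).mul
      ((H.continuous_deriv j).mul (hφc.comp H.continuous))).add (H.continuous_χ.mul
      (((H.continuous_deriv₂ j).mul (hφc.comp H.continuous)).add ((H.continuous_deriv j).mul
        ((hφ'c.comp H.continuous).mul (H.continuous_deriv j)))))
  have hPd : ∀ j, HasFlowDeriv (γ j) (P j) (P' j) := fun j =>
    HasFlowDeriv.mul (H.oneParam j) (H.deriv_χ j) (HasFlowDeriv.mul (H.oneParam j) (H.deriv₂ j)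
      (HasFlowDeriv.comp (H.oneParam j) (fun x => hφd (v x)) (H.deriv j)))
  set A := (Fintype.card ι : ℝ) / (1 - a) * ∫ x, χ x * Real.exp (-v x) ∂ρ with hA
  have main : ∀ n, κ * ∫ x, η n x ^ 2 * (χ x * φ (v x)) ∂ρ ≤ δ n ^ 2 * A := by
    intro n
    obtain ⟨L, hL, hL0⟩ := hη.compact n
    have ibp := fun j => integral_cutoff_byParts (H.oneParam j) (locallyL2_const (ρ := ρ) 1)
      (locallyL2_const (ρ := ρ) 0) (hasWeakFlowDeriv_const (γ j) 1) hL (hη.measurable n) hL0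
      (hη.nonneg n) (hη.le_one n) (hη.deriv n j) (hη.deriv_le n j) (hPc j) (hP'c j) (hPd j)
    have hsumi := integrable_finsetSum Finset.univ fun j _ => (ibp j).1
    have hsum0 := integral_finsetSum Finset.univ fun j _ => (ibp j).1
    rw [Finset.sum_eq_zero fun j _ => (ibp j).2] at hsum0
    have hpt : ∀ x, κ * (η n x ^ 2 * (χ x * φ (v x))) ≤
        -(∑ j, ((1 : ℝ) ^ 2 * (2 * η n x * η' n j x * P j x + η n x ^ 2 * P' j x) +
          2 * (1 * 0 * (η n x ^ 2 * P j x)))) +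
        δ n ^ 2 * ((Fintype.card ι : ℝ) / (1 - a)) * (χ x * Real.exp (-v x)) := by
      intro x
      have ha' : 0 < 1 - a := by linarith
      have hχ := H.pos x
      set S := ∑ j, v' j x ^ 2 with hS
      set Lv := ∑ j, (v'' j x + c j * v' j x) with hLv
      set T := ∑ j, η' n j x * v' j x with hT
      set N := ∑ j, η' n j x ^ 2 with hN
      have e1 : ∑ j, ((1 : ℝ) ^ 2 * (2 * η n x * η' n j x * P j x + η n x ^ 2 * P' j x) +
          2 * (1 * 0 * (η n x ^ 2 * P j x))) =
          χ x * (2 * η n x * φ (v x) * T + η n x ^ 2 * (φ (v x) * Lv + φ' (v x) * S)) := by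
        rw [hT, hLv, hS, Finset.mul_sum, Finset.mul_sum, Finset.mul_sum, ← Finset.sum_add_distrib,
          Finset.mul_sum, ← Finset.sum_add_distrib, Finset.mul_sum]
        refine Finset.sum_congr rfl fun j _ => ?_
        simp only [P, P']
        ring
      rw [e1]
      have hNδ : N ≤ Fintype.card ι * δ n ^ 2 := by
        have : N ≤ ∑ _j : ι, δ n ^ 2 := by
          refine Finset.sum_le_sum fun j _ => ?_
          rw [← sq_abs]
          exact pow_le_pow_left₀ (abs_nonneg _) (hη.deriv_le n j x) 2
        simpa using this
      have hS0 : 0 ≤ S := Finset.sum_nonneg fun j _ => sq_nonneg _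
      -- The inequality `φ' ≤ -φ` makes a full multiple of `|∇v|²` available. The hypothesis uses
      -- the fraction `a`, and the remaining `1 - a` absorbs the gradient of the cutoff.
      have hyoung : 2 * η n x * T ≤ (1 - a) * (η n x ^ 2 * S) + N / (1 - a) := by
        rw [hT, hN, hS, Finset.mul_sum, Finset.mul_sum, Finset.mul_sum, Finset.sum_div,
          ← Finset.sum_add_distrib]
        refine Finset.sum_le_sum fun j _ => ?_
        have h1 : 0 ≤ ((1 - a) * (η n x * v' j x) - η' n j x) ^ 2 / (1 - a) := by positivity
        have h2 : ((1 - a) * (η n x * v' j x) - η' n j x) ^ 2 / (1 - a) =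
            (1 - a) * (η n x ^ 2 * v' j x ^ 2) + η' n j x ^ 2 / (1 - a) -
              2 * η n x * (η' n j x * v' j x) := by
          field_simp
          ring
        linarith
      have hyoung' : -(2 * η n x * T) ≤ (1 - a) * (η n x ^ 2 * S) + N / (1 - a) := by
        rw [hT, hN, hS, Finset.mul_sum, Finset.mul_sum, Finset.mul_sum, Finset.sum_div,
          ← Finset.sum_add_distrib, ← Finset.sum_neg_distrib]
        refine Finset.sum_le_sum fun j _ => ?_
        have h1 : 0 ≤ ((1 - a) * (η n x * v' j x) + η' n j x) ^ 2 / (1 - a) := by positivity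
        have h2 : ((1 - a) * (η n x * v' j x) + η' n j x) ^ 2 / (1 - a) =
            (1 - a) * (η n x ^ 2 * v' j x ^ 2) + η' n j x ^ 2 / (1 - a) +
              2 * η n x * (η' n j x * v' j x) := by
          field_simp
          ring
        linarith
      have hNδ' : N / (1 - a) ≤ δ n ^ 2 * ((Fintype.card ι : ℝ) / (1 - a)) := by
        rw [mul_div_assoc', mul_comm (δ n ^ 2)]
        exact div_le_div_of_nonneg_right hNδ ha'.le
      have hrest : 0 ≤ δ n ^ 2 * ((Fintype.card ι : ℝ) / (1 - a)) := by positivity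
      by_cases hy : y (v x) = 0
      · have z1 : φ (v x) = 0 := by simp [φ, hy]
        have z2 : φ' (v x) = 0 := by simp [φ', hy]
        rw [z1, z2]
        have := mul_nonneg hrest (mul_nonneg hχ.le (Real.exp_pos (-v x)).le)
        simpa using this
      · have hxK : x ∉ K := fun hx => hy (max_eq_right (by linarith [hkK x hx]))
        have hx := h x hxK
        have f0 := hφ0 (v x)
        have f1 := hφ1 (v x)
        have f2 := hφφ (v x)
        have g0 : 0 ≤ η n x ^ 2 * S := by positivity
        have g1 : η n x ^ 2 * S * φ' (v x) ≤ η n x ^ 2 * S * -φ (v x) :=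
          mul_le_mul_of_nonneg_left f2 g0
        have g2 : φ (v x) * η n x ^ 2 * κ ≤ φ (v x) * η n x ^ 2 * (a * S - Lv) :=
          mul_le_mul_of_nonneg_left hx (by positivity)
        have g3 := mul_le_mul_of_nonneg_left hyoung f0
        have g4 : φ (v x) * (N / (1 - a)) ≤
            Real.exp (-v x) * (δ n ^ 2 * ((Fintype.card ι : ℝ) / (1 - a))) :=
          mul_le_mul f1 hNδ' (div_nonneg (Finset.sum_nonneg fun j _ => sq_nonneg _) ha'.le)
            (Real.exp_pos _).le
        have g5 : κ * (η n x ^ 2 * φ (v x)) ≤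
            -(2 * η n x * φ (v x) * T + η n x ^ 2 * (φ (v x) * Lv + φ' (v x) * S)) +
            Real.exp (-v x) * (δ n ^ 2 * ((Fintype.card ι : ℝ) / (1 - a))) := by
          linarith
        have := mul_le_mul_of_nonneg_left g5 hχ.le
        linarith
    have hI2 : Integrable (fun x => δ n ^ 2 * ((Fintype.card ι : ℝ) / (1 - a)) *
        (χ x * Real.exp (-v x))) ρ := hint.const_mul _
    rw [← integral_const_mul]
    calc _ ≤ ∫ x, (-(∑ j, ((1 : ℝ) ^ 2 * (2 * η n x * η' n j x * P j x + η n x ^ 2 * P' j x) +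
          2 * (1 * 0 * (η n x ^ 2 * P j x)))) +
          δ n ^ 2 * ((Fintype.card ι : ℝ) / (1 - a)) * (χ x * Real.exp (-v x))) ∂ρ := by
          refine integral_mono_of_nonneg (Eventually.of_forall fun x => ?_) (hsumi.neg.add hI2)
            (Eventually.of_forall hpt)
          exact mul_nonneg hκ.le (mul_nonneg (sq_nonneg _) (mul_nonneg (H.pos x).le (hφ0 _)))
      _ = δ n ^ 2 * A := by
          rw [integral_neg_add_eq hsumi hsum0 hI2, integral_const_mul, hA]
          ring
  have hcont : Continuous fun x => χ x * φ (v x) := H.continuous_χ.mul (hφc.comp H.continuous)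
  have hnn : ∀ x, 0 ≤ χ x * φ (v x) := fun x => mul_nonneg (H.pos x).le (hφ0 _)
  have hle : ∀ x, χ x * φ (v x) ≤ χ x * Real.exp (-v x) := fun x =>
    mul_le_mul_of_nonneg_left (hφ1 _) (H.pos x).le
  have hi : Integrable (fun x => χ x * φ (v x)) ρ :=
    hint.mono' hcont.aestronglyMeasurable (Eventually.of_forall fun x => by
      rw [Real.norm_of_nonneg (hnn x)]
      exact hle x)
  have hlim : Tendsto (fun n => ∫ x, η n x ^ 2 * (χ x * φ (v x)) ∂ρ) atTop
      (𝓝 (∫ x, χ x * φ (v x) ∂ρ)) := by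
    refine tendsto_integral_of_dominated_convergence (fun x => χ x * φ (v x))
      (fun n => (((hη.measurable n).pow_const 2).mul hcont.measurable).aestronglyMeasurable) hi
      (fun n => Eventually.of_forall fun x => ?_) (Eventually.of_forall fun x => ?_)
    · rw [Real.norm_of_nonneg (mul_nonneg (sq_nonneg _) (hnn x))]
      exact mul_le_of_le_one_left (hnn x) (pow_le_one₀ (hη.nonneg n x) (hη.le_one n x))
    · refine tendsto_const_nhds.congr' ?_
      filter_upwards [hη.eventually_eq x] with n hn
      rw [hn, one_pow, one_mul]
  have h0 : κ * ∫ x, χ x * φ (v x) ∂ρ ≤ 0 := by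
    have h1 : Tendsto (fun n => δ n ^ 2 * A) atTop (𝓝 0) := by
      simpa using (hη.tendsto.pow 2).mul_const A
    exact le_of_tendsto_of_tendsto' (hlim.const_mul κ) h1 main
  have h1 : ∫ x, χ x * φ (v x) ∂ρ = 0 :=
    le_antisymm (nonpos_of_mul_nonpos_right h0 hκ) (integral_nonneg hnn)
  have h2 : (fun x => χ x * φ (v x)) =ᵐ[ρ] 0 :=
    (integral_eq_zero_iff_of_nonneg hnn hi).1 h1
  -- Continuity and positivity of `ρ` on open sets turn vanishing almost everywhere into vanishing
  -- everywhere.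
  have h3 := (Continuous.ae_eq_iff_eq ρ hcont continuous_const).1 h2
  refine ⟨-Real.log k, ?_⟩
  rintro _ ⟨x, rfl⟩
  have h4 : χ x * φ (v x) = 0 := congrFun h3 x
  have h5 : φ (v x) = 0 := (mul_eq_zero.1 h4).resolve_left (H.pos x).ne'
  have h6 : y (v x) ^ 2 = 0 := (mul_eq_zero.1 h5).resolve_right (Real.exp_pos _).ne'
  have h7 : Real.exp (-v x) - k ≤ 0 := by
    have : y (v x) = 0 := by simpa using h6
    rw [← this]
    exact le_max_left _ _
  have h8 : -v x ≤ Real.log k := (Real.le_log_iff_exp_le hk1).2 (by linarith)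
  linarith

/-- A continuous positive weight is bounded below on each compact set. -/
lemma locallyL2_of_weight {w f : G → ℝ} (hw : Continuous w) (hw0 : ∀ x, 0 < w x)
    (hf : Measurable f) (hi : Integrable (fun x => w x * f x ^ 2) ρ) : LocallyL2 ρ f := by
  refine ⟨hf, fun K hK => ?_⟩
  rw [memLp_two_iff_integrable_sq hf.aestronglyMeasurable]
  have hwi : Continuous fun x => (w x)⁻¹ := hw.inv₀ fun x => (hw0 x).ne'
  obtain ⟨B, hB⟩ := hK.exists_bound_of_continuousOn hwi.continuousOn
  have h1 : Integrable (fun x => (w x)⁻¹ * (w x * f x ^ 2)) (ρ.restrict K) :=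
    (hi.mono_measure Measure.restrict_le_self).bdd_mul (c := B) hwi.aestronglyMeasurable
      ((ae_restrict_iff' hK.measurableSet).2 (Eventually.of_forall hB))
  refine h1.congr (Eventually.of_forall fun x => ?_)
  have := (hw0 x).ne'
  field_simp

/-- The weighted Poincaré inequality, from the Lyapunov condition off a compact set and the local
Poincaré inequality. -/
theorem IsFlowPotential.poincare [LocallyCompactSpace G]
    (H : IsFlowPotential γ χ c v v' v'') (hη : IsCutoffSequence γ η η' δ)
    (hint : Integrable (fun x => χ x * Real.exp (-v x)) ρ) {a κ : ℝ} (ha : a < 1) (hκ : 0 < κ)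
    {K₀ : Set G} (hK₀ : IsCompact K₀)
    (h₀ : ∀ x, x ∉ K₀ → κ ≤ a * ∑ j, v' j x ^ 2 - ∑ j, (v'' j x + c j * v' j x)) :
    ∃ C : ℝ, 0 ≤ C ∧ ∀ (f : G → ℝ) (g : ι → G → ℝ), Measurable f → (∀ j, Measurable (g j)) →
      (∀ j, HasWeakFlowDeriv ρ (γ j) f (g j)) →
      Integrable (fun x => χ x * Real.exp (-v x) * f x ^ 2) ρ →
      (∀ j, Integrable (fun x => χ x * Real.exp (-v x) * g j x ^ 2) ρ) →
      ∃ m : ℝ, ∫ x, χ x * Real.exp (-v x) * (f x - m) ^ 2 ∂ρ ≤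
        C * ∫ x, χ x * Real.exp (-v x) * ∑ j, g j x ^ 2 ∂ρ := by
  -- The exceptional set is enlarged to have nonempty interior, as the local Poincaré inequality
  -- demands.
  obtain ⟨K₁, hK₁, hK₁n⟩ := exists_compact_mem_nhds (1 : G)
  set K := K₀ ∪ K₁ with hKdef
  have hK : IsCompact K := hK₀.union hK₁
  have hKi : (interior K).Nonempty :=
    ⟨1, interior_mono subset_union_right (mem_interior_iff_mem_nhds.2 hK₁n)⟩
  have h : ∀ x, x ∉ K → κ ≤ a * ∑ j, v' j x ^ 2 - ∑ j, (v'' j x + c j * v' j x) :=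
    fun x hx => h₀ x fun h' => hx (Or.inl h')
  obtain ⟨D, K', hK', hD⟩ := exists_localPoincare (ρ := ρ) H.oneParam H.generates hK hKi
  set w : G → ℝ := fun x => χ x * Real.exp (-v x) with hw
  have hwc : Continuous w := H.continuous_χ.mul (Real.continuous_exp.comp H.continuous.neg)
  have hw0 : ∀ x, 0 < w x := fun x => mul_pos (H.pos x) (Real.exp_pos _)
  have hwd : ∀ j, HasFlowDeriv (γ j) w fun x => w x * (c j - v' j x) := fun j => by
    have h1 := HasFlowDeriv.mul (H.oneParam j) (H.deriv_χ j)
      (HasFlowDeriv.comp (H.oneParam j) (F := fun y => Real.exp (-y)) (F' := fun y => -Real.exp (-y))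
        (fun x => by simpa using (hasDerivAt_neg (v x)).exp) (H.deriv j))
    refine h1.congr_deriv fun x => ?_
    simp only [hw]
    ring
  obtain ⟨b, hb⟩ := hK.exists_bound_of_continuousOn (f := fun x =>
      ∑ j, (v'' j x + c j * v' j x) - a * ∑ j, v' j x ^ 2 + κ)
    (Continuous.continuousOn (by
      have h1 : ∀ j, Continuous (v' j) := H.continuous_deriv
      have h2 : ∀ j, Continuous (v'' j) := H.continuous_deriv₂
      fun_prop))
  obtain ⟨Wm, hWm⟩ := hK.exists_bound_of_continuousOn hwc.continuousOn
  obtain ⟨Vm, hVm⟩ := hK'.exists_bound_of_continuousOn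
    (hwc.inv₀ fun x => (hw0 x).ne').continuousOn
  have ha' : 0 < 1 - a := by linarith
  -- The first summand comes from Young's inequality and from splitting `|∇(η F)|²`. In the second,
  -- `|b|` bounds the failure of the lower bound on `K`, `D` is the local Poincaré constant, and
  -- `|Wm|`, `|Vm|` exchange weighted and unweighted integrals on `K` and `K'`.
  refine ⟨κ⁻¹ * (2 / (1 - a) + |b| * |Wm| * D * |Vm|), by positivity,
    fun f g hf hg hfg hfi hgi => ?_⟩
  obtain ⟨m, hm⟩ := hD f g hf hg hfg
  refine ⟨m, ?_⟩
  set F : G → ℝ := fun x => f x - m with hF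
  have hFm : Measurable F := hf.sub measurable_const
  have hFi : Integrable (fun x => w x * F x ^ 2) ρ := by
    have h1 : Integrable (fun x => 2 * (w x * f x ^ 2) + 2 * m ^ 2 * w x) ρ :=
      (hfi.const_mul 2).add (hint.const_mul _)
    refine h1.mono' (hwc.measurable.mul (hFm.pow_const 2)).aestronglyMeasurable
      (Eventually.of_forall fun x => ?_)
    rw [Real.norm_of_nonneg (mul_nonneg (hw0 x).le (sq_nonneg _))]
    have : F x ^ 2 ≤ 2 * f x ^ 2 + 2 * m ^ 2 := by
      simp only [hF]
      nlinarith [sq_nonneg (f x + m)]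
    have := mul_le_mul_of_nonneg_left this (hw0 x).le
    linarith
  have hFL : LocallyL2 ρ F := locallyL2_of_weight hwc hw0 hFm hFi
  have hgL : ∀ j, LocallyL2 ρ (g j) := fun j => locallyL2_of_weight hwc hw0 (hg j) (hgi j)
  have hFg : ∀ j, HasWeakFlowDeriv ρ (γ j) F (g j) := fun j => (hfg j).sub_const m
  have hgsi : Integrable (fun x => w x * ∑ j, g j x ^ 2) ρ := by
    simp only [Finset.mul_sum]
    exact integrable_finsetSum _ fun j _ => hgi j
  set Γ := ∫ x, w x * ∑ j, g j x ^ 2 ∂ρ with hΓ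
  have hΓ0 : 0 ≤ Γ := integral_nonneg fun x =>
    mul_nonneg (hw0 x).le (Finset.sum_nonneg fun j _ => sq_nonneg _)
  -- the local term
  have hFK : IntegrableOn (fun x => F x ^ 2) K ρ := (hFL.2 K hK).integrable_sq
  have hloc : ∫ x in K, F x ^ 2 ∂ρ ≤ D * (|Vm| * Γ) := by
    have h1 : ∀ j, IntegrableOn (fun x => g j x ^ 2) K' ρ := fun j =>
      ((hgL j).2 K' hK').integrable_sq
    have h2 : ∑ j, ∫ x in K', g j x ^ 2 ∂ρ ≤ |Vm| * Γ := by
      rw [← integral_finsetSum _ fun j _ => h1 j, hΓ, ← integral_const_mul]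
      calc _ ≤ ∫ x in K', |Vm| * (w x * ∑ j, g j x ^ 2) ∂ρ := by
            refine setIntegral_mono_on (integrable_finsetSum _ fun j _ => h1 j)
              (hgsi.const_mul _).integrableOn hK'.measurableSet fun x hx => ?_
            have h3 : 1 ≤ |Vm| * w x := by
              have : (w x)⁻¹ ≤ |Vm| := (le_abs_self _).trans ((hVm x hx).trans (le_abs_self _))
              rwa [inv_le_iff_one_le_mul₀ (hw0 x)] at this
            have h4 : 0 ≤ ∑ j, g j x ^ 2 := Finset.sum_nonneg fun j _ => sq_nonneg _
            calc _ ≤ (|Vm| * w x) * ∑ j, g j x ^ 2 := le_mul_of_one_le_left h4 h3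
              _ = _ := mul_assoc _ _ _
        _ ≤ _ := setIntegral_le_integral (hgsi.const_mul _) (Eventually.of_forall fun x =>
            mul_nonneg (abs_nonneg _) (mul_nonneg (hw0 x).le
              (Finset.sum_nonneg fun j _ => sq_nonneg _)))
    refine le_trans ?_ (mul_le_mul_of_nonneg_left h2 D.coe_nonneg)
    have h3 : ∀ j ∈ Finset.univ, 0 ≤ ∫ x in K', g j x ^ 2 ∂ρ := fun j _ =>
      integral_nonneg fun x => sq_nonneg _
    refine (ENNReal.ofReal_le_ofReal_iff (mul_nonneg D.coe_nonneg (Finset.sum_nonneg h3))).1 ?_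
    rw [ofReal_setIntegral_sq (hFL.2 K hK), ENNReal.ofReal_mul D.coe_nonneg,
      ENNReal.ofReal_sum_of_nonneg h3]
    simp only [fun j => ofReal_setIntegral_sq ((hgL j).2 K' hK')]
    simpa using hm
  have hlocw : ∫ x in K, w x * F x ^ 2 ∂ρ ≤ |Wm| * (D * (|Vm| * Γ)) := by
    refine le_trans ?_ (mul_le_mul_of_nonneg_left hloc (abs_nonneg _))
    rw [← integral_const_mul]
    refine setIntegral_mono_on hFi.integrableOn (hFK.const_mul _) hK.measurableSet fun x hx => ?_
    exact mul_le_mul_of_nonneg_right ((le_abs_self _).trans ((hWm x hx).trans (le_abs_self _)))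
      (sq_nonneg _)
  set Φ := ∫ x, w x * F x ^ 2 ∂ρ with hΦ
  -- These are the components of `w ∇v`. Summing the derivatives `P'` over `j` gives the divergence
  -- `w (L v - |∇v|²)`, the source of the full term `|∇v|²`.
  let P : ι → G → ℝ := fun j x => w x * v' j x
  let P' : ι → G → ℝ := fun j x => w x * (c j - v' j x) * v' j x + w x * v'' j x
  have hPc : ∀ j, Continuous (P j) := fun j => hwc.mul (H.continuous_deriv j)
  have hP'c : ∀ j, Continuous (P' j) := fun j =>
    ((hwc.mul (continuous_const.sub (H.continuous_deriv j))).mul (H.continuous_deriv j)).add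
      (hwc.mul (H.continuous_deriv₂ j))
  have hPd : ∀ j, HasFlowDeriv (γ j) (P j) (P' j) := fun j =>
    HasFlowDeriv.mul (H.oneParam j) (hwd j) (H.deriv₂ j)
  have main : ∀ n, κ * ∫ x, η n x ^ 2 * (w x * F x ^ 2) ∂ρ ≤
      2 / (1 - a) * (Fintype.card ι * δ n ^ 2 * Φ + Γ) + |b| * (|Wm| * (D * (|Vm| * Γ))) := by
    intro n
    obtain ⟨L, hL, hL0⟩ := hη.compact n
    have ibp := fun j => integral_cutoff_byParts (H.oneParam j) hFL (hgL j) (hFg j) hL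
      (hη.measurable n) hL0
      (hη.nonneg n) (hη.le_one n) (hη.deriv n j) (hη.deriv_le n j) (hPc j) (hP'c j) (hPd j)
    have hsumi := integrable_finsetSum Finset.univ fun j _ => (ibp j).1
    have hsum0 := integral_finsetSum Finset.univ fun j _ => (ibp j).1
    rw [Finset.sum_eq_zero fun j _ => (ibp j).2] at hsum0
    have hpt : ∀ x, κ * (η n x ^ 2 * (w x * F x ^ 2)) ≤
        -(∑ j, (F x ^ 2 * (2 * η n x * η' n j x * P j x + η n x ^ 2 * P' j x) +
          2 * (F x * g j x * (η n x ^ 2 * P j x)))) +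
        (2 / (1 - a) * (Fintype.card ι * δ n ^ 2 * (w x * F x ^ 2) + w x * ∑ j, g j x ^ 2) +
        |b| * K.indicator (fun x => w x * F x ^ 2) x) := by
      intro x
      have hwx := hw0 x
      set S := ∑ j, v' j x ^ 2 with hS
      set Lv := ∑ j, (v'' j x + c j * v' j x) with hLv
      -- Here `T` is `∇(η F) · ∇v` and `N` is `|∇(η F)|²`.
      set T := ∑ j, (F x * η' n j x + η n x * g j x) * v' j x with hT
      set N := ∑ j, (F x * η' n j x + η n x * g j x) ^ 2 with hN
      set g2 := ∑ j, g j x ^ 2 with hg2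
      have e1 : ∑ j, (F x ^ 2 * (2 * η n x * η' n j x * P j x + η n x ^ 2 * P' j x) +
          2 * (F x * g j x * (η n x ^ 2 * P j x))) =
          w x * (2 * (F x * η n x) * T + (F x * η n x) ^ 2 * (Lv - S)) := by
        rw [hT, hLv, hS, ← Finset.sum_sub_distrib, Finset.mul_sum, Finset.mul_sum,
          ← Finset.sum_add_distrib, Finset.mul_sum]
        refine Finset.sum_congr rfl fun j _ => ?_
        simp only [P, P']
        ring
      rw [e1]
      have hη1 : η n x ^ 2 ≤ 1 := pow_le_one₀ (hη.nonneg n x) (hη.le_one n x)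
      have hN1 : N ≤ 2 * (Fintype.card ι * δ n ^ 2 * F x ^ 2 + g2) := by
        have : N ≤ ∑ j, 2 * (δ n ^ 2 * F x ^ 2 + g j x ^ 2) := by
          refine Finset.sum_le_sum fun j _ => ?_
          have h1 : η' n j x ^ 2 ≤ δ n ^ 2 := by
            rw [← sq_abs]
            exact pow_le_pow_left₀ (abs_nonneg _) (hη.deriv_le n j x) 2
          have h2 := mul_le_mul_of_nonneg_right h1 (sq_nonneg (F x))
          have h3 := mul_le_mul_of_nonneg_right hη1 (sq_nonneg (g j x))
          nlinarith [sq_nonneg (F x * η' n j x - η n x * g j x)]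
        refine this.trans (le_of_eq ?_)
        rw [← Finset.mul_sum, Finset.sum_add_distrib]
        simp
        ring
      have hyoung : 2 * (F x * η n x) * T ≤ (1 - a) * ((F x * η n x) ^ 2 * S) + N / (1 - a) := by
        rw [hT, hN, hS, Finset.mul_sum, Finset.mul_sum, Finset.mul_sum, Finset.sum_div,
          ← Finset.sum_add_distrib]
        refine Finset.sum_le_sum fun j _ => ?_
        set z := F x * η' n j x + η n x * g j x
        have h1 : 0 ≤ ((1 - a) * (F x * η n x * v' j x) - z) ^ 2 / (1 - a) := by positivity
        have h2 : ((1 - a) * (F x * η n x * v' j x) - z) ^ 2 / (1 - a) =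
            (1 - a) * ((F x * η n x) ^ 2 * v' j x ^ 2) + z ^ 2 / (1 - a) -
              2 * (F x * η n x) * (z * v' j x) := by
          field_simp
          ring
        linarith
      have hN2 : N / (1 - a) ≤ 2 / (1 - a) * (Fintype.card ι * δ n ^ 2 * F x ^ 2 + g2) := by
        rw [div_mul_eq_mul_div]
        exact div_le_div_of_nonneg_right hN1 ha'.le
      have hF2 : 0 ≤ (F x * η n x) ^ 2 := sq_nonneg _
      have hF3 : (F x * η n x) ^ 2 ≤ F x ^ 2 := by
        rw [mul_pow]
        exact mul_le_of_le_one_right (sq_nonneg _) hη1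
      -- Off `K` the left side is nonpositive by hypothesis; on `K` the defect is at most `|b|`.
      have hmain : (F x * η n x) ^ 2 * (κ - (a * S - Lv)) ≤
          |b| * K.indicator (fun x => F x ^ 2) x := by
        by_cases hxK : x ∈ K
        · rw [indicator_of_mem hxK]
          have h1 : κ - (a * S - Lv) ≤ |b| := by
            have := (le_abs_self _).trans ((hb x hxK).trans (le_abs_self _))
            linarith
          calc _ ≤ (F x * η n x) ^ 2 * |b| := mul_le_mul_of_nonneg_left h1 hF2
            _ ≤ F x ^ 2 * |b| := mul_le_mul_of_nonneg_right hF3 (abs_nonneg _)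
            _ = _ := mul_comm _ _
        · rw [indicator_of_notMem hxK, mul_zero]
          exact mul_nonpos_of_nonneg_of_nonpos hF2 (by linarith [h x hxK])
      have hind : K.indicator (fun x => w x * F x ^ 2) x =
          w x * K.indicator (fun x => F x ^ 2) x := by
        by_cases hxK : x ∈ K <;> simp [hxK]
      rw [hind]
      have g5 : κ * (F x * η n x) ^ 2 ≤
          -(2 * (F x * η n x) * T + (F x * η n x) ^ 2 * (Lv - S)) +
          (2 / (1 - a) * (Fintype.card ι * δ n ^ 2 * F x ^ 2 + g2) +
          |b| * K.indicator (fun x => F x ^ 2) x) := by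
        linarith
      have := mul_le_mul_of_nonneg_left g5 hwx.le
      linarith
    have hKind : Integrable (K.indicator fun x => w x * F x ^ 2) ρ :=
      hFi.indicator hK.measurableSet
    have hI1 : Integrable (fun x => 2 / (1 - a) * (Fintype.card ι * δ n ^ 2 * (w x * F x ^ 2) +
        w x * ∑ j, g j x ^ 2)) ρ := ((hFi.const_mul _).add hgsi).const_mul _
    have hI2 : Integrable (fun x => 2 / (1 - a) * (Fintype.card ι * δ n ^ 2 * (w x * F x ^ 2) +
        w x * ∑ j, g j x ^ 2) + |b| * K.indicator (fun x => w x * F x ^ 2) x) ρ :=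
      hI1.add (hKind.const_mul _)
    rw [← integral_const_mul]
    calc _ ≤ ∫ x, (-(∑ j, (F x ^ 2 * (2 * η n x * η' n j x * P j x + η n x ^ 2 * P' j x) +
          2 * (F x * g j x * (η n x ^ 2 * P j x)))) +
          (2 / (1 - a) * (Fintype.card ι * δ n ^ 2 * (w x * F x ^ 2) + w x * ∑ j, g j x ^ 2) +
          |b| * K.indicator (fun x => w x * F x ^ 2) x)) ∂ρ := by
          refine integral_mono_of_nonneg (Eventually.of_forall fun x => ?_) (hsumi.neg.add hI2)
            (Eventually.of_forall hpt)
          exact mul_nonneg hκ.le (mul_nonneg (sq_nonneg _)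
            (mul_nonneg (hw0 x).le (sq_nonneg _)))
      _ = 2 / (1 - a) * (Fintype.card ι * δ n ^ 2 * Φ + Γ) +
          |b| * ∫ x in K, w x * F x ^ 2 ∂ρ := by
          rw [integral_neg_add_eq hsumi hsum0 hI2, integral_add hI1 (hKind.const_mul _),
            integral_const_mul, integral_const_mul, integral_add (hFi.const_mul _) hgsi,
            integral_const_mul, integral_indicator hK.measurableSet]
      _ ≤ _ := by gcongr
  have hlim : Tendsto (fun n => ∫ x, η n x ^ 2 * (w x * F x ^ 2) ∂ρ) atTop (𝓝 Φ) := by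
    have hnn : ∀ x, 0 ≤ w x * F x ^ 2 := fun x => mul_nonneg (hw0 x).le (sq_nonneg _)
    refine tendsto_integral_of_dominated_convergence (fun x => w x * F x ^ 2)
      (fun n => (((hη.measurable n).pow_const 2).mul
        (hwc.measurable.mul (hFm.pow_const 2))).aestronglyMeasurable) hFi
      (fun n => Eventually.of_forall fun x => ?_) (Eventually.of_forall fun x => ?_)
    · rw [Real.norm_of_nonneg (mul_nonneg (sq_nonneg _) (hnn x))]
      exact mul_le_of_le_one_left (hnn x) (pow_le_one₀ (hη.nonneg n x) (hη.le_one n x))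
    · refine tendsto_const_nhds.congr' ?_
      filter_upwards [hη.eventually_eq x] with n hn
      rw [hn, one_pow, one_mul]
  have hlim2 : Tendsto (fun n => 2 / (1 - a) * (Fintype.card ι * δ n ^ 2 * Φ + Γ) +
      |b| * (|Wm| * (D * (|Vm| * Γ)))) atTop
      (𝓝 (2 / (1 - a) * (Fintype.card ι * 0 ^ 2 * Φ + Γ) + |b| * (|Wm| * (D * (|Vm| * Γ))))) :=
    (((((hη.tendsto.pow 2).const_mul _).mul_const Φ).add_const Γ).const_mul _).add_const _
  have hfin := le_of_tendsto_of_tendsto' (hlim.const_mul κ) hlim2 main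
  rw [mul_assoc, ← div_eq_inv_mul, le_div_iff₀ hκ]
  linarith

end Weighted

/-! ### One-parameter subgroups and left-invariant derivatives -/

section OneParam

variable {E : Type*} [NormedAddCommGroup E] [NormedSpace ℝ E] [CompleteSpace E]
  {G : Type*} [TopologicalSpace G] [ChartedSpace E G] [Group G] [LieGroup 𝓘(ℝ, E) ∞ G]

lemma lieGroup_minSmoothness_three (E G : Type*) [NormedAddCommGroup E] [NormedSpace ℝ E]
    [TopologicalSpace G] [ChartedSpace E G] [Group G] [LieGroup 𝓘(ℝ, E) ∞ G] :
    LieGroup 𝓘(ℝ, E) (minSmoothness ℝ 3) G := by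
  rw [minSmoothness_of_isRCLikeNormedField]
  exact LieGroup.of_le (n := ∞) ENat.LEInfty.out

lemma mdifferentiableAt_mul_left (x y : G) :
    MDifferentiableAt 𝓘(ℝ, E) 𝓘(ℝ, E) (fun z => x * z) y :=
  (contMDiff_mul_left (I := 𝓘(ℝ, E)) (n := ∞)).contMDiffAt.mdifferentiableAt (by simp)

/-- The chain rule at the identity for `(x * g) * z = x * (g * z)`. -/
lemma mfderiv_mul_left_mulInvariantVectorField (Y : GroupLieAlgebra 𝓘(ℝ, E) G) (x g : G) :
    mfderiv 𝓘(ℝ, E) 𝓘(ℝ, E) (fun z => x * z) g (mulInvariantVectorField Y g) =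
      mulInvariantVectorField Y (x * g) := by
  have e : (fun z : G => x * g * z) = (fun z => x * z) ∘ fun z => g * z := by
    ext z
    simp [mul_assoc]
  have h3 : (mfderiv 𝓘(ℝ, E) 𝓘(ℝ, E) (fun z : G => x * g * z) 1 : E →L[ℝ] E) =
      (mfderiv 𝓘(ℝ, E) 𝓘(ℝ, E) (fun z : G => x * z) (g * 1) : E →L[ℝ] E).comp
        (mfderiv 𝓘(ℝ, E) 𝓘(ℝ, E) (fun z : G => g * z) 1 : E →L[ℝ] E) := by
    rw [e]
    exact mfderiv_comp (1 : G) (mdifferentiableAt_mul_left (E := E) x (g * 1))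
      (mdifferentiableAt_mul_left (E := E) g 1)
  have e' : (mfderiv 𝓘(ℝ, E) 𝓘(ℝ, E) (fun z : G => x * z) (g * 1) : E →L[ℝ] E) =
      (mfderiv 𝓘(ℝ, E) 𝓘(ℝ, E) (fun z : G => x * z) g : E →L[ℝ] E) := by
    rw [mul_one g]
  rw [e'] at h3
  exact (DFunLike.congr_fun h3 Y).symm

lemma isMIntegralCurveOn_mul_left {Y : GroupLieAlgebra 𝓘(ℝ, E) G} {γ : ℝ → G} {s : Set ℝ}
    (h : IsMIntegralCurveOn (I := 𝓘(ℝ, E)) γ (mulInvariantVectorField Y) s) (x : G) :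
    IsMIntegralCurveOn (I := 𝓘(ℝ, E)) (fun t => x * γ t) (mulInvariantVectorField Y) s := by
  intro t ht
  have h1 := (mdifferentiableAt_mul_left (E := E) x (γ t)).hasMFDerivAt
  have h2 := h1.comp_hasMFDerivWithinAt t (h t ht)
  refine h2.congr_mfderiv ?_
  refine ContinuousLinearMap.ext_ring ?_
  have h3 : (mfderiv 𝓘(ℝ, E) 𝓘(ℝ, E) (fun z => x * z) (γ t) : E →L[ℝ] E)
      ((1 : ℝ) • (mulInvariantVectorField Y (γ t) : E)) =
      (1 : ℝ) • (mulInvariantVectorField Y (x * γ t) : E) := by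
    rw [one_smul, one_smul]
    exact mfderiv_mul_left_mulInvariantVectorField Y x (γ t)
  exact h3

lemma contMDiff_one_mulInvariantVectorField (Y : GroupLieAlgebra 𝓘(ℝ, E) G) :
    ContMDiff 𝓘(ℝ, E) 𝓘(ℝ, E).tangent 1
      (fun g : G => (⟨g, mulInvariantVectorField Y g⟩ : TangentBundle 𝓘(ℝ, E) G)) := by
  have := lieGroup_minSmoothness_three E G
  refine (contMDiff_mulInvariantVectorField Y).of_le ?_
  rw [minSmoothness_of_isRCLikeNormedField]
  exact one_le_two

/-- Every element of the Lie algebra generates a one-parameter subgroup. -/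
theorem exists_isOneParam [T2Space G] (Y : GroupLieAlgebra 𝓘(ℝ, E) G) :
    ∃ γ : ℝ → G, IsOneParam γ ∧
      IsMIntegralCurve (I := 𝓘(ℝ, E)) γ (mulInvariantVectorField Y) := by
  have hv := contMDiff_one_mulInvariantVectorField Y
  obtain ⟨γ₀, h0, hγ₀⟩ := exists_isMIntegralCurveAt_of_contMDiffAt_boundaryless (t₀ := 0)
    (hv.contMDiffAt (x := (1 : G)))
  obtain ⟨ε, hε, hγε⟩ := isMIntegralCurveAt_iff'.1 hγ₀
  rw [Real.ball_eq_Ioo, zero_sub, zero_add] at hγε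
  -- Left translates of one local curve through `1` give integral curves through all points with the
  -- same lifetime `ε`, so the field is complete.
  obtain ⟨γ, hγ0, hγ⟩ := exists_isMIntegralCurve_of_isMIntegralCurveOn hv hε
    (fun x => ⟨fun t => x * γ₀ t, by simp [h0], isMIntegralCurveOn_mul_left hγε x⟩) (1 : G)
  refine ⟨γ, ⟨hγ.continuous, fun s t => ?_⟩, hγ⟩
  have h1 : IsMIntegralCurve (I := 𝓘(ℝ, E)) (γ ∘ (· + s)) (mulInvariantVectorField Y) :=
    hγ.comp_add s
  have h2 : IsMIntegralCurve (I := 𝓘(ℝ, E)) (fun t => γ s * γ t) (mulInvariantVectorField Y) := by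
    rw [isMIntegralCurve_iff_isMIntegralCurveOn] at hγ ⊢
    exact isMIntegralCurveOn_mul_left hγ (γ s)
  -- The curves `t ↦ γ (t + s)` and `t ↦ γ s * γ t` both start at `γ s`; uniqueness gives the
  -- homomorphism property.
  have h3 := isMIntegralCurve_Ioo_eq_of_contMDiff_boundaryless hv h1 h2 (t₀ := 0) (by simp [hγ0])
  have h4 := congrFun h3 t
  simpa [add_comm] using h4

lemma hasDerivAt_of_comp_smulRight {F F' : Type*} [NormedAddCommGroup F] [NormedSpace ℝ F]
    [NormedAddCommGroup F'] [NormedSpace ℝ F'] {A : F →L[ℝ] F'} {w : F} {f : ℝ → F'} {t : ℝ}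
    (h : HasFDerivAt f (A.comp ((1 : ℝ →L[ℝ] ℝ).smulRight w)) t) : HasDerivAt f (A w) t := by
  simpa using h.hasDerivAt

lemma hasDerivAt_comp_mul_flow {F : Type*} [NormedAddCommGroup F] [NormedSpace ℝ F]
    {Y : GroupLieAlgebra 𝓘(ℝ, E) G} {γ : ℝ → G} (hγ : IsOneParam γ)
    (h : IsMIntegralCurve (I := 𝓘(ℝ, E)) γ (mulInvariantVectorField Y)) {u : G → F} {x : G}
    (hu : MDifferentiableAt 𝓘(ℝ, E) 𝓘(ℝ, F) u x) :
    HasDerivAt (fun t => u (x * γ t))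
      (mfderiv 𝓘(ℝ, E) 𝓘(ℝ, F) u x (mulInvariantVectorField Y x)) 0 := by
  have h1 := hasMFDerivWithinAt_univ.1
    ((isMIntegralCurveOn_mul_left (h.isMIntegralCurveOn univ) x) 0 (mem_univ _))
  have e : x * γ 0 = x := by rw [hγ.map_zero, mul_one]
  have hu' : MDifferentiableAt 𝓘(ℝ, E) 𝓘(ℝ, F) u (x * γ 0) := by rwa [e]
  have h2 := (hu'.hasMFDerivAt).comp (0 : ℝ) h1
  have h3 : HasDerivAt (fun t => u (x * γ t))
      (mfderiv 𝓘(ℝ, E) 𝓘(ℝ, F) u (x * γ 0) (mulInvariantVectorField Y (x * γ 0))) 0 :=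
    hasDerivAt_of_comp_smulRight (F := E) (F' := F) (f := fun t => u (x * γ t))
      (A := mfderiv 𝓘(ℝ, E) 𝓘(ℝ, F) u (x * γ 0))
      (w := mulInvariantVectorField Y (x * γ 0)) h2.hasFDerivAt
  rwa [e] at h3

/-- The derivative along the one-parameter subgroup of `Y` is the Lie derivative along `Y`. -/
lemma hasDerivAt_flow {Y : GroupLieAlgebra 𝓘(ℝ, E) G} {γ : ℝ → G} (hγ : IsOneParam γ)
    (h : IsMIntegralCurve (I := 𝓘(ℝ, E)) γ (mulInvariantVectorField Y)) {u : G → ℝ} {x : G}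
    (hu : MDifferentiableAt 𝓘(ℝ, E) 𝓘(ℝ, ℝ) u x) :
    HasDerivAt (fun t => u (x * γ t)) (lieDeriv Y u x) 0 :=
  hasDerivAt_comp_mul_flow hγ h hu

lemma hasFlowDeriv_lieDeriv {Y : GroupLieAlgebra 𝓘(ℝ, E) G} {γ : ℝ → G} (hγ : IsOneParam γ)
    (h : IsMIntegralCurve (I := 𝓘(ℝ, E)) γ (mulInvariantVectorField Y)) {u : G → ℝ}
    (hu : MDifferentiable 𝓘(ℝ, E) 𝓘(ℝ, ℝ) u) : HasFlowDeriv γ u (lieDeriv Y u) :=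
  fun x => hasDerivAt_flow hγ h (hu x)

/-- The Lie derivative of a `C²` function is `C¹`; more generally one derivative is lost. -/
lemma contMDiff_lieDeriv (Y : GroupLieAlgebra 𝓘(ℝ, E) G) {u : G → ℝ} {m n : WithTop ℕ∞}
    (hu : ContMDiff 𝓘(ℝ, E) 𝓘(ℝ, ℝ) n u) (hmn : m + 1 ≤ n) (hm : m ≤ 1) :
    ContMDiff 𝓘(ℝ, E) 𝓘(ℝ, ℝ) m (lieDeriv Y u) := by
  have h1 : ContMDiff 𝓘(ℝ, E).tangent 𝓘(ℝ, ℝ).tangent m (tangentMap 𝓘(ℝ, E) 𝓘(ℝ, ℝ) u) :=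
    hu.contMDiff_tangentMap hmn
  have h2 := h1.comp ((contMDiff_one_mulInvariantVectorField Y).of_le hm)
  exact (contMDiff_snd_tangentBundle_modelSpace ℝ 𝓘(ℝ, ℝ)).comp h2

lemma continuous_lieDeriv (Y : GroupLieAlgebra 𝓘(ℝ, E) G) {u : G → ℝ}
    (hu : ContMDiff 𝓘(ℝ, E) 𝓘(ℝ, ℝ) 1 u) : Continuous (lieDeriv Y u) :=
  (contMDiff_lieDeriv Y (m := 0) hu (by simp) zero_le_one).continuous

end OneParam

/-! ### The adjoint action and the bracket for a local group law -/

section LocalGroup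

variable {E : Type*} [NormedAddCommGroup E] [NormedSpace ℝ E] [CompleteSpace E]

/-- For a local group law `m` with unit `p`, the velocity of `y ↦ m (x, y)` at `p`. -/
noncomputable def leftVelocity (m : E × E → E) (p x : E) : E →L[ℝ] E :=
  (fderiv ℝ m (x, p)).comp (ContinuousLinearMap.inr ℝ E E)

/-- For a local group law `m` with unit `p`, the velocity of `y ↦ m (y, x)` at `p`. -/
noncomputable def rightVelocity (m : E × E → E) (p x : E) : E →L[ℝ] E :=
  (fderiv ℝ m (p, x)).comp (ContinuousLinearMap.inl ℝ E E)

lemma leftVelocity_self {m : E × E → E} {p : E} (hm : DifferentiableAt ℝ m (p, p))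
    (h : ∀ᶠ x in 𝓝 p, m (p, x) = x) : leftVelocity m p p = 1 := by
  have h1 : HasFDerivAt (fun y => m (p, y)) (leftVelocity m p p) p :=
    hm.hasFDerivAt.comp p (hasFDerivAt_prodMk_right p p)
  exact h1.unique ((hasFDerivAt_id p).congr_of_eventuallyEq h)

lemma rightVelocity_self {m : E × E → E} {p : E} (hm : DifferentiableAt ℝ m (p, p))
    (h : ∀ᶠ x in 𝓝 p, m (x, p) = x) : rightVelocity m p p = 1 := by
  have h1 : HasFDerivAt (fun y => m (y, p)) (rightVelocity m p p) p :=
    hm.hasFDerivAt.comp (f := fun e => (e, p)) p (hasFDerivAt_prodMk_left p p)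
  exact h1.unique ((hasFDerivAt_id p).congr_of_eventuallyEq h)

lemma ContDiffAt.hasFDerivAt_fderiv {F : Type*} [NormedAddCommGroup F] [NormedSpace ℝ F]
    {m : F → E} {p : F} (hm : ContDiffAt ℝ 2 m p) :
    HasFDerivAt (fderiv ℝ m) (fderiv ℝ (fderiv ℝ m) p) p :=
  ((hm.fderiv_right (m := 1) (by norm_num)).differentiableAt (by simp)).hasFDerivAt

lemma hasFDerivAt_leftVelocity_apply {m : E × E → E} {p : E} (hm : ContDiffAt ℝ 2 m (p, p))
    (Y : E) : HasFDerivAt (fun x => leftVelocity m p x Y)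
      ((((fderiv ℝ (fderiv ℝ m) (p, p)).comp (ContinuousLinearMap.inl ℝ E E)).flip (0, Y))) p := by
  have h1 : HasFDerivAt (fun x => fderiv ℝ m (x, p))
      ((fderiv ℝ (fderiv ℝ m) (p, p)).comp (ContinuousLinearMap.inl ℝ E E)) p :=
    (ContDiffAt.hasFDerivAt_fderiv hm).comp (f := fun e => (e, p)) p
      (hasFDerivAt_prodMk_left p p)
  have h2 := h1.clm_apply (hasFDerivAt_const ((0 : E), Y) p)
  refine (h2.congr_fderiv ?_).congr_of_eventuallyEq (Eventually.of_forall fun x => ?_)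
  · ext x
    simp
  · simp [leftVelocity]

/-- The Lie bracket of two left-invariant fields of a local group law, as the derivative of the
adjoint action. -/
lemma hasDerivAt_adjoint {m : E × E → E} {p : E} (hm : ContDiffAt ℝ 2 m (p, p))
    (h1 : ∀ᶠ x in 𝓝 p, m (p, x) = x) (h2 : ∀ᶠ x in 𝓝 p, m (x, p) = x) {c w : ℝ → E} {X Y : E}
    (hc0 : c 0 = p) (hc : HasDerivAt c X 0)
    (hw : ∀ᶠ t in 𝓝 (0 : ℝ), rightVelocity m p (c t) (w t) = leftVelocity m p (c t) Y) :
    HasDerivAt w (VectorField.lieBracket ℝ (fun x => leftVelocity m p x X)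
      (fun x => leftVelocity m p x Y) p) 0 := by
  have hmd : DifferentiableAt ℝ m (p, p) := hm.differentiableAt (by simp)
  have hl := leftVelocity_self hmd h1
  have hr := rightVelocity_self hmd h2
  set D2 := fderiv ℝ (fderiv ℝ m) (p, p) with hD2
  have hsymm : ∀ a b, D2 a b = D2 b a := fun a b =>
    (hm.isSymmSndFDerivAt (by simp)).eq a b
  have hB : HasDerivAt (fun t => leftVelocity m p (c t) Y) (D2 (X, 0) (0, Y)) 0 := by
    have := (hasFDerivAt_leftVelocity_apply hm Y).comp_hasDerivAt_of_eq (0 : ℝ) hc hc0.symm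
    refine this.congr_deriv ?_
    simp [hD2]
  have hA : HasDerivAt (fun t => rightVelocity m p (c t))
      ((D2 (0, X)).comp (ContinuousLinearMap.inl ℝ E E)) 0 := by
    have h3 : HasFDerivAt (fun x => fderiv ℝ m (p, x))
        (D2.comp (ContinuousLinearMap.inr ℝ E E)) p :=
      (ContDiffAt.hasFDerivAt_fderiv hm).comp p (hasFDerivAt_prodMk_right p p)
    have h4 := h3.comp_hasDerivAt_of_eq (0 : ℝ) hc hc0.symm
    have h5 := h4.clm_comp (hasDerivAt_const (0 : ℝ) (ContinuousLinearMap.inl ℝ E E))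
    refine h5.congr_deriv ?_
    ext x
    simp
  have hinv : HasDerivAt (fun t => Ring.inverse (rightVelocity m p (c t)))
      (-((D2 (0, X)).comp (ContinuousLinearMap.inl ℝ E E))) 0 := by
    have h6 := hasFDerivAt_ringInverse (𝕜 := ℝ) (1 : (E →L[ℝ] E)ˣ)
    have e : rightVelocity m p (c 0) = ((1 : (E →L[ℝ] E)ˣ) : E →L[ℝ] E) := by
      rw [hc0, hr]; rfl
    rw [← e] at h6
    refine (h6.comp_hasDerivAt (0 : ℝ) hA).congr_deriv ?_
    ext x
    simp
  have hprod := hinv.clm_apply hB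
  have hunit : ∀ᶠ t in 𝓝 (0 : ℝ), IsUnit (rightVelocity m p (c t)) := by
    have : {L : E →L[ℝ] E | IsUnit L} ∈ 𝓝 (rightVelocity m p (c 0)) := by
      refine Units.isOpen.mem_nhds ?_
      rw [hc0, hr]
      exact isUnit_one
    exact hA.continuousAt this
  -- Right velocities equal `1` at the unit, hence are invertible nearby, and the implicit relation
  -- `hw` can be solved for `w`.
  have heq : w =ᶠ[𝓝 0] fun t =>
      Ring.inverse (rightVelocity m p (c t)) (leftVelocity m p (c t) Y) := by
    filter_upwards [hw, hunit] with t ht hu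
    rw [← ht, ← mul_apply_eq_comp, Ring.inverse_mul_cancel _ hu]
    rfl
  refine (hprod.congr_of_eventuallyEq heq).congr_deriv ?_
  rw [VectorField.lieBracket_eq]
  simp only [(hasFDerivAt_leftVelocity_apply hm X).fderiv,
    (hasFDerivAt_leftVelocity_apply hm Y).fderiv, hc0, hr, hl, Ring.inverse_one]
  simp only [one_apply_eq_self, ContinuousLinearMap.flip_apply,
    ContinuousLinearMap.comp_apply, neg_apply, ContinuousLinearMap.inl_apply]
  -- The product rule gives `D2 (X, 0) (0, Y) - D2 (0, X) (Y, 0)`; symmetry of the second derivative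
  -- identifies the last term with the one in the bracket.
  rw [← hD2, hsymm (0, X) (Y, 0)]
  abel

end LocalGroup

/-! ### The group law and conjugations in the chart at the identity -/

section IdentityChart

variable (E : Type*) [NormedAddCommGroup E] [NormedSpace ℝ E]
  (G : Type*) [TopologicalSpace G] [ChartedSpace E G] [Group G]

/-- The preferred chart of a Lie group at the identity. -/
noncomputable def idChart : PartialEquiv G E := extChartAt 𝓘(ℝ, E) (1 : G)

/-- The coordinates of the identity. -/
noncomputable def idPoint : E := idChart E G 1

/-- The group law read in the chart at the identity. -/
noncomputable def chartMul (z : E × E) : E :=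
  idChart E G ((idChart E G).symm z.1 * (idChart E G).symm z.2)

variable {G} in
/-- Conjugation by `h` read in the chart at the identity. -/
noncomputable def chartConj (h : G) (x : E) : E :=
  idChart E G (h * (idChart E G).symm x * h⁻¹)

variable {G} in
/-- The adjoint action of a Lie group on its tangent space at the identity. -/
noncomputable def adjointMap (h : G) : E →L[ℝ] E := fderiv ℝ (chartConj E h) (idPoint E G)

lemma idChart_symm_idPoint : (idChart E G).symm (idPoint E G) = 1 :=
  extChartAt_to_inv (I := 𝓘(ℝ, E)) (1 : G)

lemma eventually_idChart_symm_idChart : ∀ᶠ g in 𝓝 (1 : G),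
    (idChart E G).symm (idChart E G g) = g := by
  filter_upwards [extChartAt_source_mem_nhds (I := 𝓘(ℝ, E)) (1 : G)] with g hg
  exact (extChartAt 𝓘(ℝ, E) (1 : G)).left_inv hg

lemma eventually_idChart_idChart_symm : ∀ᶠ x in 𝓝 (idPoint E G),
    idChart E G ((idChart E G).symm x) = x := by
  filter_upwards [extChartAt_target_mem_nhds (I := 𝓘(ℝ, E)) (1 : G)] with x hx
  exact (extChartAt 𝓘(ℝ, E) (1 : G)).right_inv hx

lemma continuousAt_idChart : ContinuousAt (idChart E G) 1 :=
  continuousAt_extChartAt (I := 𝓘(ℝ, E)) (1 : G)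

lemma tendsto_idChart_symm : Tendsto (idChart E G).symm (𝓝 (idPoint E G)) (𝓝 1) := by
  have h := continuousAt_extChartAt_symm (I := 𝓘(ℝ, E)) (1 : G)
  have e : (extChartAt 𝓘(ℝ, E) (1 : G)).symm (extChartAt 𝓘(ℝ, E) (1 : G) 1) = 1 :=
    extChartAt_to_inv (I := 𝓘(ℝ, E)) (1 : G)
  unfold ContinuousAt at h
  rwa [e] at h

variable [LieGroup 𝓘(ℝ, E) ∞ G]

lemma contMDiffAt_idChart_symm :
    ContMDiffAt 𝓘(ℝ, E) 𝓘(ℝ, E) ∞ (idChart E G).symm (idPoint E G) :=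
  (contMDiffOn_extChartAt_symm (I := 𝓘(ℝ, E)) (1 : G)).contMDiffAt
    (extChartAt_target_mem_nhds (I := 𝓘(ℝ, E)) (1 : G))

variable {E G}

lemma contDiffAt_idChart_comp {Ω : Type*} [NormedAddCommGroup Ω] [NormedSpace ℝ Ω] {F : Ω → G}
    {x : Ω} (hF : ContMDiffAt 𝓘(ℝ, Ω) 𝓘(ℝ, E) ∞ F x) (hx : F x = 1) :
    ContDiffAt ℝ ∞ (fun y => idChart E G (F y)) x := by
  have h : ContMDiffAt 𝓘(ℝ, E) 𝓘(ℝ, E) ∞ (idChart E G) (F x) := by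
    rw [hx]
    exact contMDiffAt_extChartAt (I := 𝓘(ℝ, E))
  exact (h.comp x hF).contDiffAt

variable (E G)

lemma contDiffAt_chartMul : ContDiffAt ℝ ∞ (chartMul E G) (idPoint E G, idPoint E G) := by
  refine contDiffAt_idChart_comp (F := fun z : E × E =>
    (idChart E G).symm z.1 * (idChart E G).symm z.2) ?_ ?_
  · have h1 : ContMDiffAt 𝓘(ℝ, E × E) 𝓘(ℝ, E) ∞ (Prod.fst : E × E → E)
        (idPoint E G, idPoint E G) := contDiffAt_fst.contMDiffAt
    have h2 : ContMDiffAt 𝓘(ℝ, E × E) 𝓘(ℝ, E) ∞ (Prod.snd : E × E → E)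
        (idPoint E G, idPoint E G) := contDiffAt_snd.contMDiffAt
    exact ((contMDiffAt_idChart_symm E G).comp (idPoint E G, idPoint E G) h1).mul
      ((contMDiffAt_idChart_symm E G).comp (idPoint E G, idPoint E G) h2)
  · simp [idChart_symm_idPoint]

variable {G} in
lemma contDiffAt_chartConj (h : G) : ContDiffAt ℝ ∞ (chartConj E h) (idPoint E G) := by
  refine contDiffAt_idChart_comp (F := fun x : E => h * (idChart E G).symm x * h⁻¹) ?_ ?_
  · exact (contMDiffAt_const.mul (contMDiffAt_idChart_symm E G)).mul contMDiffAt_const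
  · simp [idChart_symm_idPoint]

variable {G} in
lemma chartConj_idPoint (h : G) : chartConj E h (idPoint E G) = idPoint E G := by
  rw [chartConj, idChart_symm_idPoint, mul_one, mul_inv_cancel, idPoint]

lemma eventually_chartMul_right : ∀ᶠ x in 𝓝 (idPoint E G), chartMul E G (idPoint E G, x) = x := by
  filter_upwards [eventually_idChart_idChart_symm E G] with x hx
  simp [chartMul, idChart_symm_idPoint, hx]

lemma eventually_chartMul_left : ∀ᶠ x in 𝓝 (idPoint E G), chartMul E G (x, idPoint E G) = x := by
  filter_upwards [eventually_idChart_idChart_symm E G] with x hx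
  simp [chartMul, idChart_symm_idPoint, hx]

variable {G} in
lemma hasFDerivAt_chartConj (h : G) :
    HasFDerivAt (chartConj E h) (adjointMap E h) (idPoint E G) :=
  ((contDiffAt_chartConj E h).differentiableAt (by simp)).hasFDerivAt

variable {G} in
lemma hasStrictFDerivAt_chartConj (h : G) :
    HasStrictFDerivAt (chartConj E h) (adjointMap E h) (idPoint E G) :=
  (contDiffAt_chartConj E h).hasStrictFDerivAt (by simp)

variable {G} in
/-- Near the identity a conjugation preserves the domain of the chart. -/
lemma eventually_conj (h : G) {P : G → Prop} (hP : ∀ᶠ g in 𝓝 1, P g) :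
    ∀ᶠ x in 𝓝 (idPoint E G), P (h * (idChart E G).symm x * h⁻¹) := by
  have hG := topologicalGroup_of_lieGroup 𝓘(ℝ, E) ∞ (G := G)
  have h1 : Tendsto (fun g : G => h * g * h⁻¹) (𝓝 1) (𝓝 (h * 1 * h⁻¹)) := by
    apply Continuous.tendsto
    fun_prop
  rw [mul_one, mul_inv_cancel] at h1
  exact (h1.comp (tendsto_idChart_symm E G)).eventually hP

variable {G} in
lemma adjointMap_mul (h k : G) :
    adjointMap E (h * k) = (adjointMap E h).comp (adjointMap E k) := by
  have h1 : HasFDerivAt (chartConj E h) (adjointMap E h) (chartConj E k (idPoint E G)) := by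
    rw [chartConj_idPoint]
    exact hasFDerivAt_chartConj E h
  have h2 := h1.comp (idPoint E G) (hasFDerivAt_chartConj E k)
  refine (h2.congr_of_eventuallyEq ?_).fderiv
  filter_upwards [eventually_conj E k (eventually_idChart_symm_idChart E G)] with x hx
  simp only [Function.comp, chartConj, hx]
  simp [mul_assoc]

variable {G} in
lemma adjointMap_one : adjointMap E (1 : G) = 1 := by
  refine ((hasFDerivAt_id (𝕜 := ℝ) (idPoint E G)).congr_of_eventuallyEq ?_).fderiv
  filter_upwards [eventually_idChart_idChart_symm E G] with x hx
  simp [chartConj, hx]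

/-- The adjoint action intertwines left and right translations. -/
lemma eventually_rightVelocity_adjointMap : ∀ᶠ g in 𝓝 (1 : G), ∀ Y : E,
    rightVelocity (chartMul E G) (idPoint E G) (idChart E G g) (adjointMap E g Y) =
      leftVelocity (chartMul E G) (idPoint E G) (idChart E G g) Y := by
  have hG := topologicalGroup_of_lieGroup 𝓘(ℝ, E) ∞ (G := G)
  have hd : ∀ᶠ z in 𝓝 (idPoint E G, idPoint E G), DifferentiableAt ℝ (chartMul E G) z :=
    ((((contDiffAt_chartMul E G).of_le (m := 1) (by simp)).eventually (by simp))).mono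
      fun z hz => hz.differentiableAt (by simp)
  have hl : ∀ᶠ g in 𝓝 (1 : G), DifferentiableAt ℝ (chartMul E G) (idChart E G g, idPoint E G) :=
    ((continuousAt_idChart E G).prodMk continuousAt_const).eventually hd
  have hr : ∀ᶠ g in 𝓝 (1 : G), DifferentiableAt ℝ (chartMul E G) (idPoint E G, idChart E G g) :=
    (continuousAt_const.prodMk (continuousAt_idChart E G)).eventually hd
  filter_upwards [hl, hr, eventually_idChart_symm_idChart E G] with g h1 h2 h3 Y
  have h4 : HasFDerivAt (fun y => chartMul E G (idChart E G g, y))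
      (leftVelocity (chartMul E G) (idPoint E G) (idChart E G g)) (idPoint E G) :=
    h1.hasFDerivAt.comp (idPoint E G) (hasFDerivAt_prodMk_right _ _)
  have h5 : HasFDerivAt (fun y => chartMul E G (y, idChart E G g))
      (rightVelocity (chartMul E G) (idPoint E G) (idChart E G g))
      (chartConj E g (idPoint E G)) := by
    rw [chartConj_idPoint]
    exact h2.hasFDerivAt.comp (f := fun e => (e, idChart E G g)) (idPoint E G)
      (hasFDerivAt_prodMk_left _ _)
  have h6 := h5.comp (idPoint E G) (hasFDerivAt_chartConj E g)
  -- This is `g * y = (g * y * g⁻¹) * g` in coordinates; differentiating both sides at the identity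
  -- gives the claim.
  have h7 : (fun y => chartMul E G (idChart E G g, y)) =ᶠ[𝓝 (idPoint E G)]
      (fun y => chartMul E G (y, idChart E G g)) ∘ chartConj E g := by
    filter_upwards [eventually_conj E g (eventually_idChart_symm_idChart E G)] with y hy
    simp only [Function.comp, chartMul, chartConj, hy, h3]
    simp
  have h8 := (h6.congr_of_eventuallyEq h7).unique h4
  exact DFunLike.congr_fun h8 Y

end IdentityChart

/-! ### The Lie bracket as the derivative of the adjoint action -/

section Bracket

variable {E : Type*} [NormedAddCommGroup E] [NormedSpace ℝ E] [CompleteSpace E]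
  {G : Type*} [TopologicalSpace G] [ChartedSpace E G] [Group G] [LieGroup 𝓘(ℝ, E) ∞ G]

lemma mdifferentiableAt_idChart {g : G} (hg : g ∈ (idChart E G).source) :
    MDifferentiableAt 𝓘(ℝ, E) 𝓘(ℝ, E) (idChart E G) g := by
  refine mdifferentiableAt_extChartAt (I := 𝓘(ℝ, E)) (x := (1 : G)) ?_
  rwa [idChart, extChartAt_source] at hg

lemma mulInvariantVectorField_one (Y : GroupLieAlgebra 𝓘(ℝ, E) G) :
    mulInvariantVectorField Y (1 : G) = Y := by
  have h : (fun z : G => 1 * z) = id := by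
    ext z
    simp
  have h1 : @Eq (E →L[ℝ] E) (mfderiv 𝓘(ℝ, E) 𝓘(ℝ, E) (fun z : G => 1 * z) 1) 1 := by
    rw [h]
    exact mfderiv_id
  exact DFunLike.congr_fun h1 Y

/-- A one-parameter subgroup, read in the chart at the identity, has the expected velocity. -/
lemma hasDerivAt_idChart_flow {Y : GroupLieAlgebra 𝓘(ℝ, E) G} {γ : ℝ → G} (hγ : IsOneParam γ)
    (h : IsMIntegralCurve (I := 𝓘(ℝ, E)) γ (mulInvariantVectorField Y)) :
    HasDerivAt (fun t => idChart E G (γ t)) (Y : E) 0 := by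
  have h1 := hasDerivAt_comp_mul_flow hγ h
    (mdifferentiableAt_idChart (mem_extChartAt_source (I := 𝓘(ℝ, E)) (1 : G)))
  simp only [one_mul] at h1
  refine h1.congr_deriv ?_
  have h2 : @Eq (E →L[ℝ] E) (mfderiv 𝓘(ℝ, E) 𝓘(ℝ, E) (idChart E G) (1 : G)) 1 :=
    mfderiv_extChartAt_self (I := 𝓘(ℝ, E)) (x := (1 : G))
  rw [mulInvariantVectorField_one]
  exact DFunLike.congr_fun h2 Y

/-- Strictness is what the inverse function theorem needs later. It follows because the derivative
at nearby times `t` is the left velocity at `γ t`, which is continuous at `0`. -/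
lemma hasStrictDerivAt_idChart_flow {Y : GroupLieAlgebra 𝓘(ℝ, E) G} {γ : ℝ → G}
    (hγ : IsOneParam γ) (h : IsMIntegralCurve (I := 𝓘(ℝ, E)) γ (mulInvariantVectorField Y)) :
    HasStrictDerivAt (fun t => idChart E G (γ t)) (Y : E) 0 := by
  have h0 := hasDerivAt_idChart_flow hγ h
  have hs := contDiffAt_chartMul E G
  have hγt : Tendsto γ (𝓝 0) (𝓝 1) := by
    have := hγ.continuous.tendsto 0
    rwa [hγ.map_zero] at this
  have hc0 : idChart E G (γ 0) = idPoint E G := by rw [hγ.map_zero, idPoint]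
  have hct : ContinuousAt (fun t => (idChart E G (γ t), idPoint E G)) 0 :=
    h0.continuousAt.prodMk continuousAt_const
  have hd : ∀ᶠ z in 𝓝 (idPoint E G, idPoint E G), DifferentiableAt ℝ (chartMul E G) z :=
    ((hs.of_le (m := 1) (by simp)).eventually (by simp)).mono
      fun z hz => hz.differentiableAt (by simp)
  have hd' : ∀ᶠ t in 𝓝 (0 : ℝ), DifferentiableAt ℝ (chartMul E G)
      (idChart E G (γ t), idPoint E G) := by
    rw [ContinuousAt, hc0] at hct
    exact hct.eventually hd
  have key : ∀ᶠ t in 𝓝 (0 : ℝ), HasDerivAt (fun t => idChart E G (γ t))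
      (leftVelocity (chartMul E G) (idPoint E G) (idChart E G (γ t)) Y) t := by
    filter_upwards [hd', hγt.eventually (eventually_idChart_symm_idChart E G)] with t ht ht'
    have h1 : HasFDerivAt (fun y => chartMul E G (idChart E G (γ t), y))
        (leftVelocity (chartMul E G) (idPoint E G) (idChart E G (γ t))) (idPoint E G) :=
      ht.hasFDerivAt.comp (idPoint E G) (hasFDerivAt_prodMk_right _ _)
    have h2 := h1.comp_hasDerivAt_of_eq (0 : ℝ) h0 hc0.symm
    have h3 : (fun s => idChart E G (γ (t + s))) =ᶠ[𝓝 0]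
        (fun y => chartMul E G (idChart E G (γ t), y)) ∘ fun t => idChart E G (γ t) := by
      filter_upwards [hγt.eventually (eventually_idChart_symm_idChart E G)] with s hs'
      simp only [Function.comp, chartMul, ht', hs', hγ.map_add]
    have h4 := h2.congr_of_eventuallyEq h3
    have h5 : HasDerivAt (fun s => idChart E G (γ (t + (s - t))))
        (leftVelocity (chartMul E G) (idPoint E G) (idChart E G (γ t)) Y) t := by
      rw [← sub_self t] at h4
      exact h4.comp_sub_const t t
    simpa using h5
  have hcont : ContinuousAt
      (fun t => leftVelocity (chartMul E G) (idPoint E G) (idChart E G (γ t)) (Y : E)) 0 := by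
    refine ContinuousAt.comp (f := fun t => idChart E G (γ t))
      (g := fun x => leftVelocity (chartMul E G) (idPoint E G) x (Y : E)) ?_ h0.continuousAt
    rw [hc0]
    exact (hasFDerivAt_leftVelocity_apply (hs.of_le ENat.LEInfty.out) Y).continuousAt
  have := hasStrictDerivAt_of_hasDerivAt_of_continuousAt key hcont
  rw [hc0, leftVelocity_self (hs.differentiableAt (by simp)) (eventually_chartMul_right E G)]
    at this
  exact this

/-- Both sides are the velocity at time `0` of the left translate of `γ` through the point with
coordinates `x`, computed once through `chartMul` and once from the invariant field. -/
lemma leftVelocity_flow {Y : GroupLieAlgebra 𝓘(ℝ, E) G} {γ : ℝ → G} (hγ : IsOneParam γ)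
    (h : IsMIntegralCurve (I := 𝓘(ℝ, E)) γ (mulInvariantVectorField Y)) {x : E}
    (hx : (idChart E G).symm x ∈ (idChart E G).source)
    (hd : DifferentiableAt ℝ (chartMul E G) (x, idPoint E G)) :
    @Eq E (leftVelocity (chartMul E G) (idPoint E G) x (Y : E))
      (mfderiv 𝓘(ℝ, E) 𝓘(ℝ, E) (idChart E G) ((idChart E G).symm x)
        (mulInvariantVectorField Y ((idChart E G).symm x))) := by
  have h1 := hasDerivAt_comp_mul_flow hγ h (mdifferentiableAt_idChart hx)
  have h2 : HasFDerivAt (fun y => chartMul E G (x, y))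
      (leftVelocity (chartMul E G) (idPoint E G) x) (idPoint E G) :=
    hd.hasFDerivAt.comp (idPoint E G) (hasFDerivAt_prodMk_right _ _)
  have h3 := h2.comp_hasDerivAt_of_eq (0 : ℝ) (hasDerivAt_idChart_flow hγ h)
    (by rw [hγ.map_zero, idPoint])
  have hγt : Tendsto γ (𝓝 0) (𝓝 1) := by
    have := hγ.continuous.tendsto 0
    rwa [hγ.map_zero] at this
  refine (h3.congr_of_eventuallyEq ?_).unique h1
  filter_upwards [hγt.eventually (eventually_idChart_symm_idChart E G)] with t ht
  simp only [Function.comp, chartMul, ht]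

/-- A left-invariant vector field read in the chart at the identity. -/
noncomputable def chartField (Y : GroupLieAlgebra 𝓘(ℝ, E) G) (x : E) : E :=
  VectorField.mpullbackWithin 𝓘(ℝ, E) 𝓘(ℝ, E) (idChart E G).symm
    (mulInvariantVectorField Y) (range 𝓘(ℝ, E)) x

/-- Pulling back by the inverse chart amounts to applying the derivative of the chart, the two
derivatives being mutually inverse; `leftVelocity_flow` then applies. -/
lemma eventually_chartField [T2Space G] (Y : GroupLieAlgebra 𝓘(ℝ, E) G) :
    chartField Y =ᶠ[𝓝 (idPoint E G)]
      fun x => leftVelocity (chartMul E G) (idPoint E G) x (Y : E) := by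
  obtain ⟨γ, hγ, h⟩ := exists_isOneParam Y
  have hd : ∀ᶠ z in 𝓝 (idPoint E G, idPoint E G), DifferentiableAt ℝ (chartMul E G) z :=
    (((contDiffAt_chartMul E G).of_le (m := 1) (by simp)).eventually (by simp)).mono
      fun z hz => hz.differentiableAt (by simp)
  have hd' : ∀ᶠ x in 𝓝 (idPoint E G), DifferentiableAt ℝ (chartMul E G) (x, idPoint E G) :=
    (continuousAt_id.prodMk continuousAt_const).eventually hd
  filter_upwards [hd', extChartAt_target_mem_nhds (I := 𝓘(ℝ, E)) (1 : G)] with x hx hxt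
  have hxs : (idChart E G).symm x ∈ (idChart E G).source := (idChart E G).map_target hxt
  rw [leftVelocity_flow hγ h hxs hx]
  have e := ContinuousLinearMap.inverse_eq
    (mfderivWithin_extChartAt_symm_comp_mfderiv_extChartAt (I := 𝓘(ℝ, E)) (x := (1 : G)) hxt)
    (mfderiv_extChartAt_comp_mfderivWithin_extChartAt_symm (I := 𝓘(ℝ, E)) (x := (1 : G)) hxt)
  exact DFunLike.congr_fun e (mulInvariantVectorField Y ((idChart E G).symm x))

/-- The bracket is by definition computed in the chart at the identity. The derivative of the chart
is the identity there, and the invariant fields become left velocities. -/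
lemma bracket_eq_lieBracket [T2Space G] (Y Z : GroupLieAlgebra 𝓘(ℝ, E) G) :
    ⁅Y, Z⁆ = VectorField.lieBracket ℝ
      (fun x => leftVelocity (chartMul E G) (idPoint E G) x (Y : E))
      (fun x => leftVelocity (chartMul E G) (idPoint E G) x (Z : E)) (idPoint E G) := by
  obtain ⟨D, hD⟩ : ∃ D : E →L[ℝ] E,
      D = mfderiv 𝓘(ℝ, E) 𝓘(ℝ, E) (idChart E G) (1 : G) := ⟨_, rfl⟩
  have h1 : @Eq E (⁅Y, Z⁆ : GroupLieAlgebra 𝓘(ℝ, E) G)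
      (D.inverse (VectorField.lieBracketWithin ℝ (chartField Y) (chartField Z)
        ((idChart E G).symm ⁻¹' univ ∩ range 𝓘(ℝ, E)) (idPoint E G))) := by
    rw [hD]
    rfl
  have h2 : D = ContinuousLinearMap.id ℝ E :=
    hD.trans (mfderiv_extChartAt_self (I := 𝓘(ℝ, E)) (x := (1 : G)))
  refine h1.trans ?_
  rw [h2, ContinuousLinearMap.inverse_id, ModelWithCorners.range_eq_univ, preimage_univ,
    inter_univ, VectorField.lieBracketWithin_univ]
  exact (eventually_chartField Y).lieBracket_vectorField_eq (eventually_chartField Z)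

/-- The Lie bracket is the derivative of the adjoint action along a one-parameter subgroup. -/
lemma hasDerivAt_adjointMap [T2Space G] {Y : GroupLieAlgebra 𝓘(ℝ, E) G} {γ : ℝ → G}
    (hγ : IsOneParam γ) (h : IsMIntegralCurve (I := 𝓘(ℝ, E)) γ (mulInvariantVectorField Y))
    (Z : GroupLieAlgebra 𝓘(ℝ, E) G) :
    HasDerivAt (F := E) (fun t => adjointMap E (γ t) Z)
      (⁅Y, Z⁆ : GroupLieAlgebra 𝓘(ℝ, E) G) 0 := by
  have hγt : Tendsto γ (𝓝 0) (𝓝 1) := by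
    have := hγ.continuous.tendsto 0
    rwa [hγ.map_zero] at this
  have h2 : ContDiffAt ℝ 2 (chartMul E G) (idPoint E G, idPoint E G) :=
    (contDiffAt_chartMul E G).of_le ENat.LEInfty.out
  have h1 := hasDerivAt_adjoint (c := fun t => idChart E G (γ t))
    (w := fun t => adjointMap E (γ t) (Z : E)) (X := (Y : E)) (Y := (Z : E)) h2
    (eventually_chartMul_right E G) (eventually_chartMul_left E G)
    (by rw [hγ.map_zero, idPoint]) (hasDerivAt_idChart_flow hγ h)
    ((hγt.eventually (eventually_rightVelocity_adjointMap E G)).mono fun t ht => ht Z)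
  exact h1.congr_deriv (bracket_eq_lieBracket Y Z).symm

end Bracket

/-! ### Hörmander's condition and Chow's theorem -/

section Chow

variable {E : Type*} [NormedAddCommGroup E] [NormedSpace ℝ E] [FiniteDimensional ℝ E]
  [CompleteSpace E] {G : Type*} [TopologicalSpace G] [ChartedSpace E G] [Group G] [LieGroup 𝓘(ℝ, E) ∞ G]
  [IsTopologicalGroup G] {ℓ : ℕ} {X : Fin ℓ → GroupLieAlgebra 𝓘(ℝ, E) G} {γ : Fin ℓ → ℝ → G}

/-- The group generated by small pieces of the one-parameter subgroups. -/
def wordGroup (γ : Fin ℓ → ℝ → G) : Subgroup G := Subgroup.closure (letters γ)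

/-- The span of the orbits of `X₁, …, X_ℓ` under the adjoint action of `wordGroup γ`. -/
noncomputable def orbitSpan (X : Fin ℓ → GroupLieAlgebra 𝓘(ℝ, E) G) (γ : Fin ℓ → ℝ → G) :
    Submodule ℝ E :=
  Submodule.span ℝ {Z | ∃ h ∈ wordGroup γ, ∃ j, Z = adjointMap E h (X j)}

lemma adjointMap_mem_orbitSpan {h : G} (hh : h ∈ wordGroup γ) {Z : E}
    (hZ : Z ∈ orbitSpan X γ) : adjointMap E h Z ∈ orbitSpan X γ := by
  induction hZ using Submodule.span_induction with
  | mem Z hZ =>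
    obtain ⟨k, hk, j, rfl⟩ := hZ
    refine Submodule.subset_span ⟨h * k, mul_mem hh hk, j, ?_⟩
    rw [adjointMap_mul]
    rfl
  | zero => rw [map_zero]; exact zero_mem _
  | add x y _ _ hx hy => rw [map_add]; exact add_mem hx hy
  | smul a x _ hx => rw [map_smul]; exact Submodule.smul_mem _ _ hx

lemma mem_orbitSpan (j : Fin ℓ) : (X j : E) ∈ orbitSpan X γ := by
  refine Submodule.subset_span ⟨1, one_mem _, j, ?_⟩
  rw [adjointMap_one]
  rfl

/-- Difference quotients stay in `S`, and a subspace of finite dimension is closed. -/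
lemma Submodule.mem_of_hasDerivAt (S : Submodule ℝ E) {w : ℝ → E} {w' : E} {t : ℝ}
    (h : HasDerivAt w w' t) (hw : ∀ᶠ s in 𝓝 t, w s ∈ S) : w' ∈ S := by
  refine S.closed_of_finiteDimensional.mem_of_tendsto (hasDerivAt_iff_tendsto_slope.1 h) ?_
  filter_upwards [hw.filter_mono nhdsWithin_le_nhds] with s hs
  exact S.smul_mem _ (S.sub_mem hs hw.self_of_nhds)

lemma bracket_mem_orbitSpan [T2Space G] (hγ : ∀ j, IsOneParam (γ j))
    (h : ∀ j, IsMIntegralCurve (I := 𝓘(ℝ, E)) (γ j) (mulInvariantVectorField (X j)))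
    (j : Fin ℓ) {Z : GroupLieAlgebra 𝓘(ℝ, E) G} (hZ : (Z : E) ∈ orbitSpan (E := E) X γ) :
    @Membership.mem E _ _ (orbitSpan (E := E) X γ) (⁅X j, Z⁆ : GroupLieAlgebra 𝓘(ℝ, E) G) := by
  refine Submodule.mem_of_hasDerivAt (E := E) _ (w := fun t => adjointMap E (γ j t) (Z : E)) (hasDerivAt_adjointMap (hγ j) (h j) Z) ?_
  filter_upwards [Metric.ball_mem_nhds (0 : ℝ) one_pos] with s hs
  refine adjointMap_mem_orbitSpan (Subgroup.subset_closure (apply_mem_letters j ?_)) hZ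
  simpa using (mem_ball_zero_iff.1 hs).le

/-- Differentiating the adjoint action shows only that the span `S` is stable under brackets with
the `X j`. The space `N` of all `Z` with `[Z, S] ⊆ S` therefore contains the `X j`, and it is closed
under brackets by the Jacobi identity, so Hörmander's condition gives `N = ⊤`. Then `S` itself is
closed under brackets, and a second application gives `S = ⊤`. -/
lemma orbitSpan_eq_top [T2Space G] (hγ : ∀ j, IsOneParam (γ j))
    (h : ∀ j, IsMIntegralCurve (I := 𝓘(ℝ, E)) (γ j) (mulInvariantVectorField (X j)))
    (hX : HormanderCondition X) : orbitSpan X γ = ⊤ := by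
  have := lieGroup_minSmoothness_three E G
  let S : Submodule ℝ (GroupLieAlgebra 𝓘(ℝ, E) G) := orbitSpan (E := E) X γ
  let N : Submodule ℝ (GroupLieAlgebra 𝓘(ℝ, E) G) :=
    { carrier := {Z | ∀ u ∈ S, ⁅Z, u⁆ ∈ S}
      zero_mem' := fun u _ => by rw [zero_lie]; exact S.zero_mem
      add_mem' := fun {a b} ha hb u hu => by rw [add_lie]; exact S.add_mem (ha u hu) (hb u hu)
      smul_mem' := fun c a ha u hu => by rw [smul_lie]; exact S.smul_mem c (ha u hu) }
  have hN : N = ⊤ := hX N (fun j u hu => bracket_mem_orbitSpan hγ h j hu) fun a ha b hb u hu => by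
    rw [lie_lie]
    exact S.sub_mem (ha _ (hb u hu)) (hb _ (ha u hu))
  refine hX S (fun j => mem_orbitSpan j) fun u _ w hw => ?_
  have hu : u ∈ N := hN ▸ Submodule.mem_top
  exact hu w hw

/-- A product of conjugated one-parameter subgroups. -/
def wordMap (γ : Fin ℓ → ℝ → G) {d : ℕ} (h : Fin d → G) (k : Fin d → Fin ℓ)
    (l : List (Fin d)) (t : Fin d → ℝ) : G :=
  (l.map fun i => h i * γ (k i) (t i) * (h i)⁻¹).prod

lemma wordMap_zero (hγ : ∀ j, IsOneParam (γ j)) {d : ℕ} (h : Fin d → G) (k : Fin d → Fin ℓ)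
    (l : List (Fin d)) : wordMap γ h k l 0 = 1 := by
  induction l with
  | nil => rfl
  | cons i l ih =>
    simp only [wordMap, List.map_cons, List.prod_cons] at ih ⊢
    rw [ih]
    simp [(hγ _).map_zero]

lemma continuous_wordMap (hγ : ∀ j, IsOneParam (γ j)) {d : ℕ} (h : Fin d → G)
    (k : Fin d → Fin ℓ) (l : List (Fin d)) : Continuous (wordMap γ h k l) := by
  refine continuous_list_prod l fun i _ => ?_
  have := (hγ (k i)).continuous
  fun_prop

lemma hasStrictFDerivAt_chartMul : HasStrictFDerivAt (chartMul E G)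
    (ContinuousLinearMap.fst ℝ E E + ContinuousLinearMap.snd ℝ E E)
    (idPoint E G, idPoint E G) := by
  have hs := contDiffAt_chartMul E G
  have hd := hs.differentiableAt (by simp)
  have h1 := hs.hasStrictFDerivAt (by simp)
  have hl : leftVelocity (chartMul E G) (idPoint E G) (idPoint E G) = 1 :=
    leftVelocity_self (p := idPoint E G) hd (eventually_chartMul_right E G)
  have hr : rightVelocity (chartMul E G) (idPoint E G) (idPoint E G) = 1 :=
    rightVelocity_self (p := idPoint E G) hd (eventually_chartMul_left E G)
  refine h1.congr_fderiv ?_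
  refine ContinuousLinearMap.prod_ext ?_ ?_
  · refine hr.trans ?_
    ext x
    simp
  · refine hl.trans ?_
    ext x
    simp

lemma hasStrictFDerivAt_idChart_mul {Ω : Type*} [NormedAddCommGroup Ω] [NormedSpace ℝ Ω]
    {F K : Ω → G} {A B : Ω →L[ℝ] E} {x : Ω} (hF1 : F x = 1) (hK1 : K x = 1)
    (hFc : ContinuousAt F x) (hKc : ContinuousAt K x)
    (hF : HasStrictFDerivAt (fun t => idChart E G (F t)) A x)
    (hK : HasStrictFDerivAt (fun t => idChart E G (K t)) B x) :
    HasStrictFDerivAt (fun t => idChart E G (F t * K t)) (A + B) x := by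
  have h1 : HasStrictFDerivAt (chartMul E G)
      (ContinuousLinearMap.fst ℝ E E + ContinuousLinearMap.snd ℝ E E)
      (idChart E G (F x), idChart E G (K x)) := by
    rw [hF1, hK1]
    exact hasStrictFDerivAt_chartMul
  have h2 := h1.comp x (hF.prodMk hK)
  rw [ContinuousAt, hF1] at hFc
  rw [ContinuousAt, hK1] at hKc
  refine (h2.congr_of_eventuallyEq ?_).congr_fderiv ?_
  · filter_upwards [hFc.eventually (eventually_idChart_symm_idChart E G),
      hKc.eventually (eventually_idChart_symm_idChart E G)] with t h3 h4
    simp only [chartMul, h3, h4]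
  · ext t
    simp

/-- At `t = 0` every factor is the identity, where the derivative of multiplication is addition; the
factor with index `i` contributes `t i` times the adjoint image of `X (k i)`. -/
lemma hasStrictFDerivAt_wordMap
    (hγ : ∀ j, IsOneParam (γ j))
    (h : ∀ j, IsMIntegralCurve (I := 𝓘(ℝ, E)) (γ j) (mulInvariantVectorField (X j)))
    {d : ℕ} (q : Fin d → G) (k : Fin d → Fin ℓ) (l : List (Fin d)) :
    HasStrictFDerivAt (fun t => idChart E G (wordMap γ q k l t))
      (l.map fun i => (ContinuousLinearMap.proj (R := ℝ) (φ := fun _ : Fin d => ℝ) i).smulRight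
        (adjointMap E (q i) (X (k i)))).sum 0 := by
  induction l with
  | nil => exact hasStrictFDerivAt_const (𝕜 := ℝ) (idChart E G 1) (0 : Fin d → ℝ)
  | cons i l ih =>
    rw [List.map_cons, List.sum_cons]
    have hc : Continuous fun t : Fin d → ℝ => q i * γ (k i) (t i) * (q i)⁻¹ := by
      have := (hγ (k i)).continuous
      fun_prop
    refine hasStrictFDerivAt_idChart_mul (F := fun t : Fin d → ℝ => q i * γ (k i) (t i) * (q i)⁻¹)
      (K := wordMap γ q k l) (by simp [(hγ _).map_zero])
      (wordMap_zero hγ q k l) hc.continuousAt (continuous_wordMap hγ q k l).continuousAt ?_ ih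
    have h1 := (hasStrictDerivAt_idChart_flow (hγ (k i)) (h (k i))).hasStrictFDerivAt
    have h2 : HasStrictFDerivAt (fun t : Fin d → ℝ => t i)
      (ContinuousLinearMap.proj (R := ℝ) (φ := fun _ : Fin d => ℝ) i) 0 :=
      (ContinuousLinearMap.proj (R := ℝ) (φ := fun _ : Fin d => ℝ) i).hasStrictFDerivAt
    have h3 := HasStrictFDerivAt.comp (g := fun s => idChart E G (γ (k i) s))
      (f := fun t : Fin d → ℝ => t i) (0 : Fin d → ℝ) h1 h2
    have h4 : HasStrictFDerivAt (chartConj E (q i)) (adjointMap E (q i))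
        (idChart E G (γ (k i) ((0 : Fin d → ℝ) i))) := by
      rw [Pi.zero_apply, (hγ _).map_zero]
      exact hasStrictFDerivAt_chartConj E (q i)
    have h5 := h4.comp (0 : Fin d → ℝ) h3
    refine (h5.congr_of_eventuallyEq ?_).congr_fderiv ?_
    · have hγt : Tendsto (fun t : Fin d → ℝ => γ (k i) (t i)) (𝓝 0) (𝓝 1) := by
        have : Continuous fun t : Fin d → ℝ => γ (k i) (t i) := by
          have := (hγ (k i)).continuous
          fun_prop
        have := this.tendsto 0
        rwa [Pi.zero_apply, (hγ _).map_zero] at this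
      filter_upwards [hγt.eventually (eventually_idChart_symm_idChart E G)] with t ht
      simp only [chartConj, ht]
    · ext t
      exact map_smul (adjointMap E (q i)) (t i) (X (k i) : E)

/-- Products of finitely many conjugated one-parameter subgroups give coordinates near the
identity. -/
theorem exists_wordMap_coordinates [T2Space G] (hγ : ∀ j, IsOneParam (γ j))
    (h : ∀ j, IsMIntegralCurve (I := 𝓘(ℝ, E)) (γ j) (mulInvariantVectorField (X j)))
    (hX : HormanderCondition X) :
    ∃ (d : ℕ) (q : Fin d → G) (k : Fin d → Fin ℓ) (A : (Fin d → ℝ) ≃L[ℝ] E),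
      (∀ i, q i ∈ wordGroup γ) ∧
      HasStrictFDerivAt (fun t => idChart E G (wordMap γ q k (List.finRange d) t))
        (A : (Fin d → ℝ) →L[ℝ] E) 0 := by
  -- A basis is extracted from the adjoint orbits themselves, so each basis vector is the velocity
  -- of a conjugated one-parameter subgroup.
  let b := Module.Basis.ofSpan (orbitSpan_eq_top hγ h hX).ge
  have := Module.Finite.finite_basis b
  obtain ⟨d, ⟨e⟩⟩ := Finite.exists_equiv_fin ((linearIndepOn_empty ℝ id).extend
    (empty_subset {Z | ∃ h ∈ wordGroup γ, ∃ j, Z = adjointMap E h (X j)}))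
  let b' := b.reindex e
  have hb' : ∀ i, ∃ q ∈ wordGroup γ, ∃ j, b' i = adjointMap E q (X j) := fun i =>
    Module.Basis.ofSpan_subset (orbitSpan_eq_top hγ h hX).ge
      ⟨e.symm i, (b.reindex_apply e i).symm⟩
  choose q hq k hk using hb'
  refine ⟨d, q, k, b'.equivFun.symm.toContinuousLinearEquiv, hq,
    (hasStrictFDerivAt_wordMap hγ h q k _).congr_fderiv ?_⟩
  rw [← Fin.sum_univ_def]
  ext t
  simp [Module.Basis.equivFun_symm_apply, ← hk]

lemma exists_mem_letters_pow (hγ : ∀ j, IsOneParam (γ j)) {x : G} (hx : x ∈ wordGroup γ) :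
    ∃ n, x ∈ letters γ ^ n := by
  induction hx using Subgroup.closure_induction with
  | mem x hx => exact ⟨1, by rwa [pow_one]⟩
  | one => exact ⟨0, by simp⟩
  | mul x y _ _ hx hy =>
    obtain ⟨m, hm⟩ := hx
    obtain ⟨n, hn⟩ := hy
    exact ⟨m + n, by rw [pow_add]; exact mul_mem_mul hm hn⟩
  | inv x _ hx =>
    obtain ⟨n, hn⟩ := hx
    exact ⟨n, inv_mem_letters_pow hγ hn⟩

lemma letters_pow_subset_wordGroup (n : ℕ) : letters γ ^ n ⊆ (wordGroup γ : Set G) := by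
  induction n with
  | zero =>
    rw [pow_zero]
    rintro _ rfl
    exact one_mem _
  | succ n ih =>
    rw [pow_succ]
    rintro _ ⟨x, hx, y, hy, rfl⟩
    exact mul_mem (ih hx) (Subgroup.subset_closure hy)

lemma exists_wordMap_mem_letters_pow (hγ : ∀ j, IsOneParam (γ j)) {d : ℕ} {q : Fin d → G}
    (hq : ∀ i, q i ∈ wordGroup γ) (k : Fin d → Fin ℓ) (l : List (Fin d)) :
    ∃ n, ∀ t : Fin d → ℝ, (∀ i, |t i| ≤ 1) → wordMap γ q k l t ∈ letters γ ^ n := by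
  induction l with
  | nil => exact ⟨0, fun t _ => by simp [wordMap]⟩
  | cons i l ih =>
    obtain ⟨n, hn⟩ := ih
    obtain ⟨m, hm⟩ := exists_mem_letters_pow hγ (hq i)
    refine ⟨m + 1 + m + n, fun t ht => ?_⟩
    rw [wordMap, List.map_cons, List.prod_cons, pow_add, pow_add, pow_add, pow_one]
    exact mul_mem_mul (mul_mem_mul (mul_mem_mul hm (apply_mem_letters _ (ht i)))
      (inv_mem_letters_pow hγ hm)) (hn t ht)

/-- By the inverse function theorem, the image of a small box of times under `wordMap` is a
neighbourhood of the identity. The conjugating elements are fixed words, so the word length is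
uniform over the box. -/
lemma exists_letters_pow_mem_nhds_one [T2Space G] (hγ : ∀ j, IsOneParam (γ j))
    (h : ∀ j, IsMIntegralCurve (I := 𝓘(ℝ, E)) (γ j) (mulInvariantVectorField (X j)))
    (hX : HormanderCondition X) : ∃ n, letters γ ^ n ∈ 𝓝 (1 : G) := by
  obtain ⟨d, q, k, A, hq, hA⟩ := exists_wordMap_coordinates hγ h hX
  obtain ⟨n, hn⟩ := exists_wordMap_mem_letters_pow hγ hq k (List.finRange d)
  refine ⟨n, ?_⟩
  have h1 := hA.map_nhds_eq_of_equiv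
  rw [wordMap_zero hγ] at h1
  have h2 : ∀ᶠ t in 𝓝 (0 : Fin d → ℝ), (∀ i, |t i| ≤ 1) ∧
      (idChart E G).symm (idChart E G (wordMap γ q k (List.finRange d) t)) =
        wordMap γ q k (List.finRange d) t := by
    have h3 := (continuous_wordMap hγ q k (List.finRange d)).tendsto 0
    rw [wordMap_zero hγ] at h3
    filter_upwards [Metric.closedBall_mem_nhds (0 : Fin d → ℝ) one_pos,
      h3.eventually (eventually_idChart_symm_idChart E G)] with t ht ht'
    exact ⟨fun i => (norm_le_pi_norm t i).trans (by simpa using ht), ht'⟩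
  have h4 : ∀ᶠ x in 𝓝 (idChart E G 1), (idChart E G).symm x ∈ letters γ ^ n := by
    rw [← h1, eventually_map]
    filter_upwards [h2] with t ht
    rw [ht.2]
    exact hn t ht.1
  filter_upwards [(continuousAt_idChart E G).eventually h4,
    eventually_idChart_symm_idChart E G] with g hg hg'
  rwa [hg'] at hg

/-- Chow's theorem: under Hörmander's condition the horizontal one-parameter subgroups generate
the group, and each compact set is reached by words of bounded length. -/
theorem generates_of_hormanderCondition [T2Space G] [ConnectedSpace G]
    (hγ : ∀ j, IsOneParam (γ j))
    (h : ∀ j, IsMIntegralCurve (I := 𝓘(ℝ, E)) (γ j) (mulInvariantVectorField (X j)))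
    (hX : HormanderCondition X) : Generates γ := by
  obtain ⟨m, hm⟩ := exists_letters_pow_mem_nhds_one hγ h hX
  have hopen : IsOpen (wordGroup γ : Set G) := by
    refine Subgroup.isOpen_of_mem_nhds _ (g := 1) (mem_of_superset hm ?_)
    exact letters_pow_subset_wordGroup m
  have htop : (wordGroup γ : Set G) = univ :=
    IsClopen.eq_univ ⟨Subgroup.isClosed_of_isOpen _ hopen, hopen⟩ ⟨1, one_mem _⟩
  intro K hK
  -- A word `x` of length `n` is interior to the words of length `n + m`, since `x` times a
  -- neighbourhood of `1` is a neighbourhood of `x`. Compactness then selects one length.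
  have hcov : K ⊆ ⋃ n, interior (letters γ ^ n) := by
    intro x _
    obtain ⟨n, hn⟩ := exists_mem_letters_pow hγ (htop ▸ mem_univ x : x ∈ (wordGroup γ : Set G))
    refine mem_iUnion.2 ⟨n + m, mem_interior_iff_mem_nhds.2 ?_⟩
    have h1 : x • (letters γ ^ m) ∈ 𝓝 x := by
      have := smul_mem_nhds_smul x hm
      rwa [smul_eq_mul, mul_one] at this
    refine mem_of_superset h1 ?_
    rintro _ ⟨y, hy, rfl⟩
    rw [pow_add]
    exact mul_mem_mul hn hy
  obtain ⟨n, hn⟩ := hK.elim_directed_cover _ (fun n => isOpen_interior) hcov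
    (directed_of_isDirected_le fun a b hab => interior_mono (letters_pow_mono hab))
  exact ⟨n, hn.trans interior_subset⟩

end Chow

/-! ### Differentiability of continuous positive characters -/

section Character

variable {E : Type*} [NormedAddCommGroup E] [NormedSpace ℝ E] [FiniteDimensional ℝ E]
  [CompleteSpace E] {G : Type*} [TopologicalSpace G] [ChartedSpace E G] [Group G]
  [LieGroup 𝓘(ℝ, E) ∞ G] [IsTopologicalGroup G] [T2Space G]
  {ℓ : ℕ} {X : Fin ℓ → GroupLieAlgebra 𝓘(ℝ, E) G} {γ : Fin ℓ → ℝ → G}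
  {χ : G →* ℝ}

/-- The function `log (χ (γ t))` is continuous and additive in `t`, hence linear. -/
lemma IsOneParam.exists_character_eq_exp {γ : ℝ → G} (hγ : IsOneParam γ) (hχ : Continuous χ)
    (hχ0 : ∀ x, 0 < χ x) : ∃ c : ℝ, ∀ t, χ (γ t) = Real.exp (t * c) := by
  let f : ℝ →+ ℝ :=
    { toFun := fun t => Real.log (χ (γ t))
      map_zero' := by simp [hγ.map_zero]
      map_add' := fun s t => by
        rw [hγ.map_add, map_mul, Real.log_mul (hχ0 _).ne' (hχ0 _).ne'] }
  have hf : Continuous f := (hχ.comp hγ.continuous).log fun t => (hχ0 _).ne'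
  refine ⟨f 1, fun t => ?_⟩
  have h1 : f (t • 1) = t • f 1 := map_real_smul f hf t 1
  rw [smul_eq_mul, mul_one, smul_eq_mul] at h1
  rw [← h1]
  exact (Real.exp_log (hχ0 _)).symm

lemma character_wordMap {c : Fin ℓ → ℝ} (hc : ∀ j t, χ (γ j t) = Real.exp (t * c j)) {d : ℕ}
    (q : Fin d → G) (k : Fin d → Fin ℓ) (l : List (Fin d)) (t : Fin d → ℝ) :
    χ (wordMap γ q k l t) = Real.exp (l.map fun i => t i * c (k i)).sum := by
  induction l with
  | nil => simp [wordMap]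
  | cons i l ih =>
    have h1 : χ (q i) * χ (q i)⁻¹ = 1 := by rw [← map_mul, mul_inv_cancel, map_one]
    simp only [wordMap, List.map_cons, List.prod_cons, List.sum_cons, Real.exp_add] at ih ⊢
    rw [map_mul, ih, map_mul, map_mul, hc, mul_right_comm (χ (q i)), h1, one_mul]

/-- Conjugation does not affect `χ`, so on a product of conjugated one-parameter subgroups it is the
exponential of a linear form in the times. Near the identity those times are recovered by the local
inverse of `wordMap`, which is differentiable there. -/
lemma mdifferentiableAt_character_one (hγ : ∀ j, IsOneParam (γ j))
    (h : ∀ j, IsMIntegralCurve (I := 𝓘(ℝ, E)) (γ j) (mulInvariantVectorField (X j)))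
    (hX : HormanderCondition X) (hχ : Continuous χ) (hχ0 : ∀ x, 0 < χ x) :
    MDifferentiableAt 𝓘(ℝ, E) 𝓘(ℝ, ℝ) χ 1 := by
  obtain ⟨d, q, k, A, hq, hA⟩ := exists_wordMap_coordinates hγ h hX
  choose c hc using fun j => (hγ j).exists_character_eq_exp hχ hχ0
  set Φ := wordMap γ q k (List.finRange d) with hΦ
  have hΦ0 : Φ 0 = 1 := wordMap_zero hγ _ _ _
  have hL := hA.to_localInverse
  have hLt := hA.localInverse_tendsto
  have hLr := hA.eventually_right_inverse
  set L := hA.localInverse with hLdef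
  simp only [hΦ0] at hL hLt hLr
  let f : E → ℝ := fun x => Real.exp (∑ i, L x i * c (k i))
  have hf : DifferentiableAt ℝ f (idChart E G 1) := by
    have h1 := hL.hasFDerivAt.differentiableAt
    have h2 : ∀ i, DifferentiableAt ℝ (fun x => L x i) (idChart E G 1) :=
      fun i => differentiableAt_pi.1 h1 i
    exact (DifferentiableAt.fun_sum fun i _ => (h2 i).mul_const _).exp
  have hΦt : Tendsto Φ (𝓝 0) (𝓝 1) := by
    have := (continuous_wordMap hγ q k (List.finRange d)).tendsto 0
    rwa [wordMap_zero hγ] at this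
  have heq : ∀ᶠ x in 𝓝 (idChart E G 1), χ ((idChart E G).symm x) = f x := by
    filter_upwards [hLr, (hΦt.comp hLt).eventually (eventually_idChart_symm_idChart E G)]
      with x hx hx'
    simp only [Function.comp] at hx'
    rw [hx] at hx'
    rw [hx', hΦ, character_wordMap hc, ← Fin.sum_univ_def]
  have h3 : (χ : G → ℝ) =ᶠ[𝓝 1] f ∘ idChart E G := by
    filter_upwards [(continuousAt_idChart E G).eventually heq,
      eventually_idChart_symm_idChart E G] with g hg hg'
    rw [hg'] at hg
    exact hg
  refine MDifferentiableAt.congr_of_eventuallyEq ?_ h3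
  exact hf.mdifferentiableAt.comp (1 : G)
    (mdifferentiableAt_idChart (mem_extChartAt_source (I := 𝓘(ℝ, E)) (1 : G)))

/-- A continuous positive character is an eigenfunction of the left-invariant fields. -/
lemma hasFlowDeriv_character (hγ : ∀ j, IsOneParam (γ j))
    (h : ∀ j, IsMIntegralCurve (I := 𝓘(ℝ, E)) (γ j) (mulInvariantVectorField (X j)))
    (hX : HormanderCondition X) (hχ : Continuous χ) (hχ0 : ∀ x, 0 < χ x) (j : Fin ℓ) :
    HasFlowDeriv (γ j) χ (fun x => lieDeriv (X j) χ 1 * χ x) := by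
  intro x
  have h1 := hasDerivAt_flow (hγ j) (h j) (mdifferentiableAt_character_one hγ h hX hχ hχ0)
  simp only [one_mul] at h1
  simpa only [map_mul, mul_comm (lieDeriv _ _ _)] using h1.const_mul (χ x)

end Character

/-! ### From distributional derivatives to derivatives along flows -/

section WeakGradient

section Flow

variable {G : Type*} [TopologicalSpace G] [Group G] [IsTopologicalGroup G] [T2Space G]
  [SecondCountableTopology G] [MeasurableSpace G] [BorelSpace G]
  {ρ : Measure G} [ρ.IsMulRightInvariant] [SFinite ρ]

lemma IsOneParam.measurable_mul {γ : ℝ → G} (hγ : IsOneParam γ) :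
    Measurable fun p : ℝ × G => p.2 * γ p.1 := by
  have := hγ.continuous
  exact (by fun_prop : Continuous fun p : ℝ × G => p.2 * γ p.1).measurable

/-- By right invariance the integral over `K` at each time is bounded by the integral over one fixed
compact set swept out of `K`. This licenses the use of Fubini below. -/
lemma integrable_prod_flow {γ : ℝ → G} (hγ : IsOneParam γ) {g : G → ℝ} (hg : Measurable g)
    (hgi : ∀ K, IsCompact K → IntegrableOn g K ρ) {K : Set G} (hK : IsCompact K) (t : ℝ) :
    Integrable (fun p : ℝ × G => g (p.2 * γ p.1)) ((volume.restrict (uIoc 0 t)).prod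
      (ρ.restrict K)) := by
  have hm : Measurable fun p : ℝ × G => g (p.2 * γ p.1) := hg.comp hγ.measurable_mul
  refine ⟨hm.aestronglyMeasurable, ?_⟩
  have hK' : IsCompact (K * γ '' uIcc 0 t) := hK.mul (isCompact_uIcc.image hγ.continuous)
  rw [hasFiniteIntegral_iff_enorm, lintegral_prod _ hm.enorm.aemeasurable]
  calc _ ≤ ∫⁻ _ in uIoc 0 t, (∫⁻ x in K * γ '' uIcc 0 t, ‖g x‖ₑ ∂ρ) := by
        refine setLIntegral_mono measurable_const fun s hs => ?_
        exact setLIntegral_mul_right_le (F := fun x => ‖g x‖ₑ) hK hK' (γ s) fun x hx =>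
          mul_mem_mul hx (mem_image_of_mem _ (uIoc_subset_uIcc hs))
    _ < ⊤ := by
        rw [setLIntegral_const]
        exact ENNReal.mul_lt_top (hgi _ hK').2 (by simp [uIoc])

end Flow

variable {E : Type*} [NormedAddCommGroup E] [NormedSpace ℝ E] [FiniteDimensional ℝ E]
  [CompleteSpace E] {G : Type*} [TopologicalSpace G] [ChartedSpace E G] [Group G]
  [LieGroup 𝓘(ℝ, E) ∞ G] [IsTopologicalGroup G] [T2Space G]
  [SecondCountableTopology G] [MeasurableSpace G] [BorelSpace G]
  {ρ : Measure G} [ρ.IsMulRightInvariant] [SFinite ρ]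
  {ℓ : ℕ} {X : Fin ℓ → GroupLieAlgebra 𝓘(ℝ, E) G}

lemma contMDiff_comp_mul_right {φ : G → ℝ} (hφ : ContMDiff 𝓘(ℝ, E) 𝓘(ℝ, ℝ) ∞ φ) (y : G) :
    ContMDiff 𝓘(ℝ, E) 𝓘(ℝ, ℝ) ∞ fun x => φ (x * y) :=
  hφ.comp contMDiff_mul_right

lemma hasCompactSupport_comp_mul_right {φ : G → ℝ} (hφ : HasCompactSupport φ) (y : G) :
    HasCompactSupport fun x => φ (x * y) :=
  hφ.comp_homeomorph (Homeomorph.mulRight y)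

/-- Testing the flow of a test function against a locally integrable function. -/
lemma hasDerivAt_integral_test {Y : GroupLieAlgebra 𝓘(ℝ, E) G} {γ : ℝ → G} (hγ : IsOneParam γ)
    (h : IsMIntegralCurve (I := 𝓘(ℝ, E)) γ (mulInvariantVectorField Y)) {F φ : G → ℝ}
    (hF : LocallyIntegrable F ρ) (hφ : ContMDiff 𝓘(ℝ, E) 𝓘(ℝ, ℝ) ∞ φ)
    (hφc : HasCompactSupport φ) (t : ℝ) :
    HasDerivAt (fun t => ∫ x, F x * φ (x * γ (-t)) ∂ρ)
      (-∫ x, F x * lieDeriv Y (fun x => φ (x * γ (-t))) x ∂ρ) t := by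
  set ψ : G → ℝ := fun x => φ (x * γ (-t)) with hψdef
  have hψ : ContMDiff 𝓘(ℝ, E) 𝓘(ℝ, ℝ) ∞ ψ := contMDiff_comp_mul_right hφ _
  have hψc : HasCompactSupport ψ := hasCompactSupport_comp_mul_right hφc _
  have hd : HasFlowDeriv γ ψ (lieDeriv Y ψ) :=
    hasFlowDeriv_lieDeriv hγ h (hψ.mdifferentiable (by simp))
  have h0 : ∀ x, x ∉ tsupport ψ → ψ x = 0 := fun x hx => image_eq_zero_of_notMem_tsupport hx
  have hcont' : Continuous (lieDeriv Y ψ) := continuous_lieDeriv Y (hψ.of_le (by simp))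
  have h0' : ∀ x, x ∉ tsupport ψ → lieDeriv Y ψ x = 0 :=
    fun x hx => hd.eq_zero_of_notMem hγ hψc.isCompact.isClosed h0 hx
  obtain ⟨B, hB⟩ := hψc.exists_bound_of_continuous hψ.continuous
  obtain ⟨B', hB'⟩ := (HasCompactSupport.intro hψc.isCompact h0').exists_bound_of_continuous hcont'
  have key := hasDerivAt_integral_mul_flow (ρ := ρ) hγ (F := F)
    (fun K hK => hF.integrableOn_isCompact hK) hψc.isCompact hψ.continuous.measurable h0 hd hB hB'
  rw [← sub_self t] at key
  have key2 := key.comp_sub_const t t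
  refine key2.congr_of_eventuallyEq (Eventually.of_forall fun s => ?_)
  refine integral_congr_ae (Eventually.of_forall fun x => ?_)
  simp only [hψdef]
  rw [mul_assoc, ← hγ.map_add]
  congr 3
  ring_nf

lemma locallyIntegrable_comp_mul_right {f : G → ℝ} (hf : LocallyIntegrable f ρ) (hfm : Measurable f)
    [LocallyCompactSpace G] (y : G) : LocallyIntegrable (fun x => f (x * y)) ρ := by
  rw [locallyIntegrable_iff]
  intro K hK
  have hK' : IsCompact (K * {y}) := hK.mul isCompact_singleton
  refine ⟨(hfm.comp (continuous_mul_const y).measurable).aestronglyMeasurable, ?_⟩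
  rw [hasFiniteIntegral_iff_enorm]
  exact (setLIntegral_mul_right_le (F := fun x => ‖f x‖ₑ) hK hK' y
    fun x hx => mul_mem_mul hx rfl).trans_lt (hf.integrableOn_isCompact hK').2

/-- A distributional derivative along a left-invariant field is a weak derivative along the
flow. -/
theorem IsWeakGradient.hasWeakFlowDeriv {f : G → ℝ} {g : Fin ℓ → G → ℝ}
    (hw : IsWeakGradient ρ X f g) (hf : Measurable f) (hg : ∀ j, Measurable (g j)) (j : Fin ℓ)
    {γ : ℝ → G} (hγ : IsOneParam γ)
    (h : IsMIntegralCurve (I := 𝓘(ℝ, E)) γ (mulInvariantVectorField (X j))) :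
    HasWeakFlowDeriv ρ γ f (g j) := by
  intro t
  have := Manifold.locallyCompact_of_finiteDimensional 𝓘(ℝ, E) (M := G)
  obtain ⟨hfi, hw⟩ := hw
  obtain ⟨hgi, hw⟩ := hw j
  have hgK : ∀ K, IsCompact K → IntegrableOn (g j) K ρ := fun K hK => hgi.integrableOn_isCompact hK
  have hft := locallyIntegrable_comp_mul_right hfi hf (γ t)
  refine ae_eq_of_integral_contMDiff_smul_eq 𝓘(ℝ, E) (hft.sub hfi) ?_ ?_
  · rw [locallyIntegrable_iff]
    intro K hK
    have h1 := (integrable_prod_flow hγ (hg j) hgK hK t).integral_prod_right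
    simp only [intervalIntegral.intervalIntegral_eq_integral_uIoc]
    exact Integrable.smul (if (0 : ℝ) ≤ t then (1 : ℝ) else -1) h1
  · intro φ hφ hφc
    have hder : ∀ s, HasDerivAt (fun t => ∫ x, f x * φ (x * γ (-t)) ∂ρ)
        (∫ x, g j x * φ (x * γ (-s)) ∂ρ) s := fun s => by
      have h1 := hasDerivAt_integral_test (ρ := ρ) hγ h hfi hφ hφc s
      rwa [hw _ (contMDiff_comp_mul_right hφ _) (hasCompactSupport_comp_mul_right hφc _),
        neg_neg] at h1
    have hcont : Continuous fun s => ∫ x, g j x * φ (x * γ (-s)) ∂ρ :=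
      continuous_iff_continuousAt.2 fun s =>
        (hasDerivAt_integral_test (ρ := ρ) hγ h hgi hφ hφc s).continuousAt
    -- The regular test function is moved instead of `f`. The fundamental theorem of calculus is
    -- applied to the pairing, and `htr` returns the translation to `f` and `g j`.
    have hFTC := intervalIntegral.integral_eq_sub_of_hasDerivAt (a := 0) (b := t)
      (fun s _ => hder s) (hcont.intervalIntegrable _ _)
    have htr : ∀ (F : G → ℝ) s, ∫ x, F x * φ (x * γ (-s)) ∂ρ = ∫ x, F (x * γ s) * φ x ∂ρ := by
      intro F s
      rw [← integral_mul_right_eq_self (fun x => F x * φ (x * γ (-s))) (γ s)]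
      simp only [mul_assoc, ← hγ.map_add, add_neg_cancel, hγ.map_zero, mul_one]
    simp only [htr] at hFTC
    rw [hγ.map_zero] at hFTC
    simp only [mul_one] at hFTC
    obtain ⟨B, hB⟩ := hφc.exists_bound_of_continuous hφ.continuous
    have hsupp : ∀ F : G → ℝ, ∫ x in tsupport φ, F x * φ x ∂ρ = ∫ x, F x * φ x ∂ρ := fun F =>
      setIntegral_eq_integral_of_forall_compl_eq_zero fun x hx => by
        rw [image_eq_zero_of_notMem_tsupport hx, mul_zero]
    have hint : Integrable (Function.uncurry fun (s : ℝ) (x : G) => g j (x * γ s) * φ x)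
        ((volume.restrict (uIoc 0 t)).prod (ρ.restrict (tsupport φ))) :=
      (integrable_prod_flow hγ (hg j) hgK hφc.isCompact t).mul_bdd (c := B)
        (hφ.continuous.comp continuous_snd).aestronglyMeasurable
        (Eventually.of_forall fun p => hB p.2)
    have hswap := intervalIntegral_integral_swap hint
    simp only [hsupp, hFTC] at hswap
    have hfφ : ∀ F : G → ℝ, LocallyIntegrable F ρ → Integrable (fun x => F x * φ x) ρ :=
      fun F hF => by
        simpa only [smul_eq_mul, mul_comm] using
          hF.integrable_smul_left_of_hasCompactSupport hφ.continuous hφc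
    have e1 : ∫ x, φ x • ((fun x => f (x * γ t)) - f) x ∂ρ =
        (∫ x, f (x * γ t) * φ x ∂ρ) - ∫ x, f x * φ x ∂ρ := by
      rw [← integral_sub (hfφ _ hft) (hfφ _ hfi)]
      refine integral_congr_ae (Eventually.of_forall fun x => ?_)
      simp only [Pi.sub_apply, smul_eq_mul]
      ring
    refine e1.trans (hswap.trans ?_)
    simp only [intervalIntegral.integral_mul_const]
    rw [hsupp fun x => ∫ s in (0 : ℝ)..t, g j (x * γ s)]
    simp only [smul_eq_mul, mul_comm]

lemma IsWeakGradient.congr {f f' : G → ℝ} {g g' : Fin ℓ → G → ℝ} (hw : IsWeakGradient ρ X f g)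
    (hf : f =ᵐ[ρ] f') (hg : ∀ j, g j =ᵐ[ρ] g' j) : IsWeakGradient ρ X f' g' := by
  refine ⟨hw.1.congr hf, fun j => ⟨(hw.2 j).1.congr (hg j), fun φ hφ hφc => ?_⟩⟩
  have h1 : ∫ x, f' x * lieDeriv (X j) φ x ∂ρ = ∫ x, f x * lieDeriv (X j) φ x ∂ρ :=
    integral_congr_ae (hf.mono fun x hx => by simp only [hx])
  have h2 : ∫ x, g' j x * φ x ∂ρ = ∫ x, g j x * φ x ∂ρ :=
    integral_congr_ae ((hg j).mono fun x hx => by simp only [hx])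
  rw [h1, h2]
  exact (hw.2 j).2 φ hφ hφc

end WeakGradient

/-! ### Relative compactness of Carnot–Carathéodory balls -/

section Balls

variable {E : Type*} [NormedAddCommGroup E] [NormedSpace ℝ E] [FiniteDimensional ℝ E]
  [CompleteSpace E] {G : Type*} [TopologicalSpace G] [ChartedSpace E G] [Group G]
  [LieGroup 𝓘(ℝ, E) ∞ G] [IsTopologicalGroup G] [T2Space G]
  {ℓ : ℕ} {X : Fin ℓ → GroupLieAlgebra 𝓘(ℝ, E) G}

variable (E G) in
/-- A smooth compactly supported nonnegative function that is `1` at the identity. -/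
lemma exists_contMDiff_bump : ∃ φ : G → ℝ, ContMDiff 𝓘(ℝ, E) 𝓘(ℝ, ℝ) ∞ φ ∧ HasCompactSupport φ ∧
    (∀ x, 0 ≤ φ x) ∧ φ 1 = 1 := by
  obtain ⟨φ⟩ : Nonempty (SmoothBumpFunction 𝓘(ℝ, E) (1 : G)) := inferInstance
  exact ⟨φ, φ.contMDiff, φ.hasCompactSupport, fun x => φ.nonneg, φ.eq_one⟩

lemma exists_bound_lieDeriv {φ : G → ℝ} (hφ : ContMDiff 𝓘(ℝ, E) 𝓘(ℝ, ℝ) 1 φ)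
    (hφc : HasCompactSupport φ) (Y : GroupLieAlgebra 𝓘(ℝ, E) G) :
    ∃ B, ∀ x, |lieDeriv Y φ x| ≤ B := by
  obtain ⟨γ, hγ, h⟩ := exists_isOneParam Y
  have hd := hasFlowDeriv_lieDeriv hγ h (hφ.mdifferentiable (by simp))
  have h0 : ∀ x, x ∉ tsupport φ → lieDeriv Y φ x = 0 := fun x hx =>
    hd.eq_zero_of_notMem hγ hφc.isCompact.isClosed
      (fun x hx => image_eq_zero_of_notMem_tsupport hx) hx
  exact (HasCompactSupport.intro hφc.isCompact h0).exists_bound_of_continuous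
    (continuous_lieDeriv Y hφ)

/-- Left invariance lets all left translates of a single bump function share the same bounds on
their horizontal derivatives. -/
lemma lieDeriv_comp_mul_left {φ : G → ℝ} (hφ : MDifferentiable 𝓘(ℝ, E) 𝓘(ℝ, ℝ) φ)
    (Y : GroupLieAlgebra 𝓘(ℝ, E) G) (y x : G) :
    lieDeriv Y (fun z => φ (y * z)) x = lieDeriv Y φ (y * x) := by
  obtain ⟨γ, hγ, h⟩ := exists_isOneParam Y
  have h1 : MDifferentiable 𝓘(ℝ, E) 𝓘(ℝ, ℝ) fun z => φ (y * z) :=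
    hφ.comp fun z => mdifferentiableAt_mul_left (E := E) y z
  have h2 := hasDerivAt_flow hγ h (h1 x)
  have h3 := hasDerivAt_flow hγ h (hφ (y * x))
  simp only [mul_assoc] at h3
  exact h2.unique h3

lemma HasMFDerivAt.hasDerivAt_comp_horizontal {γ : ℝ → G} {t : ℝ} {α : Fin ℓ → ℝ}
    (h : HasMFDerivAt 𝓘(ℝ, ℝ) 𝓘(ℝ, E) γ t
      ((1 : ℝ →L[ℝ] ℝ).smulRight (∑ j, α j • mulInvariantVectorField (X j) (γ t))))
    {u : G → ℝ} (hu : MDifferentiableAt 𝓘(ℝ, E) 𝓘(ℝ, ℝ) u (γ t)) :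
    HasDerivAt (fun s => u (γ s)) (∑ j, α j * lieDeriv (X j) u (γ t)) t := by
  have h2 := hu.hasMFDerivAt.comp t h
  have h3 : HasDerivAt (fun s => u (γ s)) (mfderiv 𝓘(ℝ, E) 𝓘(ℝ, ℝ) u (γ t)
      (∑ j, α j • mulInvariantVectorField (X j) (γ t))) t :=
    hasDerivAt_of_comp_smulRight (F := E) (F' := ℝ) (f := fun s => u (γ s))
      (A := mfderiv 𝓘(ℝ, E) 𝓘(ℝ, ℝ) u (γ t))
      (w := ∑ j, α j • mulInvariantVectorField (X j) (γ t)) h2.hasFDerivAt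
  refine h3.congr_deriv ?_
  obtain ⟨D, hD⟩ : ∃ D : E →L[ℝ] ℝ, D = mfderiv 𝓘(ℝ, E) 𝓘(ℝ, ℝ) u (γ t) := ⟨_, rfl⟩
  have h4 : ∀ V : Fin ℓ → E, D (∑ j, α j • V j) = ∑ j, α j * D (V j) := fun V => by
    simp only [map_sum, map_smul, smul_eq_mul]
  have h5 := h4 fun j => mulInvariantVectorField (X j) (γ t)
  rw [hD] at h5
  exact h5

/-- A smooth function with horizontal derivatives bounded by `B` varies along a subunit curve at
speed at most `∑ j, B j`. -/
lemma IsSubunitCurve.abs_sub_le {T : ℝ} {γ : ℝ → G} (hγ : IsSubunitCurve X T γ) {u : G → ℝ}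
    (hu : ContMDiff 𝓘(ℝ, E) 𝓘(ℝ, ℝ) ∞ u) {B : Fin ℓ → ℝ} (hB : ∀ j x, |lieDeriv (X j) u x| ≤ B j)
    {s t : ℝ} (hs : s ∈ Icc 0 T) (ht : t ∈ Icc 0 T) :
    |u (γ t) - u (γ s)| ≤ (∑ j, B j) * |t - s| := by
  have hT : 0 ≤ T := hs.1.trans hs.2
  obtain ⟨α, -, hα⟩ := hγ.velocity
  have hac : AbsolutelyContinuousOnInterval (fun t => u (γ t)) s t :=
    (hγ.absolutelyContinuous u hu).mono (by
      rw [uIcc_of_le hT]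
      exact uIcc_subset_Icc hs ht)
  rw [← hac.integral_deriv_eq_sub, ← Real.norm_eq_abs]
  refine intervalIntegral.norm_integral_le_of_norm_le_const_ae ?_
  rw [Measure.restrict_congr_set Ioo_ae_eq_Icc, ae_restrict_iff' measurableSet_Icc] at hα
  filter_upwards [hα] with r hr hrm
  have hrI : r ∈ Icc 0 T := uIcc_subset_Icc hs ht (uIoc_subset_uIcc hrm)
  obtain ⟨h1, h2⟩ := hr hrI
  rw [(HasMFDerivAt.hasDerivAt_comp_horizontal h2
    (hu.mdifferentiable (by simp) (γ r))).deriv]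
  refine (norm_sum_le _ _).trans (Finset.sum_le_sum fun j _ => ?_)
  have h3 : α r j ^ 2 ≤ 1 :=
    (Finset.single_le_sum (f := fun j => α r j ^ 2) (fun i _ => sq_nonneg _)
      (Finset.mem_univ j)).trans h1
  have h4 : |α r j| ≤ 1 := (sq_le_one_iff_abs_le_one _).1 h3
  rw [Real.norm_eq_abs, abs_mul]
  calc _ ≤ 1 * B j := mul_le_mul h4 (hB j _) (abs_nonneg _) zero_le_one
    _ = B j := one_mul _

/-- Carnot–Carathéodory balls are relatively compact. -/
theorem exists_isCompact_ccBall_subset (X : Fin ℓ → GroupLieAlgebra 𝓘(ℝ, E) G) (R : ℝ) :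
    ∃ K, IsCompact K ∧ ccBall X R ⊆ K := by
  obtain ⟨φ, hφ, hφc, -, hφ1⟩ := exists_contMDiff_bump E G
  choose B hB using fun j => exists_bound_lieDeriv (hφ.of_le (by simp)) hφc (X j)
  have hB0 : 0 ≤ ∑ j, B j := Finset.sum_nonneg fun j _ => (abs_nonneg _).trans (hB j 1)
  -- The curve is cut into `n` pieces so short that the bump, translated to the start of a piece,
  -- varies by less than `1` along it and cannot reach `0`.
  obtain ⟨n, hn⟩ := exists_nat_gt ((∑ j, B j) * |R|)
  have hn0 : (0 : ℝ) < n := (mul_nonneg hB0 (abs_nonneg R)).trans_lt hn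
  refine ⟨tsupport φ ^ n, isCompact_pow hφc.isCompact n, fun x hx => ?_⟩
  simp only [ccBall, ccDist, mem_ofPred_eq, iInf_lt_iff] at hx
  obtain ⟨T, ⟨γ, hγ, rfl, hγT⟩, hT⟩ := hx
  have hTR : (T : ℝ) ≤ |R| := by
    have h1 : ENNReal.ofReal T < ENNReal.ofReal R := by simpa using hT
    exact ((ENNReal.ofReal_lt_ofReal_iff_of_nonneg T.2).1 h1).le.trans (le_abs_self R)
  have step : ∀ s ∈ Icc (0 : ℝ) T, ∀ t ∈ Icc (0 : ℝ) T, (∑ j, B j) * |t - s| < 1 →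
      γ t ∈ {γ s} * tsupport φ := by
    intro s hs t ht hst
    have h1 := hγ.abs_sub_le (u := fun z => φ ((γ s)⁻¹ * z)) (hφ.comp contMDiff_mul_left) (B := B)
      (fun j x => by
        rw [lieDeriv_comp_mul_left (hφ.mdifferentiable (by simp))]
        exact hB j _) hs ht
    rw [inv_mul_cancel, hφ1] at h1
    refine ⟨γ s, rfl, (γ s)⁻¹ * γ t, subset_tsupport _ fun h0 => ?_, by simp⟩
    rw [h0] at h1
    norm_num at h1
    linarith
  -- The curve ends at the identity and is followed backwards; each piece contributes one factor
  -- `tsupport φ`.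
  have main : ∀ i : ℕ, i ≤ n → γ (T - i * (T / n)) ∈ tsupport φ ^ i := by
    intro i
    induction i with
    | zero => intro _; simp [hγT]
    | succ i ih =>
      intro hi
      have hmem : ∀ k : ℕ, k ≤ n → (T : ℝ) - k * (T / n) ∈ Icc (0 : ℝ) T := fun k hk => by
        have h2 : (k : ℝ) * (T / n) ≤ T := by
          calc (k : ℝ) * (T / n) ≤ n * (T / n) := by gcongr
            _ = T := by field_simp
        have h3 : 0 ≤ (k : ℝ) * (T / n) := by positivity
        constructor <;> linarith
      have h4 := step _ (hmem i (by omega)) _ (hmem (i + 1) hi) ?_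
      · rw [pow_succ]
        exact mul_subset_mul_right (singleton_subset_iff.2 (ih (by omega))) h4
      · have e : (T : ℝ) - ((i + 1 : ℕ) : ℝ) * (T / n) - (T - i * (T / n)) = -(T / n) := by
          push_cast
          ring
        rw [e, abs_neg, abs_of_nonneg (by positivity), ← mul_div_assoc, div_lt_one hn0]
        exact (mul_le_mul_of_nonneg_left hTR hB0).trans_lt hn
  have h5 := main n le_rfl
  rwa [mul_div_cancel₀ _ hn0.ne', sub_self] at h5

end Balls

/-! ### Application to Lie groups and the chain rule for the exponential -/

section Main

variable {E : Type*} [NormedAddCommGroup E] [NormedSpace ℝ E] [FiniteDimensional ℝ E]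
  [CompleteSpace E] {G : Type*} [TopologicalSpace G] [ChartedSpace E G] [Group G]
  [LieGroup 𝓘(ℝ, E) ∞ G] [IsTopologicalGroup G] [T2Space G]
  {ℓ : ℕ} {X : Fin ℓ → GroupLieAlgebra 𝓘(ℝ, E) G}

lemma isFlowPotential_of_contMDiff [ConnectedSpace G] {γ : Fin ℓ → ℝ → G}
    (hγ : ∀ j, IsOneParam (γ j))
    (h : ∀ j, IsMIntegralCurve (I := 𝓘(ℝ, E)) (γ j) (mulInvariantVectorField (X j)))
    (hX : HormanderCondition X) {χ : G →* ℝ} (hχ : Continuous χ) (hχ0 : ∀ x, 0 < χ x)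
    {v : G → ℝ} (hv : ContMDiff 𝓘(ℝ, E) 𝓘(ℝ, ℝ) 2 v) :
    IsFlowPotential γ χ (fun j => lieDeriv (X j) χ 1) v (fun j => lieDeriv (X j) v)
      (fun j => lieDeriv (X j) (lieDeriv (X j) v)) := by
  have hv1 : ContMDiff 𝓘(ℝ, E) 𝓘(ℝ, ℝ) 1 v := hv.of_le one_le_two
  have hv' : ∀ j, ContMDiff 𝓘(ℝ, E) 𝓘(ℝ, ℝ) 1 (lieDeriv (X j) v) := fun j =>
    contMDiff_lieDeriv (X j) hv (by norm_num [one_add_one_eq_two]) le_rfl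
  exact
    { oneParam := hγ
      generates := generates_of_hormanderCondition hγ h hX
      pos := hχ0
      continuous_χ := hχ
      deriv_χ := hasFlowDeriv_character hγ h hX hχ hχ0
      continuous := hv.continuous
      continuous_deriv := fun j => (hv' j).continuous
      continuous_deriv₂ := fun j => continuous_lieDeriv (X j) (hv' j)
      deriv := fun j => hasFlowDeriv_lieDeriv (hγ j) (h j) (hv1.mdifferentiable (by simp))
      deriv₂ := fun j => hasFlowDeriv_lieDeriv (hγ j) (h j) ((hv' j).mdifferentiable (by simp)) }

lemma exists_isCutoffSequence_lieGroup [ConnectedSpace G] [SecondCountableTopology G]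
    [MeasurableSpace G] [BorelSpace G] {γ : Fin ℓ → ℝ → G} (hγ : ∀ j, IsOneParam (γ j))
    (h : ∀ j, IsMIntegralCurve (I := 𝓘(ℝ, E)) (γ j) (mulInvariantVectorField (X j)))
    (hX : HormanderCondition X) : ∃ η η' δ, IsCutoffSequence γ η η' δ := by
  have := Manifold.locallyCompact_of_finiteDimensional 𝓘(ℝ, E) (M := G)
  obtain ⟨ψ, hψ, hψc, hψ0, hψ1⟩ := exists_contMDiff_bump E G
  exact exists_isCutoffSequence hγ (generates_of_hormanderCondition hγ h hX) hψ.continuous hψc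
    hψ0 (hψ1 ▸ one_pos) (fun j => continuous_lieDeriv (X j) (hψ.of_le (by simp)))
    fun j => hasFlowDeriv_lieDeriv (hγ j) (h j) (hψ.mdifferentiable (by simp))

lemma lieDeriv_exp_const_mul_sub {u : G → ℝ} (hu : MDifferentiable 𝓘(ℝ, E) 𝓘(ℝ, ℝ) u)
    (Y : GroupLieAlgebra 𝓘(ℝ, E) G) (β m : ℝ) (x : G) :
    lieDeriv Y (fun x => Real.exp (β * (u x - m))) x =
      β * Real.exp (β * (u x - m)) * lieDeriv Y u x := by
  obtain ⟨γ, hγ, h⟩ := exists_isOneParam Y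
  have h1 : MDifferentiable 𝓘(ℝ, E) 𝓘(ℝ, ℝ) fun x => Real.exp (β * (u x - m)) :=
    (by fun_prop : Differentiable ℝ fun s : ℝ => Real.exp (β * (s - m))).mdifferentiable.comp hu
  have h2 := hasDerivAt_flow hγ h (h1 x)
  have h3 := (((hasDerivAt_flow hγ h (hu x)).sub_const m).const_mul β).exp
  rw [hγ.map_zero, mul_one] at h3
  rw [h2.unique h3]
  ring

lemma lieDeriv_mul {u w : G → ℝ} (hu : MDifferentiable 𝓘(ℝ, E) 𝓘(ℝ, ℝ) u)
    (hw : MDifferentiable 𝓘(ℝ, E) 𝓘(ℝ, ℝ) w) (Y : GroupLieAlgebra 𝓘(ℝ, E) G) (x : G) :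
    lieDeriv Y (fun x => u x * w x) x = lieDeriv Y u x * w x + u x * lieDeriv Y w x := by
  obtain ⟨γ, hγ, h⟩ := exists_isOneParam Y
  have h1 : MDifferentiable 𝓘(ℝ, E) 𝓘(ℝ, ℝ) fun x => u x * w x := hu.mul hw
  have h2 := hasDerivAt_flow hγ h (h1 x)
  have h3 := (hasDerivAt_flow hγ h (hu x)).mul (hasDerivAt_flow hγ h (hw x))
  rw [hγ.map_zero, mul_one] at h3
  exact h2.unique h3

lemma lieDeriv_neg {u : G → ℝ} (hu : MDifferentiable 𝓘(ℝ, E) 𝓘(ℝ, ℝ) u)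
    (Y : GroupLieAlgebra 𝓘(ℝ, E) G) (x : G) :
    lieDeriv Y (fun x => -u x) x = -lieDeriv Y u x := by
  obtain ⟨γ, hγ, h⟩ := exists_isOneParam Y
  exact (hasDerivAt_flow hγ h (hu.neg x)).unique (hasDerivAt_flow hγ h (hu x)).neg

/-- The weighted Laplacian of `exp (β (v - m))`. -/
lemma neg_weightedLaplacian_exp {v M χ : G → ℝ} (hv : ContMDiff 𝓘(ℝ, E) 𝓘(ℝ, ℝ) 2 v)
    (hM : ∀ x, Real.log (M x) = -v x) (β m : ℝ) (x : G) :
    -weightedLaplacian X χ M (fun x => Real.exp (β * (v x - m))) x =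
      -(β * Real.exp (β * (v x - m)) * ((1 - β) * gradSq X v x + subLaplacian X χ v x)) := by
  have hv1 : MDifferentiable 𝓘(ℝ, E) 𝓘(ℝ, ℝ) v := hv.mdifferentiable (by simp)
  have hv' : ∀ j, MDifferentiable 𝓘(ℝ, E) 𝓘(ℝ, ℝ) (lieDeriv (X j) v) := fun j =>
    (contMDiff_lieDeriv (X j) hv (m := 1) (by norm_num [one_add_one_eq_two]) le_rfl).mdifferentiable
      (by simp)
  have hw : MDifferentiable 𝓘(ℝ, E) 𝓘(ℝ, ℝ) fun x => β * Real.exp (β * (v x - m)) :=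
    (by fun_prop : Differentiable ℝ fun s : ℝ =>
      β * Real.exp (β * (s - m))).mdifferentiable.comp hv1
  have e1 : ∀ j, lieDeriv (X j) (fun x => Real.exp (β * (v x - m))) =
      fun x => β * Real.exp (β * (v x - m)) * lieDeriv (X j) v x := fun j =>
    funext fun x => lieDeriv_exp_const_mul_sub hv1 (X j) β m x
  have e2 : ∀ j, lieDeriv (X j) (fun x => β * Real.exp (β * (v x - m))) x =
      β * (β * Real.exp (β * (v x - m)) * lieDeriv (X j) v x) := fun j => by
    have h1 : MDifferentiable 𝓘(ℝ, E) 𝓘(ℝ, ℝ) fun x => Real.exp (β * (v x - m)) :=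
      (by fun_prop : Differentiable ℝ fun s : ℝ =>
        Real.exp (β * (s - m))).mdifferentiable.comp hv1
    obtain ⟨γ, hγ, h⟩ := exists_isOneParam (X j)
    rw [(hasDerivAt_flow hγ h (hw x)).unique ((hasDerivAt_flow hγ h (h1 x)).const_mul β), e1]
  have e3 : ∀ j, lieDeriv (X j) (fun y => Real.log (M y)) x = -lieDeriv (X j) v x := fun j => by
    simp only [hM]
    exact lieDeriv_neg hv1 (X j) x
  -- With `W` the exponential, differentiating twice produces `β² W |∇v|²` and the drift from `M`
  -- produces `-β W |∇v|²`; together they give the coefficient `1 - β`.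
  simp only [weightedLaplacian, subLaplacian, gradInner, gradSq, e1, e3, lieDeriv_mul hw (hv' _),
    e2]
  rw [sub_eq_add_neg, ← Finset.sum_neg_distrib, ← Finset.sum_neg_distrib, ← Finset.sum_neg_distrib,
    ← Finset.sum_add_distrib, ← Finset.sum_neg_distrib, Finset.mul_sum, ← Finset.sum_add_distrib,
    Finset.mul_sum, ← Finset.sum_neg_distrib]
  refine Finset.sum_congr rfl fun j _ => ?_
  ring

end Main

/-! ### The mean as the best constant in `L²` -/

section L2

variable {α : Type*} [MeasurableSpace α] {μ : Measure α} {u : α → ℝ}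

lemma eLpNorm_two_eq_ofReal_sqrt (hu : MemLp u 2 μ) :
    eLpNorm u 2 μ = ENNReal.ofReal (√(∫ x, u x ^ 2 ∂μ)) := by
  rw [hu.eLpNorm_eq_integral_rpow_norm (by simp) (by simp), Real.sqrt_eq_rpow]
  simp

lemma integral_sub_average_sq_le [IsFiniteMeasure μ] (hu : MemLp u 2 μ) (m : ℝ) :
    ∫ x, (u x - ⨍ y, u y ∂μ) ^ 2 ∂μ ≤ ∫ x, (u x - m) ^ 2 ∂μ := by
  have hui : Integrable u μ := hu.integrable one_le_two
  set A := ⨍ y, u y ∂μ with hA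
  have h1 : Integrable (fun x => (u x - A) ^ 2) μ := (hu.sub (memLp_const A)).integrable_sq
  have h2 : Integrable (fun x => 2 * (A - m) * (u x - A)) μ :=
    (hui.sub (integrable_const A)).const_mul _
  have h3 : ∫ x, (u x - A) ∂μ = 0 := integral_sub_average μ u
  have e : ∀ x, (u x - m) ^ 2 = (u x - A) ^ 2 + 2 * (A - m) * (u x - A) + (A - m) ^ 2 :=
    fun x => by ring
  simp only [e]
  have h5 := integral_add (h1.add h2) (integrable_const ((A - m) ^ 2))
  simp only [Pi.add_apply] at h5
  rw [h5, integral_add h1 h2, integral_const_mul, h3, integral_const]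
  have h4 : 0 ≤ μ.real univ • (A - m) ^ 2 := smul_nonneg measureReal_nonneg (sq_nonneg _)
  linarith

end L2

/-! ### Integrals against measures with density -/

section Weighted

variable {G : Type*} [MeasurableSpace G] {ρ : Measure G} {χ M : G → ℝ}

lemma weightedMeasure_eq (hχ : Measurable χ) (hχ0 : ∀ x, 0 < χ x) (hM : Measurable M) :
    weightedMeasure ρ χ M = ρ.withDensity fun x => ENNReal.ofReal (χ x * M x) := by
  rw [weightedMeasure, charMeasure, ← withDensity_mul _ hχ.ennreal_ofReal hM.ennreal_ofReal]
  congr 1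
  ext x
  simp [ENNReal.ofReal_mul (hχ0 x).le]

lemma integrable_withDensity_ofReal_iff {w : G → ℝ} (hw : Measurable w) (hw0 : ∀ x, 0 < w x)
    (f : G → ℝ) : Integrable f (ρ.withDensity fun x => ENNReal.ofReal (w x)) ↔
      Integrable (fun x => w x * f x) ρ := by
  rw [integrable_withDensity_iff_integrable_smul' hw.ennreal_ofReal
    (Eventually.of_forall fun x => ENNReal.ofReal_lt_top)]
  simp only [ENNReal.toReal_ofReal (hw0 _).le, smul_eq_mul]

lemma integral_withDensity_ofReal {w : G → ℝ} (hw : Measurable w) (hw0 : ∀ x, 0 < w x)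
    (f : G → ℝ) : ∫ x, f x ∂(ρ.withDensity fun x => ENNReal.ofReal (w x)) =
      ∫ x, w x * f x ∂ρ := by
  rw [integral_withDensity_eq_integral_toReal_smul hw.ennreal_ofReal
    (Eventually.of_forall fun x => ENNReal.ofReal_lt_top)]
  simp only [ENNReal.toReal_ofReal (hw0 _).le, smul_eq_mul]

end Weighted

/-! ### The Lyapunov function and the global Poincaré inequality -/

variable {E : Type*} [NormedAddCommGroup E] [NormedSpace ℝ E] [FiniteDimensional ℝ E]
  [CompleteSpace E] {G : Type*} [TopologicalSpace G] [ChartedSpace E G] [Group G]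
  [LieGroup 𝓘(ℝ, E) ∞ G] [IsTopologicalGroup G] [T2Space G]
  {ℓ : ℕ} {X : Fin ℓ → GroupLieAlgebra 𝓘(ℝ, E) G}

/-- Under the Lyapunov condition off a ball, an exponential of the potential is a Lyapunov
function. -/
theorem isLyapunovFunction_exp {χ M v : G → ℝ} (hv : ContMDiff 𝓘(ℝ, E) 𝓘(ℝ, ℝ) 2 v)
    (hM : ∀ x, Real.log (M x) = -v x) (hbdd : BddBelow (range v)) {a κ R : ℝ} (ha : a < 1)
    (hκ : 0 < κ) (hR : 0 < R)
    (h : ∀ x, x ∉ ccBall X R → κ ≤ a * gradSq X v x + subLaplacian X χ v x) :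
    IsLyapunovFunction X χ M (fun x => Real.exp ((1 - a) * (v x - ⨅ y, v y))) := by
  have hβ : 0 < 1 - a := sub_pos.2 ha
  set m := ⨅ y, v y with hm
  have hv' : ∀ j, ContMDiff 𝓘(ℝ, E) 𝓘(ℝ, ℝ) 1 (lieDeriv (X j) v) := fun j =>
    contMDiff_lieDeriv (X j) hv (by norm_num [one_add_one_eq_two]) le_rfl
  have hc1 : ∀ j, Continuous (lieDeriv (X j) v) := fun j => (hv' j).continuous
  have hc2 : ∀ j, Continuous (lieDeriv (X j) (lieDeriv (X j) v)) :=
    fun j => continuous_lieDeriv (X j) (hv' j)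
  have hcv := hv.continuous
  set Q : G → ℝ := fun x => a * gradSq X v x + subLaplacian X χ v x with hQ
  have hQc : Continuous Q := by
    simp only [hQ, gradSq, subLaplacian]
    fun_prop
  set W : G → ℝ := fun x => Real.exp ((1 - a) * (v x - m)) with hW
  have hWc : Continuous W := by
    simp only [hW]
    fun_prop
  obtain ⟨K, hK, hRK⟩ := exists_isCompact_ccBall_subset X R
  obtain ⟨b, hb⟩ := hK.exists_bound_of_continuousOn
    (f := fun x => (1 - a) * W x * (κ - Q x)) (by fun_prop)
  -- For `β = 1 - a` the operator `-Δ_{χ,M}` maps `W` to `-(1 - a) W Q`. This gives the rate `(1 -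
  -- a) κ` off the ball; on the ball the excess `(1 - a) W (κ - Q)` is at most `b`, by continuity on
  -- a compact superset.
  refine ⟨?_, fun x => ?_, (1 - a) * κ, max b 0, R, mul_pos hβ hκ, le_max_right _ _, hR,
    fun x => ?_⟩
  · exact (by fun_prop : ContDiff ℝ 2 fun s : ℝ =>
      Real.exp ((1 - a) * (s - m))).contMDiff.comp hv
  · exact Real.one_le_exp (mul_nonneg hβ.le (sub_nonneg.2 (ciInf_le hbdd x)))
  · rw [neg_weightedLaplacian_exp hv hM, sub_sub_cancel]
    have hW0 : 0 < W x := Real.exp_pos _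
    by_cases hx : x ∈ ccBall X R
    · have h1 := (le_abs_self _).trans (hb x (hRK hx))
      have h2 := le_max_left b 0
      simp only [hx, indicator_of_mem, Pi.one_apply, mul_one]
      change -((1 - a) * W x * Q x) ≤ -((1 - a) * κ) * W x + max b 0
      linarith
    · have h1 := mul_le_mul_of_nonneg_left (h x hx) (mul_pos hβ hW0).le
      simp only [hx, not_false_eq_true, indicator_of_notMem, mul_zero, add_zero]
      change -((1 - a) * W x * Q x) ≤ -((1 - a) * κ) * W x
      simp only [hQ]
      linarith

variable [SecondCountableTopology G] [ConnectedSpace G] [MeasurableSpace G] [BorelSpace G]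
  {ρ : Measure G} [ρ.IsMulRightInvariant]

/-- The global Poincaré inequality in `L²(μ_{χ,M})`, from the corresponding inequality along the
flows. -/
theorem globalPoincare_of_flow [SFinite ρ] {γ : Fin ℓ → ℝ → G} (hγ : ∀ j, IsOneParam (γ j))
    (h : ∀ j, IsMIntegralCurve (I := 𝓘(ℝ, E)) (γ j) (mulInvariantVectorField (X j)))
    {χ M : G → ℝ} (hχ : Measurable χ) (hχ0 : ∀ x, 0 < χ x) (hM : Measurable M) (hM0 : ∀ x, 0 < M x)
    (hint : Integrable (fun x => χ x * M x) ρ) {C : ℝ} (hC : 0 ≤ C)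
    (hP : ∀ (f : G → ℝ) (g : Fin ℓ → G → ℝ), Measurable f → (∀ j, Measurable (g j)) →
      (∀ j, HasWeakFlowDeriv ρ (γ j) f (g j)) →
      Integrable (fun x => χ x * M x * f x ^ 2) ρ →
      (∀ j, Integrable (fun x => χ x * M x * g j x ^ 2) ρ) →
      ∃ m : ℝ, ∫ x, χ x * M x * (f x - m) ^ 2 ∂ρ ≤
        C * ∫ x, χ x * M x * ∑ j, g j x ^ 2 ∂ρ) : GlobalPoincare ρ X χ M := by
  have hμ := weightedMeasure_eq (ρ := ρ) hχ hχ0 hM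
  have hw : Measurable fun x => χ x * M x := hχ.mul hM
  have hw0 : ∀ x, 0 < χ x * M x := fun x => mul_pos (hχ0 x) (hM0 x)
  refine ⟨(√C).toNNReal, fun f g hf hw' hg => ?_⟩
  have hfρ := hw'.1.aestronglyMeasurable.aemeasurable
  have hgρ : ∀ j, AEMeasurable (g j) ρ := fun j =>
    (hw'.2 j).1.aestronglyMeasurable.aemeasurable
  set μ := weightedMeasure ρ χ M with hμdef
  have hac : μ ≪ ρ := by
    rw [hμ]
    exact withDensity_absolutelyContinuous _ _
  have hfin : IsFiniteMeasure μ := by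
    rw [hμ]
    exact isFiniteMeasure_withDensity_ofReal hint.2
  -- Flow derivatives compose functions with translations, so `f` and `g` are replaced by Borel
  -- representatives; every quantity involved is unchanged because `μ ≪ ρ`.
  set f' := hfρ.mk f with hf'
  set g' : Fin ℓ → G → ℝ := fun j => (hgρ j).mk (g j) with hg'
  have hff' : f =ᵐ[ρ] f' := hfρ.ae_eq_mk
  have hgg' : ∀ j, g j =ᵐ[ρ] g' j := fun j => (hgρ j).ae_eq_mk
  have hf'm : Measurable f' := hfρ.measurable_mk
  have hg'm : ∀ j, Measurable (g' j) := fun j => (hgρ j).measurable_mk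
  have hwg := hw'.congr hff' hgg'
  have hfμ : f =ᵐ[μ] f' := hac.ae_le hff'
  have hN : gradNorm g =ᵐ[μ] gradNorm g' := by
    have : ∀ᵐ x ∂μ, ∀ j, g j x = g' j x := ae_all_iff.2 fun j => hac.ae_le (hgg' j)
    filter_upwards [this] with x hx
    simp only [gradNorm, hx]
  have hf2 : MemLp f' 2 μ := (memLp_congr_ae hfμ).1 hf
  have hg2 : MemLp (gradNorm g') 2 μ := (memLp_congr_ae hN).1 hg
  have hg2j : ∀ j, MemLp (g' j) 2 μ := fun j =>
    hg2.mono (hg'm j).aestronglyMeasurable (Eventually.of_forall fun x => by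
      rw [Real.norm_eq_abs, gradNorm, Real.norm_of_nonneg (Real.sqrt_nonneg _)]
      exact Real.abs_le_sqrt (Finset.single_le_sum (f := fun j => g' j x ^ 2)
        (fun i _ => sq_nonneg _) (Finset.mem_univ j)))
  obtain ⟨m, hm⟩ := hP f' g' hf'm hg'm (fun j => hwg.hasWeakFlowDeriv hf'm hg'm j (hγ j) (h j))
    ((integrable_withDensity_ofReal_iff hw hw0 _).1 (hμ ▸ hf2.integrable_sq))
    (fun j => (integrable_withDensity_ofReal_iff hw hw0 _).1 (hμ ▸ (hg2j j).integrable_sq))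
  have e1 : ∫ x, (f' x - m) ^ 2 ∂μ = ∫ x, χ x * M x * (f' x - m) ^ 2 ∂ρ := by
    rw [hμ, integral_withDensity_ofReal hw hw0]
  have e2 : ∫ x, gradNorm g' x ^ 2 ∂μ = ∫ x, χ x * M x * ∑ j, g' j x ^ 2 ∂ρ := by
    rw [hμ, integral_withDensity_ofReal hw hw0]
    simp only [gradNorm, Real.sq_sqrt (Finset.sum_nonneg fun j _ => sq_nonneg (g' j _))]
  have hav : ⨍ y, f y ∂μ = ⨍ y, f' y ∂μ := average_congr hfμ
  have hsub : (fun x => f x - ⨍ y, f y ∂μ) =ᵐ[μ] fun x => f' x - ⨍ y, f' y ∂μ := by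
    filter_upwards [hfμ] with x hx
    rw [hx, hav]
  have hfA : MemLp (fun x => f' x - ⨍ y, f' y ∂μ) 2 μ := hf2.sub (memLp_const _)
  rw [eLpNorm_congr_ae hsub, eLpNorm_congr_ae hN,
    eLpNorm_two_eq_ofReal_sqrt hfA, eLpNorm_two_eq_ofReal_sqrt hg2]
  rw [← ENNReal.ofReal, ← ENNReal.ofReal_mul (Real.sqrt_nonneg C), ← Real.sqrt_mul hC]
  refine ENNReal.ofReal_le_ofReal (Real.sqrt_le_sqrt ?_)
  rw [e2]
  exact (integral_sub_average_sq_le hf2 m).trans (e1.trans_le hm)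

end SubRiemannianLie

theorem mainTheorem5 {E : Type*} [NormedAddCommGroup E] [NormedSpace ℝ E] [FiniteDimensional ℝ E]
    {G : Type*} [TopologicalSpace G] [ChartedSpace E G] [Group G] [LieGroup 𝓘(ℝ, E) ∞ G]
    [T2Space G] [SecondCountableTopology G] [ConnectedSpace G] [NoncompactSpace G]
    [MeasurableSpace G] [BorelSpace G]
    (ρ : Measure G) [ρ.IsMulRightInvariant] [IsFiniteMeasureOnCompacts ρ] [ρ.IsOpenPosMeasure]
    (χ : G →* ℝ) (hχ_cont : Continuous χ) (hχ_pos : ∀ x, 0 < χ x)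
    {ℓ : ℕ} (X : Fin ℓ → GroupLieAlgebra 𝓘(ℝ, E) G) (hX_indep : LinearIndependent ℝ X)
    (hX : SubRiemannianLie.HormanderCondition X)
    (M : G → ℝ) (hM_pos : ∀ x, 0 < M x) (hM_smooth : ContMDiff 𝓘(ℝ, E) 𝓘(ℝ, ℝ) 2 M)
    (hM_int : Integrable M (SubRiemannianLie.charMeasure ρ χ))
    (v : G → ℝ) (hv : ∀ x, v x = -Real.log (M x))
    (a c R : ℝ) (ha : a ∈ Ioo (0 : ℝ) 1) (hc : 0 < c) (hR : 0 < R)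
    (h : ∀ x, x ∉ SubRiemannianLie.ccBall X R →
      c ≤ a * SubRiemannianLie.gradSq X v x + SubRiemannianLie.subLaplacian X χ v x) :
    BddBelow (range v) ∧
      SubRiemannianLie.IsLyapunovFunction X χ M
        (fun x => Real.exp ((1 - a) * (v x - ⨅ y, v y))) ∧
      SubRiemannianLie.AdmitsLyapunovFunction X χ M ∧
      SubRiemannianLie.GlobalPoincare ρ X χ M := by
  have hcomp : CompleteSpace E := FiniteDimensional.complete ℝ E
  have hG : IsTopologicalGroup G := topologicalGroup_of_lieGroup 𝓘(ℝ, E) ∞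
  have hlc : LocallyCompactSpace G := Manifold.locallyCompact_of_finiteDimensional 𝓘(ℝ, E)
  choose γ hγ hγX using fun j => SubRiemannianLie.exists_isOneParam (X j)
  have hMv : ∀ x, Real.log (M x) = -v x := fun x => by rw [hv, neg_neg]
  have hMexp : ∀ x, Real.exp (-v x) = M x := fun x => by rw [← hMv, Real.exp_log (hM_pos x)]
  have hv2 : ContMDiff 𝓘(ℝ, E) 𝓘(ℝ, ℝ) 2 v := fun x => by
    have h1 : ContMDiffAt 𝓘(ℝ, ℝ) 𝓘(ℝ, ℝ) 2 (fun s : ℝ => -Real.log s) (M x) :=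
      (Real.contDiffAt_log.2 (hM_pos x).ne').neg.contMDiffAt
    rw [funext hv]
    exact h1.comp x (hM_smooth x)
  have hint : Integrable (fun x => χ x * M x) ρ :=
    (SubRiemannianLie.integrable_withDensity_ofReal_iff hχ_cont.measurable hχ_pos M).1 hM_int
  have hint' : Integrable (fun x => χ x * Real.exp (-v x)) ρ := by
    simpa only [hMexp] using hint
  have H := SubRiemannianLie.isFlowPotential_of_contMDiff hγ hγX hX hχ_cont hχ_pos hv2
  obtain ⟨η, η', δ, hη⟩ := SubRiemannianLie.exists_isCutoffSequence_lieGroup hγ hγX hX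
  obtain ⟨K, hK, hRK⟩ := SubRiemannianLie.exists_isCompact_ccBall_subset X R
  -- The ball is replaced by a compact superset, since the weighted estimates need bounds of
  -- continuous functions on the exceptional set.
  have hKv : ∀ x, x ∉ K → c ≤ a * ∑ j, SubRiemannianLie.lieDeriv (X j) v x ^ 2 -
      ∑ j, (SubRiemannianLie.lieDeriv (X j) (SubRiemannianLie.lieDeriv (X j) v) x +
        SubRiemannianLie.lieDeriv (X j) χ 1 * SubRiemannianLie.lieDeriv (X j) v x) :=
    fun x hx => h x fun hx' => hx (hRK hx')
  have hbdd : BddBelow (range v) := H.bddBelow hη hint' ha.2 hc hK hKv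
  have hLyap := SubRiemannianLie.isLyapunovFunction_exp (χ := χ) hv2 hMv hbdd ha.2 hc hR h
  obtain ⟨C, hC, hP⟩ := H.poincare hη hint' ha.2 hc hK hKv
  simp only [hMexp] at hP
  exact ⟨hbdd, hLyap, ⟨_, hLyap⟩, SubRiemannianLie.globalPoincare_of_flow hγ hγX
    hχ_cont.measurable hχ_pos hM_smooth.continuous.measurable hM_pos hint hC hP⟩
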